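/- Let $\mu_1,\mu_2$ be finite positive Borel measures on the unit circle $\mathbb T$. Put $P_{\mu}(z)=\frac1{2\pi}\int_{\mathbb T}\frac{1-|z|^2}{|\xi-z|^2}\,d\mu(\xi)$ for $z$ in the open unit disc $\mathbb D$, and let $dA$ be normalized area measure on $\mathbb D$. For a finite positive Borel measure $\mu$ on $\mathbb T$, let $\mathcal D(\mu)$ be the space of all holomorphic $f$ on $\mathbb D$ with $$\|f\|^2_{\mathcal D(\mu)}=\|f\|^2_{H^2(\mathbb D)}+\int_{\mathbb D}|f'|^2P_\mu\,dA<\infty .$$ Let $\mathcal D^2(\boldsymbol\mu)$, $\boldsymbol\mu=\mu_1\times\mu_2$, be the space of all holomorphic $f$ on $\mathbb D^2$ with $$\|f\|_{\boldsymbol\mu}^2=\|f\|^2_{H^2(\mathbb D^2)}+D_1(f)+D_2(f)+D_3(f)<\infty ,$$ where $$D_1(f)=\lim_{r\to1^-}\frac1{2\pi}\int_0^{2\pi}\!\!\int_{\mathbb D}\left|\tfrac{\partial f}{\partial z_1}(z_1,re^{it})\right|^2P_{\mu_1}(z_1)\,dA(z_1)\,dt,$$ $$D_2(f)=\lim_{r\to1^-}\frac1{2\pi}\int_0^{2\pi}\!\!\int_{\mathbb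 D}\left|\tfrac{\partial f}{\partial z_2}(re^{it},z_2)\right|^2P_{\mu_2}(z_2)\,dA(z_2)\,dt,$$ $$D_3(f)=\iint_{\mathbb D^2}\left|\tfrac{\partial^2 f}{\partial z_1\partial z_2}\right|^2P_{\mu_1}(z_1)P_{\mu_2}(z_2)\,dA(z_1)\,dA(z_2).$$ (If $\mu\ne0$, respectively if $\mu_1\neq0$ and $\mu_2\ne0$, finiteness of the $H^2$ norm is automatic. The norm of $\mathcal D^2(\boldsymbol\mu)$ depends on the pair $(\mu_1,\mu_2)$.) Then $\mathcal D(\mu_1)$, $\mathcal D(\mu_2)$ and $\mathcal D^2(\boldsymbol\mu)$ are Hilbert spaces. Multiplication by the coordinate functions defines bounded operators $M_{z_1},M_{z_2}$ on $\mathcal D^2(\boldsymbol\mu)$, and multiplication by $z$ defines bounded operators $M_z$ on $\mathcal D(\mu_1)$ and on $\mathcal D(\mu_2)$. The operators $M_{z_1},M_{z_2}$ are commuting $2$-isometries, that is, $\|M_{z_i}^2f\|^2-2\|M_{z_i}f\|^2+\|f\|^2=0$ for all $f$. The pair $(M_{z_1},M_{z_2})$ is unitarily equivalent to the pair $(M_z\otimes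 I,\ I\otimes M_z)$ on the Hilbert space tensor product $\mathcal D(\mu_1)\otimes\mathcal D(\mu_2)$: there is one unitary $U:\mathcal D^2(\boldsymbol\mu)\to\mathcal D(\mu_1)\otimes\mathcal D(\mu_2)$ with $UM_{z_1}=(M_z\otimes I)U$ and $UM_{z_2}=(I\otimes M_z)U$. In particular the pair is doubly commuting: $M_{z_1}M_{z_2}=M_{z_2}M_{z_1}$ and $M_{z_1}^*M_{z_2}=M_{z_2}M_{z_1}^*$. Moreover the three spaces have reproducing kernels $K^{\mu_1}$, $K^{\mu_2}$, $K$ respectively, and $$K\big((z_1,z_2),(w_1,w_2)\big)=K^{\mu_1}(z_1,w_1)\,K^{\mu_2}(z_2,w_2),\qquad (z_1,z_2),(w_1,w_2)\in\mathbb D^2 .$$ -/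

import Mathlib

open MeasureTheory Set Filter Topology
open scoped ENNReal InnerProductSpace

namespace DirichletType

/-- A `[0, ∞]`-valued functional on a complex vector space that behaves like the square of a
(possibly infinite) Hilbert norm.  For `s = 1` the second law is the parallelogram law. -/
structure IsQuad {V : Type*} [AddCommGroup V] [Module ℂ V] (Q : V → ℝ≥0∞) : Prop where
  smul : ∀ (c : ℂ) (f : V), Q (c • f) = ‖c‖ₑ ^ 2 * Q f
  par : ∀ (s : ℝ), 0 < s → ∀ f g : V,
    Q (f + g) + Q ((s : ℂ) • f - ((s⁻¹ : ℝ) : ℂ) • g) =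
      ENNReal.ofReal (1 + s ^ 2) * Q f + ENNReal.ofReal (1 + s⁻¹ ^ 2) * Q g

section IsQuad

variable {V : Type*} [AddCommGroup V] [Module ℂ V]

theorem enorm_par (s : ℝ) (hs : 0 < s) (a b : ℂ) :
    ‖a + b‖ₑ ^ 2 + ‖(s : ℂ) * a - ((s⁻¹ : ℝ) : ℂ) * b‖ₑ ^ 2 =
      ENNReal.ofReal (1 + s ^ 2) * ‖a‖ₑ ^ 2 + ENNReal.ofReal (1 + s⁻¹ ^ 2) * ‖b‖ₑ ^ 2 := by
  have e : ∀ z : ℂ, ‖z‖ₑ ^ 2 = ENNReal.ofReal (‖z‖ ^ 2) := fun z => by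
    rw [ENNReal.ofReal_pow (norm_nonneg _), ofReal_norm]
  simp only [e]
  rw [← ENNReal.ofReal_add (by positivity) (by positivity),
    ← ENNReal.ofReal_mul (by positivity), ← ENNReal.ofReal_mul (by positivity),
    ← ENNReal.ofReal_add (by positivity) (by positivity)]
  congr 1
  simp only [Complex.sq_norm, Complex.normSq_apply]
  simp
  field_simp
  ring

theorem IsQuad.of_linear {L : V → ℂ} (hL : IsLinearMap ℂ L) : IsQuad (fun f => ‖L f‖ₑ ^ 2) where
  smul c f := by simp [hL.map_smul, mul_pow]
  par s hs f g := by
    simp only [hL.map_add, hL.map_sub, hL.map_smul, smul_eq_mul]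
    exact enorm_par s hs _ _

theorem IsQuad.add {Q R : V → ℝ≥0∞} (hQ : IsQuad Q) (hR : IsQuad R) :
    IsQuad (fun f => Q f + R f) where
  smul c f := by simp only [hQ.smul, hR.smul]; ring
  par s hs f g := by
    have h1 := hQ.par s hs f g
    have h2 := hR.par s hs f g
    rw [add_add_add_comm, h1, h2]; ring

theorem IsQuad.const_mul {Q : V → ℝ≥0∞} (hQ : IsQuad Q) (c : ℝ≥0∞) :
    IsQuad (fun f => c * Q f) where
  smul a f := by simp only [hQ.smul]; ring
  par s hs f g := by
    rw [← mul_add, hQ.par s hs f g]; ring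

theorem IsQuad.lintegral {α : Type*} [MeasurableSpace α] {ν : Measure α} {Q : α → V → ℝ≥0∞}
    (hm : ∀ f, AEMeasurable (fun x => Q x f) ν) (hQ : ∀ᵐ x ∂ν, IsQuad (Q x)) :
    IsQuad (fun f => ∫⁻ x, Q x f ∂ν) where
  smul c f := by
    rw [← lintegral_const_mul'' _ (hm f)]
    exact lintegral_congr_ae (hQ.mono fun x hx => hx.smul c f)
  par s hs f g := by
    rw [← lintegral_add_left' (hm _), ← lintegral_const_mul'' _ (hm f),
      ← lintegral_const_mul'' _ (hm g), ← lintegral_add_left' ((hm f).const_mul _)]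
    exact lintegral_congr_ae (hQ.mono fun x hx => hx.par s hs f g)

theorem IsQuad.of_tendsto {ι : Type*} {l : Filter ι} [l.NeBot] {Q : ι → V → ℝ≥0∞} {R : V → ℝ≥0∞}
    (hQ : ∀ᶠ i in l, IsQuad (Q i)) (hR : ∀ f, Tendsto (fun i => Q i f) l (𝓝 (R f))) :
    IsQuad R where
  smul c f := by
    refine tendsto_nhds_unique (hR (c • f)) (Tendsto.congr' ?_
      (ENNReal.Tendsto.const_mul (hR f) (Or.inr (by simp))))
    exact hQ.mono fun i hi => (hi.smul c f).symm
  par s hs f g := by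
    refine tendsto_nhds_unique ((hR _).add (hR _)) (Tendsto.congr' ?_
      ((ENNReal.Tendsto.const_mul (hR f) (Or.inr ENNReal.ofReal_ne_top)).add
      (ENNReal.Tendsto.const_mul (hR g) (Or.inr ENNReal.ofReal_ne_top))))
    exact hQ.mono fun i hi => (hi.par s hs f g).symm

theorem IsQuad.parallelogram {Q : V → ℝ≥0∞} (hQ : IsQuad Q) (f g : V) :
    Q (f + g) + Q (f - g) = 2 * Q f + 2 * Q g := by
  have := hQ.par 1 one_pos f g
  have h2 : ENNReal.ofReal 2 = 2 := by simp
  norm_num at this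
  exact this

end IsQuad

/-- The space of all vectors of finite energy, for a functional that satisfies the laws of a squared
norm. -/
def finiteEnergy {V : Type*} [AddCommGroup V] [Module ℂ V] (Q : V → ℝ≥0∞) (hQ : IsQuad Q) :
    Submodule ℂ V where
  carrier := {f | Q f < ∞}
  zero_mem' := by
    have := hQ.smul 0 0
    simp at this
    simp [this]
  add_mem' {f g} hf hg := by
    have h := hQ.parallelogram f g
    refine lt_of_le_of_lt (le_self_add.trans h.le) ?_
    exact ENNReal.add_lt_top.2 ⟨ENNReal.mul_lt_top (by simp) hf, ENNReal.mul_lt_top (by simp) hg⟩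
  smul_mem' c f hf := by
    simp only [mem_ofPred_eq, hQ.smul]
    exact ENNReal.mul_lt_top (by simp) hf

/-- A squared Hilbert norm on a complex vector space, infinite values being allowed. -/
structure IsEnergy {V : Type*} [AddCommGroup V] [Module ℂ V] (Q : V → ℝ≥0∞) : Prop
    extends IsQuad Q where
  definite : ∀ f, Q f = 0 → f = 0

/-- The vectors of finite energy as an inner product space; the norm is `‖f‖ = (Q f) ^ (1/2)`. -/
def EnergySpace {V : Type*} [AddCommGroup V] [Module ℂ V] (Q : V → ℝ≥0∞) (hQ : IsEnergy Q) : Type _ :=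
  finiteEnergy Q hQ.toIsQuad

namespace EnergySpace

variable {V : Type*} [AddCommGroup V] [Module ℂ V] {Q : V → ℝ≥0∞} {hQ : IsEnergy Q}

noncomputable instance : AddCommGroup (EnergySpace Q hQ) :=
  inferInstanceAs (AddCommGroup (finiteEnergy Q hQ.toIsQuad))

noncomputable instance : Module ℂ (EnergySpace Q hQ) :=
  inferInstanceAs (Module ℂ (finiteEnergy Q hQ.toIsQuad))

/-- The inclusion of the finite-energy vectors into the ambient space. -/
def val : EnergySpace Q hQ →ₗ[ℂ] V := (finiteEnergy Q hQ.toIsQuad).subtype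

theorem energy_lt_top (f : EnergySpace Q hQ) : Q f.val < ∞ := f.2

theorem val_injective : Function.Injective (val : EnergySpace Q hQ → V) := Subtype.val_injective

noncomputable instance : Norm (EnergySpace Q hQ) := ⟨fun f => Real.sqrt (Q f.val).toReal⟩

theorem norm_def (f : EnergySpace Q hQ) : ‖f‖ = Real.sqrt (Q f.val).toReal := rfl

theorem norm_sq (f : EnergySpace Q hQ) : ‖f‖ ^ 2 = (Q f.val).toReal :=
  Real.sq_sqrt ENNReal.toReal_nonneg

theorem par_real (s : ℝ) (hs : 0 < s) (f g : EnergySpace Q hQ) :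
    ‖f + g‖ ^ 2 + ‖(s : ℂ) • f - ((s⁻¹ : ℝ) : ℂ) • g‖ ^ 2 =
      (1 + s ^ 2) * ‖f‖ ^ 2 + (1 + s⁻¹ ^ 2) * ‖g‖ ^ 2 := by
  have h := congrArg ENNReal.toReal (hQ.par s hs f.val g.val)
  rw [← map_add, ← map_smul, ← map_smul, ← map_sub,
    ENNReal.toReal_add (energy_lt_top (f + g)).ne
      (energy_lt_top ((s : ℂ) • f - ((s⁻¹ : ℝ) : ℂ) • g)).ne,
    ENNReal.toReal_add (ENNReal.mul_ne_top ENNReal.ofReal_ne_top (energy_lt_top f).ne)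
      (ENNReal.mul_ne_top ENNReal.ofReal_ne_top (energy_lt_top g).ne),
    ENNReal.toReal_mul, ENNReal.toReal_mul, ENNReal.toReal_ofReal (by positivity),
    ENNReal.toReal_ofReal (by positivity)] at h
  simp only [norm_sq]
  exact h

theorem normCore : NormedSpace.Core ℂ (EnergySpace Q hQ) where
  norm_nonneg _ := Real.sqrt_nonneg _
  norm_smul c f := by
    rw [norm_def, map_smul, hQ.smul, ENNReal.toReal_mul, Real.sqrt_mul ENNReal.toReal_nonneg,
      ENNReal.toReal_pow, Real.sqrt_sq ENNReal.toReal_nonneg]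
    simp [norm_def]
  norm_triangle f g := by
    have hf : 0 ≤ ‖f‖ := Real.sqrt_nonneg _
    have hg : 0 ≤ ‖g‖ := Real.sqrt_nonneg _
    refine le_of_sq_le_sq ?_ (by positivity)
    refine le_of_forall_pos_le_add fun δ hδ => ?_
    set ε := δ / (‖f‖ + ‖g‖ + 1) with hε
    have hε0 : 0 < ε := by positivity
    have hx : 0 < ‖f‖ + ε := by positivity
    have hy : 0 < ‖g‖ + ε := by positivity
    set s := Real.sqrt ((‖g‖ + ε) / (‖f‖ + ε)) with hs
    have hs0 : 0 < s := Real.sqrt_pos.2 (by positivity)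
    have hs2 : s ^ 2 = (‖g‖ + ε) / (‖f‖ + ε) := Real.sq_sqrt (by positivity)
    have h := par_real s hs0 f g
    have h' : ‖f + g‖ ^ 2 ≤ (1 + s ^ 2) * ‖f‖ ^ 2 + (1 + s⁻¹ ^ 2) * ‖g‖ ^ 2 := by
      rw [← h]; nlinarith [sq_nonneg ‖(s : ℂ) • f - ((s⁻¹ : ℝ) : ℂ) • g‖]
    refine h'.trans ?_
    rw [inv_pow, hs2, inv_div]
    have e1 : (‖g‖ + ε) / (‖f‖ + ε) * ‖f‖ ^ 2 ≤ (‖g‖ + ε) * ‖f‖ := by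
      rw [div_mul_eq_mul_div, div_le_iff₀ hx]; nlinarith [mul_nonneg hy.le hf]
    have e2 : (‖f‖ + ε) / (‖g‖ + ε) * ‖g‖ ^ 2 ≤ (‖f‖ + ε) * ‖g‖ := by
      rw [div_mul_eq_mul_div, div_le_iff₀ hy]; nlinarith [mul_nonneg hx.le hg]
    have e3 : ε * (‖f‖ + ‖g‖) ≤ δ := by
      rw [hε, div_mul_eq_mul_div, div_le_iff₀ (by positivity)]; nlinarith
    nlinarith
  norm_eq_zero_iff f := by
    constructor
    · intro h
      have h2 : (Q f.val).toReal = 0 := by rw [← norm_sq, h]; simp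
      have h3 : Q f.val = 0 := by
        rcases (ENNReal.toReal_eq_zero_iff _).1 h2 with h | h
        · exact h
        · exact absurd h (energy_lt_top f).ne
      exact val_injective (by rw [hQ.definite _ h3, map_zero])
    · rintro rfl
      have := hQ.smul 0 0
      simp at this
      simp [norm_def, this]

noncomputable instance : NormedAddCommGroup (EnergySpace Q hQ) := NormedAddCommGroup.ofCore normCore

noncomputable instance : NormedSpace ℂ (EnergySpace Q hQ) := NormedSpace.ofCore normCore

noncomputable instance : InnerProductSpace ℂ (EnergySpace Q hQ) :=
  InnerProductSpace.ofNorm ℂ fun f g => by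
    have h := par_real 1 one_pos f g
    norm_num at h
    nlinarith

end EnergySpace


/-- The mean `(2π)⁻¹ ∫₀^{2π} F(t) dt`. -/
noncomputable def angleMean (F : ℝ → ℝ≥0∞) : ℝ≥0∞ :=
  ENNReal.ofReal (2 * Real.pi)⁻¹ * ∫⁻ t in Ioc 0 (2 * Real.pi), F t

section Parseval

theorem hasSum_circleMap {h : ℂ → ℂ} (hh : AnalyticOnNhd ℂ h (Metric.ball 0 1)) {r : ℝ}
    (hr : 0 ≤ r) (hr1 : r < 1) (t : ℝ) :
    HasSum (fun n : ℕ => ((n.factorial : ℂ)⁻¹ * iteratedDeriv n h 0 * (r : ℂ) ^ n) *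
      Complex.exp (n * t * Complex.I)) (h (circleMap 0 r t)) := by
  have hz : circleMap 0 r t ∈ Metric.ball (0 : ℂ) 1 := by
    simp [circleMap, abs_of_nonneg hr, hr1]
  have := Complex.hasSum_taylorSeries_on_ball (c := (0 : ℂ)) (r := 1) hh.differentiableOn hz
  have e : ∀ n : ℕ, ((n.factorial : ℂ)⁻¹ * iteratedDeriv n h 0 * (r : ℂ) ^ n) *
      Complex.exp (n * t * Complex.I) =
      (n.factorial : ℂ)⁻¹ • (circleMap 0 r t - 0) ^ n • iteratedDeriv n h 0 := fun n => ?_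
  · simpa only [e] using this
  simp only [circleMap, sub_zero, zero_add, mul_pow, ← Complex.exp_nat_mul, smul_eq_mul, mul_assoc]
  ring

theorem summable_coeff {h : ℂ → ℂ} (hh : AnalyticOnNhd ℂ h (Metric.ball 0 1)) {r : ℝ}
    (hr : 0 ≤ r) (hr1 : r < 1) :
    Summable (fun n : ℕ => ‖(n.factorial : ℂ)⁻¹ * iteratedDeriv n h 0 * (r : ℂ) ^ n‖) := by
  have := (hasSum_circleMap hh hr hr1 0).summable.norm
  simpa using this

theorem integral_exp_int (m : ℤ) :
    ∫ t in (0 : ℝ)..(2 * Real.pi), Complex.exp (m * t * Complex.I) =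
      if m = 0 then 2 * Real.pi else 0 := by
  split_ifs with hm
  · simp [hm]
  · have hc : (m : ℂ) * Complex.I ≠ 0 := by simp [hm]
    have := integral_exp_mul_complex (a := 0) (b := 2 * Real.pi) hc
    have e : ∀ t : ℝ, (m : ℂ) * t * Complex.I = m * Complex.I * t := fun t => by ring
    simp only [e, this]
    have : (m : ℂ) * Complex.I * ((2 * Real.pi : ℝ) : ℂ) = m * (2 * Real.pi * Complex.I) := by
      push_cast; ring
    rw [this, Complex.exp_int_mul_two_pi_mul_I]
    simp

theorem fourierCoeffOn_circleMap {h : ℂ → ℂ} (hh : AnalyticOnNhd ℂ h (Metric.ball 0 1)) {r : ℝ}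
    (hr : 0 ≤ r) (hr1 : r < 1) (m : ℤ) :
    fourierCoeffOn Real.two_pi_pos (fun t => h (circleMap 0 r t)) m =
      ∑' n : ℕ, if (n : ℤ) = m then
        (n.factorial : ℂ)⁻¹ * iteratedDeriv n h 0 * (r : ℂ) ^ n else 0 := by
  rw [fourierCoeffOn_eq_integral]
  set c : ℕ → ℂ := fun n => (n.factorial : ℂ)⁻¹ * iteratedDeriv n h 0 * (r : ℂ) ^ n with hc
  have key := intervalIntegral.hasSum_intervalIntegral_of_summable_norm (a := 0) (b := 2 * Real.pi)
    (f := fun n : ℕ => (⟨fun t : ℝ => c n * Complex.exp (((n - m : ℤ) : ℂ) * t * Complex.I),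
      by fun_prop⟩ : C(ℝ, ℂ))) (by
      refine (summable_coeff hh hr hr1).of_nonneg_of_le (fun _ => norm_nonneg _) fun n => ?_
      refine (ContinuousMap.norm_le _ (norm_nonneg _)).2 fun t => ?_
      have : ‖Complex.exp (((n - m : ℤ) : ℂ) * (t : ℝ) * Complex.I)‖ = 1 := by
        have := Complex.norm_exp_ofReal_mul_I (((n - m : ℤ) : ℝ) * t)
        push_cast at this ⊢
        exact this
      simp only [ContinuousMap.restrict_apply, ContinuousMap.coe_mk, norm_mul, this, mul_one, hc]
      exact le_rfl)
  have e1 : ∀ n : ℕ, ∫ t in (0 : ℝ)..(2 * Real.pi),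
      c n * Complex.exp (((n - m : ℤ) : ℂ) * t * Complex.I) =
      (2 * Real.pi : ℂ) * if (n : ℤ) = m then c n else 0 := by
    intro n
    rw [intervalIntegral.integral_const_mul, integral_exp_int]
    simp only [sub_eq_zero]
    split_ifs <;> push_cast <;> ring
  simp only [ContinuousMap.coe_mk, e1] at key
  have e2 : ∀ t : ℝ, ∑' n : ℕ, c n * Complex.exp (((n - m : ℤ) : ℂ) * t * Complex.I) =
      fourier (-m) (t : AddCircle (2 * Real.pi - 0)) • h (circleMap 0 r t) := by
    intro t
    rw [fourier_coe_apply, ← (hasSum_circleMap hh hr hr1 t).tsum_eq, smul_eq_mul, ← tsum_mul_left]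
    congr 1 with n
    rw [mul_left_comm, ← Complex.exp_add]
    congr 2
    have : (Real.pi : ℂ) ≠ 0 := by simp
    push_cast
    field_simp
    ring
  simp only [e2] at key
  have hpi : (Real.pi : ℂ) ≠ 0 := by simp
  have h3 := key.tsum_eq
  rw [tsum_mul_left] at h3
  rw [← h3, sub_zero, Complex.real_smul, ← mul_assoc]
  push_cast
  rw [one_div, inv_mul_cancel₀ (by simp), one_mul]

/-- Parseval's identity on circles. -/
theorem angleMean_eq {h : ℂ → ℂ} (hh : AnalyticOnNhd ℂ h (Metric.ball 0 1)) {r : ℝ}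
    (hr : 0 ≤ r) (hr1 : r < 1) :
    angleMean (fun t => ‖h (circleMap 0 r t)‖ₑ ^ 2) =
      ∑' n : ℕ, ‖(n.factorial : ℂ)⁻¹ * iteratedDeriv n h 0‖ₑ ^ 2 * ENNReal.ofReal (r ^ 2) ^ n := by
  have hcont : Continuous fun t => h (circleMap 0 r t) := by
    refine hh.continuousOn.comp_continuous (continuous_circleMap 0 r) fun t => ?_
    simp [circleMap, abs_of_nonneg hr, hr1]
  have hs := hasSum_sq_fourierCoeffOn (a := 0) (b := 2 * Real.pi) Real.two_pi_pos
    (f := fun t => h (circleMap 0 r t)) (by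
      refine (memLp_two_iff_integrable_sq_norm hcont.aestronglyMeasurable).2 ?_
      exact ((hcont.norm.pow 2).integrableOn_Icc).mono_set Ioc_subset_Icc_self)
  have hcoe : ∀ n : ℕ, fourierCoeffOn Real.two_pi_pos (fun t => h (circleMap 0 r t)) n =
      (n.factorial : ℂ)⁻¹ * iteratedDeriv n h 0 * (r : ℂ) ^ n := by
    intro n
    rw [fourierCoeffOn_circleMap hh hr hr1, tsum_eq_single n]
    · simp
    · intro k hk; simp [hk]
  have hneg : ∀ m : ℤ, m ∉ range ((↑) : ℕ → ℤ) →
      ‖fourierCoeffOn Real.two_pi_pos (fun t => h (circleMap 0 r t)) m‖ ^ 2 = 0 := by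
    intro m hm
    rw [fourierCoeffOn_circleMap hh hr hr1]
    have : ∀ n : ℕ, (n : ℤ) ≠ m := fun n hn => hm ⟨n, hn⟩
    simp [this]
  have hs2 : HasSum (fun n : ℕ => ‖(n.factorial : ℂ)⁻¹ * iteratedDeriv n h 0 * (r : ℂ) ^ n‖ ^ 2)
      ((2 * Real.pi - 0)⁻¹ • ∫ t in (0 : ℝ)..(2 * Real.pi), ‖h (circleMap 0 r t)‖ ^ 2) := by
    have := (Function.Injective.hasSum_iff Nat.cast_injective hneg).2 hs
    simp only [Function.comp_def, hcoe] at this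
    exact this
  have hL : angleMean (fun t => ‖h (circleMap 0 r t)‖ₑ ^ 2) = ENNReal.ofReal
      ((2 * Real.pi - 0)⁻¹ • ∫ t in (0 : ℝ)..(2 * Real.pi), ‖h (circleMap 0 r t)‖ ^ 2) := by
    rw [angleMean, sub_zero, smul_eq_mul, ENNReal.ofReal_mul (by positivity),
      intervalIntegral.integral_of_le Real.two_pi_pos.le,
      ofReal_integral_eq_lintegral_ofReal]
    · congr 2 with t
      rw [ENNReal.ofReal_pow (norm_nonneg _), ofReal_norm]
    · exact ((hcont.norm.pow 2).integrableOn_Icc).mono_set Ioc_subset_Icc_self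
    · exact ae_of_all _ fun t => by positivity
  rw [hL, ← hs2.tsum_eq, ENNReal.ofReal_tsum_of_nonneg (fun _ => sq_nonneg _) hs2.summable]
  refine tsum_congr fun n => ?_
  have hre : ‖(r : ℂ)‖ₑ = ENNReal.ofReal r := by
    rw [← ofReal_norm, Complex.norm_real, Real.norm_of_nonneg hr]
  rw [ENNReal.ofReal_pow (norm_nonneg _), ofReal_norm, enorm_mul, mul_pow, enorm_pow, hre,
    ENNReal.ofReal_pow hr, ← pow_mul, ← pow_mul, mul_comm n 2]

theorem angleMean_mono {h : ℂ → ℂ} (hh : AnalyticOnNhd ℂ h (Metric.ball 0 1)) {r s : ℝ}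
    (hr : 0 ≤ r) (hrs : r ≤ s) (hs : s < 1) :
    angleMean (fun t => ‖h (circleMap 0 r t)‖ₑ ^ 2) ≤
      angleMean (fun t => ‖h (circleMap 0 s t)‖ₑ ^ 2) := by
  rw [angleMean_eq hh hr (hrs.trans_lt hs), angleMean_eq hh (hr.trans hrs) hs]
  gcongr

end Parseval
/-- The normalized area integral `π⁻¹ ∫_𝔻 F(z) dx dy` over the unit disc. -/
noncomputable def areaInt (F : ℂ → ℝ≥0∞) : ℝ≥0∞ :=
  ENNReal.ofReal Real.pi⁻¹ * ∫⁻ z in Metric.ball (0 : ℂ) 1, F z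

/-- The limit of `F(r)` as `r → 1⁻`.  It is written as an upper limit so as to be defined for every
`F`; all the quantities `F` below are nondecreasing in `r`, so the limit exists
(`tendsto_radialLim`). -/
noncomputable def radialLim (F : ℝ → ℝ≥0∞) : ℝ≥0∞ := limsup F (𝓝[<] 1)

theorem tendsto_radialLim {F : ℝ → ℝ≥0∞} (hF : ∀ r s, 0 ≤ r → r ≤ s → s < 1 → F r ≤ F s) :
    Tendsto F (𝓝[<] 1) (𝓝 (radialLim F)) := by
  have h : Tendsto F (𝓝[<] 1) (𝓝 (⨆ r ∈ Ico (0 : ℝ) 1, F r)) := by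
    refine tendsto_order.2 ⟨fun a ha => ?_, fun a ha => ?_⟩
    · obtain ⟨r, hr, har⟩ : ∃ r, ∃ _ : r ∈ Ico (0 : ℝ) 1, a < F r := by simpa only [lt_iSup_iff] using ha
      filter_upwards [Ioo_mem_nhdsLT hr.2] with s hs
      exact har.trans_le (hF r s hr.1 hs.1.le hs.2)
    · filter_upwards [Ioo_mem_nhdsLT (zero_lt_one' ℝ)] with s hs
      exact lt_of_le_of_lt (le_iSup₂ (f := fun r (_ : r ∈ Ico (0 : ℝ) 1) => F r) s
        ⟨hs.1.le, hs.2⟩) ha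
  rw [radialLim, h.limsup_eq]
  exact h

theorem le_radialLim {F : ℝ → ℝ≥0∞} (hF : ∀ r s, 0 ≤ r → r ≤ s → s < 1 → F r ≤ F s) {r : ℝ}
    (hr : 0 ≤ r) (hr1 : r < 1) : F r ≤ radialLim F := by
  refine ge_of_tendsto (tendsto_radialLim hF) ?_
  filter_upwards [Ioo_mem_nhdsLT hr1] with s hs
  exact hF r s hr hs.1.le hs.2

theorem radialLim_isQuad {V : Type*} [AddCommGroup V] [Module ℂ V] {Q : ℝ → V → ℝ≥0∞}
    (hQ : ∀ r, 0 ≤ r → r < 1 → IsQuad (Q r))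
    (hm : ∀ f r s, 0 ≤ r → r ≤ s → s < 1 → Q r f ≤ Q s f) :
    IsQuad (fun f => radialLim (fun r => Q r f)) := by
  refine IsQuad.of_tendsto (l := 𝓝[<] (1 : ℝ)) ?_ fun f => tendsto_radialLim (hm f)
  filter_upwards [Ioo_mem_nhdsLT (zero_lt_one' ℝ)] with r hr using hQ r hr.1.le hr.2

theorem angleMean_isQuad {V : Type*} [AddCommGroup V] [Module ℂ V] {Q : ℝ → V → ℝ≥0∞}
    (hm : ∀ f, AEMeasurable (fun t => Q t f) (volume.restrict (Ioc 0 (2 * Real.pi))))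
    (hQ : ∀ t, IsQuad (Q t)) : IsQuad (fun f => angleMean (fun t => Q t f)) :=
  (IsQuad.lintegral hm (ae_of_all _ hQ)).const_mul _

theorem areaInt_isQuad {V : Type*} [AddCommGroup V] [Module ℂ V] {Q : ℂ → V → ℝ≥0∞}
    (hm : ∀ f, AEMeasurable (fun t => Q t f) (volume.restrict (Metric.ball (0 : ℂ) 1)))
    (hQ : ∀ z ∈ Metric.ball (0 : ℂ) 1, IsQuad (Q z)) :
    IsQuad (fun f => areaInt (fun z => Q z f)) :=
  (IsQuad.lintegral hm
    ((ae_restrict_iff' Metric.isOpen_ball.measurableSet).2 (ae_of_all _ hQ))).const_mul _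

/-- The open unit bidisc `𝔻 × 𝔻`. -/
def bidisc : Set (ℂ × ℂ) := Metric.ball 0 1 ×ˢ Metric.ball 0 1

theorem isOpen_bidisc : IsOpen bidisc := Metric.isOpen_ball.prod Metric.isOpen_ball

/-- The space `𝒪(Ω)` of holomorphic functions on an open set `Ω`.  A function on `Ω` is represented
by its extension by zero to the whole space. -/
def holo {E : Type*} [NormedAddCommGroup E] [NormedSpace ℂ E] (Ω : Set E) :
    Submodule ℂ (E → ℂ) where
  carrier := {f | AnalyticOnNhd ℂ f Ω ∧ ∀ z ∉ Ω, f z = 0}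
  zero_mem' := ⟨fun _ _ => analyticAt_const, fun _ _ => rfl⟩
  add_mem' {f g} hf hg := ⟨hf.1.add hg.1, fun z hz => by simp [hf.2 z hz, hg.2 z hz]⟩
  smul_mem' c f hf := ⟨fun z hz => analyticAt_const.smul (hf.1 z hz),
    fun z hz => by simp [hf.2 z hz]⟩

/-- The partial derivative `∂f/∂z₁`. -/
noncomputable def partial₁ (f : ℂ × ℂ → ℂ) (z : ℂ × ℂ) : ℂ := fderiv ℂ f z (1, 0)

/-- The partial derivative `∂f/∂z₂`. -/
noncomputable def partial₂ (f : ℂ × ℂ → ℂ) (z : ℂ × ℂ) : ℂ := fderiv ℂ f z (0, 1)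

/-- The Poisson integral `P_μ(z) = (2π)⁻¹ ∫ (1 - |z|²) / |ξ - z|² dμ(ξ)` of a measure on the unit
circle. -/
noncomputable def poisson (μ : Measure (Metric.sphere (0 : ℂ) 1)) (z : ℂ) : ℝ :=
  (2 * Real.pi)⁻¹ * ∫ ξ, (1 - ‖z‖ ^ 2) / ‖(ξ : ℂ) - z‖ ^ 2 ∂μ

/-- The squared norm of the Hardy space `H²(𝔻)`. -/
noncomputable def hardySq₁ (f : ℂ → ℂ) : ℝ≥0∞ :=
  radialLim fun r => angleMean fun t => ‖f (circleMap 0 r t)‖ₑ ^ 2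

/-- The Dirichlet-type integral `∫_𝔻 |f'|² P_μ dA` on the unit disc. -/
noncomputable def dirichlet₁ (μ : Measure (Metric.sphere (0 : ℂ) 1)) (f : ℂ → ℂ) : ℝ≥0∞ :=
  areaInt fun z => ENNReal.ofReal (poisson μ z) * ‖deriv f z‖ₑ ^ 2

/-- The squared norm of the Hardy space `H²(𝔻²)`. -/
noncomputable def hardySq₂ (f : ℂ × ℂ → ℂ) : ℝ≥0∞ :=
  radialLim fun r => angleMean fun s => angleMean fun t =>
    ‖f (circleMap 0 r s, circleMap 0 r t)‖ₑ ^ 2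

section Dirichlet₂

variable (μ₁ μ₂ : Measure (Metric.sphere (0 : ℂ) 1)) (f : ℂ × ℂ → ℂ)

/-- `lim_{r → 1⁻} (2π)⁻¹ ∬_{𝔻 × 𝕋} |∂₁ f (z₁, r e^{it})|² P_{μ₁}(z₁) dA(z₁) dt`. -/
noncomputable def dirichlet₂₁ : ℝ≥0∞ :=
  radialLim fun r => areaInt fun z => ENNReal.ofReal (poisson μ₁ z) *
    angleMean fun t => ‖partial₁ f (z, circleMap 0 r t)‖ₑ ^ 2

/-- `lim_{r → 1⁻} (2π)⁻¹ ∬_{𝕋 × 𝔻} |∂₂ f (r e^{it}, z₂)|² P_{μ₂}(z₂) dA(z₂) dt`. -/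
noncomputable def dirichlet₂₂ : ℝ≥0∞ :=
  radialLim fun r => areaInt fun z => ENNReal.ofReal (poisson μ₂ z) *
    angleMean fun t => ‖partial₂ f (circleMap 0 r t, z)‖ₑ ^ 2

/-- `∬_{𝔻²} |∂₁ ∂₂ f (z₁, z₂)|² P_{μ₁}(z₁) P_{μ₂}(z₂) dA(z₁) dA(z₂)`. -/
noncomputable def dirichlet₂₃ : ℝ≥0∞ :=
  areaInt fun z₁ => areaInt fun z₂ => ENNReal.ofReal (poisson μ₁ z₁ * poisson μ₂ z₂) *
    ‖partial₁ (partial₂ f) (z₁, z₂)‖ₑ ^ 2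

/-- The Dirichlet-type integral on the unit bidisc. -/
noncomputable def dirichlet₂ : ℝ≥0∞ := dirichlet₂₁ μ₁ f + dirichlet₂₂ μ₂ f + dirichlet₂₃ μ₁ μ₂ f

end Dirichlet₂

section Energy

theorem eq_zero_of_angleMean {h : ℂ → ℂ} (hh : AnalyticOnNhd ℂ h (Metric.ball 0 1))
    (h0 : angleMean (fun t => ‖h (circleMap 0 (1 / 2) t)‖ₑ ^ 2) = 0) :
    ∀ z ∈ Metric.ball (0 : ℂ) 1, h z = 0 := by
  rw [angleMean_eq hh (by norm_num) (by norm_num), ENNReal.tsum_eq_zero] at h0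
  have hc : ∀ n : ℕ, iteratedDeriv n h 0 = 0 := by
    intro n
    have h1 : (ENNReal.ofReal ((1 / 2 : ℝ) ^ 2)) ≠ 0 := by
      rw [Ne, ENNReal.ofReal_eq_zero]; norm_num
    have := h0 n
    simpa [h1, Nat.factorial_ne_zero] using this
  intro z hz
  have := Complex.hasSum_taylorSeries_on_ball (c := (0 : ℂ)) (r := 1) hh.differentiableOn hz
  simp only [hc, smul_zero] at this
  exact (this.unique hasSum_zero)

theorem measurable_poisson (μ : Measure (Metric.sphere (0 : ℂ) 1)) [IsFiniteMeasure μ] :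
    Measurable (poisson μ) := by
  have : StronglyMeasurable fun p : ℂ × Metric.sphere (0 : ℂ) 1 =>
      (1 - ‖p.1‖ ^ 2) / ‖(p.2 : ℂ) - p.1‖ ^ 2 := by
    apply Measurable.stronglyMeasurable
    fun_prop
  exact (this.integral_prod_right (ν := μ)).measurable.const_mul _

theorem circleMap_mem {r : ℝ} (hr : 0 ≤ r) (hr1 : r < 1) (t : ℝ) :
    circleMap 0 r t ∈ Metric.ball (0 : ℂ) 1 := by
  simp [circleMap, abs_of_nonneg hr, hr1]

theorem slice₁ {f : ℂ × ℂ → ℂ} (hf : AnalyticOnNhd ℂ f bidisc) {w : ℂ}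
    (hw : w ∈ Metric.ball (0 : ℂ) 1) :
    AnalyticOnNhd ℂ (fun z => f (z, w)) (Metric.ball 0 1) := fun z hz =>
  (hf (z, w) ⟨hz, hw⟩).along_fst

theorem slice₂ {f : ℂ × ℂ → ℂ} (hf : AnalyticOnNhd ℂ f bidisc) {z : ℂ}
    (hz : z ∈ Metric.ball (0 : ℂ) 1) :
    AnalyticOnNhd ℂ (fun w => f (z, w)) (Metric.ball 0 1) := fun w hw =>
  (hf (z, w) ⟨hz, hw⟩).along_snd

theorem analytic_partial₁ {f : ℂ × ℂ → ℂ} (hf : AnalyticOnNhd ℂ f bidisc) :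
    AnalyticOnNhd ℂ (partial₁ f) bidisc := fun z hz =>
  ((ContinuousLinearMap.apply ℂ ℂ ((1, 0) : ℂ × ℂ)).analyticAt _).comp (hf.fderiv z hz)

theorem analytic_partial₂ {f : ℂ × ℂ → ℂ} (hf : AnalyticOnNhd ℂ f bidisc) :
    AnalyticOnNhd ℂ (partial₂ f) bidisc := fun z hz =>
  ((ContinuousLinearMap.apply ℂ ℂ ((0, 1) : ℂ × ℂ)).analyticAt _).comp (hf.fderiv z hz)

theorem linear_partial₁ {z : ℂ × ℂ} (hz : z ∈ bidisc) :
    IsLinearMap ℂ (fun f : holo bidisc => partial₁ f z) where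
  map_add f g := by
    change fderiv ℂ ((f : ℂ × ℂ → ℂ) + (g : ℂ × ℂ → ℂ)) z (1, 0) = _
    rw [fderiv_add (f.2.1 z hz).differentiableAt (g.2.1 z hz).differentiableAt]; rfl
  map_smul c f := by
    change fderiv ℂ (c • (f : ℂ × ℂ → ℂ)) z (1, 0) = _
    rw [fderiv_const_smul (f.2.1 z hz).differentiableAt]; rfl

theorem linear_partial₂ {z : ℂ × ℂ} (hz : z ∈ bidisc) :
    IsLinearMap ℂ (fun f : holo bidisc => partial₂ f z) where
  map_add f g := by
    change fderiv ℂ ((f : ℂ × ℂ → ℂ) + (g : ℂ × ℂ → ℂ)) z (0, 1) = _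
    rw [fderiv_add (f.2.1 z hz).differentiableAt (g.2.1 z hz).differentiableAt]; rfl
  map_smul c f := by
    change fderiv ℂ (c • (f : ℂ × ℂ → ℂ)) z (0, 1) = _
    rw [fderiv_const_smul (f.2.1 z hz).differentiableAt]; rfl

theorem linear_partial₁₂ {z : ℂ × ℂ} (hz : z ∈ bidisc) :
    IsLinearMap ℂ (fun f : holo bidisc => partial₁ (partial₂ f) z) where
  map_add f g := by
    have e : partial₂ ((f : ℂ × ℂ → ℂ) + (g : ℂ × ℂ → ℂ)) =ᶠ[𝓝 z]
        partial₂ (f : ℂ × ℂ → ℂ) + partial₂ (g : ℂ × ℂ → ℂ) := by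
      filter_upwards [isOpen_bidisc.mem_nhds hz] with w hw using (linear_partial₂ hw).map_add f g
    change fderiv ℂ (partial₂ ((f : ℂ × ℂ → ℂ) + (g : ℂ × ℂ → ℂ))) z (1, 0) = _
    rw [e.fderiv_eq, fderiv_add (analytic_partial₂ f.2.1 z hz).differentiableAt
      (analytic_partial₂ g.2.1 z hz).differentiableAt]; rfl
  map_smul c f := by
    have e : partial₂ (c • (f : ℂ × ℂ → ℂ)) =ᶠ[𝓝 z] c • partial₂ (f : ℂ × ℂ → ℂ) := by
      filter_upwards [isOpen_bidisc.mem_nhds hz] with w hw using (linear_partial₂ hw).map_smul c f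
    change fderiv ℂ (partial₂ (c • (f : ℂ × ℂ → ℂ))) z (1, 0) = _
    rw [e.fderiv_eq, fderiv_const_smul (analytic_partial₂ f.2.1 z hz).differentiableAt]; rfl

theorem hardySq₁_isQuad : IsQuad (fun f : holo (Metric.ball (0 : ℂ) 1) => hardySq₁ f) := by
  refine radialLim_isQuad (fun r hr hr1 => angleMean_isQuad (fun f => ?_) fun t =>
    IsQuad.of_linear ⟨fun _ _ => rfl, fun _ _ => rfl⟩) fun f r s => angleMean_mono f.2.1
  have : Continuous fun t => (f : ℂ → ℂ) (circleMap 0 r t) :=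
    f.2.1.continuousOn.comp_continuous (continuous_circleMap 0 r) (circleMap_mem hr hr1)
  exact (this.enorm.measurable.pow_const 2).aemeasurable

theorem dirichlet₁_isQuad (μ : Measure (Metric.sphere (0 : ℂ) 1)) [IsFiniteMeasure μ] :
    IsQuad (fun f : holo (Metric.ball (0 : ℂ) 1) => dirichlet₁ μ f) := by
  refine areaInt_isQuad (fun f => ?_) fun z hz => IsQuad.const_mul (IsQuad.of_linear
    ⟨fun f g => ?_, fun c f => ?_⟩) _
  · exact (measurable_poisson μ).ennreal_ofReal.aemeasurable.mul
      ((measurable_deriv _).enorm.pow_const 2).aemeasurable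
  · exact deriv_add (f.2.1 z hz).differentiableAt (g.2.1 z hz).differentiableAt
  · exact deriv_const_smul c (f.2.1 z hz).differentiableAt

theorem continuous_torus {f : ℂ × ℂ → ℂ} (hf : AnalyticOnNhd ℂ f bidisc) {r s : ℝ}
    (hr : 0 ≤ r) (hr1 : r < 1) (hs : 0 ≤ s) (hs1 : s < 1) :
    Continuous fun p : ℝ × ℝ => f (circleMap 0 r p.1, circleMap 0 s p.2) :=
  hf.continuousOn.comp_continuous (((continuous_circleMap 0 r).comp continuous_fst).prodMk
    ((continuous_circleMap 0 s).comp continuous_snd))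
    fun p => ⟨circleMap_mem hr hr1 p.1, circleMap_mem hs hs1 p.2⟩

theorem measurable_torus {f : ℂ × ℂ → ℂ} (hf : AnalyticOnNhd ℂ f bidisc) {r s : ℝ}
    (hr : 0 ≤ r) (hr1 : r < 1) (hs : 0 ≤ s) (hs1 : s < 1) :
    Measurable fun p : ℝ × ℝ => ‖f (circleMap 0 r p.1, circleMap 0 s p.2)‖ₑ ^ 2 :=
  (continuous_torus hf hr hr1 hs hs1).enorm.measurable.pow_const 2

theorem measurable_torusMean {f : ℂ × ℂ → ℂ} (hf : AnalyticOnNhd ℂ f bidisc) {r s : ℝ}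
    (hr : 0 ≤ r) (hr1 : r < 1) (hs : 0 ≤ s) (hs1 : s < 1) :
    Measurable fun a => angleMean fun b => ‖f (circleMap 0 r a, circleMap 0 s b)‖ₑ ^ 2 :=
  (measurable_torus hf hr hr1 hs hs1).lintegral_prod_right'.const_mul _

theorem angleMean_swap {F : ℝ × ℝ → ℝ≥0∞} (hF : Measurable F) :
    angleMean (fun a => angleMean fun b => F (a, b)) =
      angleMean (fun b => angleMean fun a => F (a, b)) := by
  simp only [angleMean]
  rw [lintegral_const_mul' _ _ ENNReal.ofReal_ne_top, lintegral_const_mul' _ _ ENNReal.ofReal_ne_top,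
    lintegral_lintegral_swap]
  exact hF.aemeasurable

theorem angleMean_le {F G : ℝ → ℝ≥0∞} (h : ∀ t, F t ≤ G t) : angleMean F ≤ angleMean G := by
  unfold angleMean
  gcongr
  exact h _

theorem areaInt_le {F G : ℂ → ℝ≥0∞} (h : ∀ z ∈ Metric.ball (0 : ℂ) 1, F z ≤ G z) :
    areaInt F ≤ areaInt G := by
  unfold areaInt
  gcongr ENNReal.ofReal Real.pi⁻¹ * ?_
  exact setLIntegral_mono' Metric.isOpen_ball.measurableSet h

theorem torusMean_mono {f : ℂ × ℂ → ℂ} (hf : AnalyticOnNhd ℂ f bidisc) {r s : ℝ}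
    (hr : 0 ≤ r) (hrs : r ≤ s) (hs : s < 1) :
    (angleMean fun a => angleMean fun b => ‖f (circleMap 0 r a, circleMap 0 r b)‖ₑ ^ 2) ≤
      angleMean fun a => angleMean fun b => ‖f (circleMap 0 s a, circleMap 0 s b)‖ₑ ^ 2 := by
  have hr1 := hrs.trans_lt hs
  have hs0 := hr.trans hrs
  calc _ ≤ angleMean fun a => angleMean fun b => ‖f (circleMap 0 r a, circleMap 0 s b)‖ₑ ^ 2 :=
        angleMean_le fun a => angleMean_mono (slice₂ hf (circleMap_mem hr hr1 a)) hr hrs hs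
    _ = angleMean fun b => angleMean fun a => ‖f (circleMap 0 r a, circleMap 0 s b)‖ₑ ^ 2 :=
        angleMean_swap (measurable_torus hf hr hr1 hs0 hs)
    _ ≤ angleMean fun b => angleMean fun a => ‖f (circleMap 0 s a, circleMap 0 s b)‖ₑ ^ 2 :=
        angleMean_le fun b => angleMean_mono (slice₁ hf (circleMap_mem hs0 hs b)) hr hrs hs
    _ = _ := (angleMean_swap (measurable_torus hf hs0 hs hs0 hs)).symm

theorem hardySq₂_isQuad : IsQuad (fun f : holo bidisc => hardySq₂ f) := by
  refine radialLim_isQuad (fun r hr hr1 => angleMean_isQuad (fun f => ?_) fun a =>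
    angleMean_isQuad (fun f => ?_) fun b => IsQuad.of_linear ⟨fun _ _ => rfl, fun _ _ => rfl⟩)
    fun f r s => torusMean_mono f.2.1
  · exact (measurable_torusMean f.2.1 hr hr1 hr hr1).aemeasurable
  · exact ((measurable_torus f.2.1 hr hr1 hr hr1).comp
      (measurable_const.prodMk measurable_id)).aemeasurable

theorem aemeasurable_mixed {g : ℂ × ℂ → ℂ} (hg : AnalyticOnNhd ℂ g bidisc) {r : ℝ}
    (hr : 0 ≤ r) (hr1 : r < 1) :
    AEMeasurable (fun z => angleMean fun t => ‖g (z, circleMap 0 r t)‖ₑ ^ 2)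
      (volume.restrict (Metric.ball (0 : ℂ) 1)) := by
  have hc : ContinuousOn (fun p : ℂ × ℝ => ‖g (p.1, circleMap 0 r p.2)‖ₑ)
      (Metric.ball (0 : ℂ) 1 ×ˢ Ioc 0 (2 * Real.pi)) := by
    refine ContinuousOn.enorm ?_
    exact hg.continuousOn.comp (continuous_fst.prodMk
      ((continuous_circleMap 0 r).comp continuous_snd)).continuousOn
      fun p hp => ⟨hp.1, circleMap_mem hr hr1 p.2⟩
  have hm := hc.aemeasurable (μ := (volume : Measure ℂ).prod (volume : Measure ℝ))
    (Metric.isOpen_ball.measurableSet.prod measurableSet_Ioc)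
  rw [← Measure.prod_restrict] at hm
  exact (hm.pow_const 2).lintegral_prod_right'.const_mul _

theorem analytic_swap {g : ℂ × ℂ → ℂ} (hg : AnalyticOnNhd ℂ g bidisc) :
    AnalyticOnNhd ℂ (fun p : ℂ × ℂ => g (p.2, p.1)) bidisc := fun p hp =>
  AnalyticAt.fun_comp (g := g) (f := fun p : ℂ × ℂ => (p.2, p.1)) (hg (p.2, p.1) ⟨hp.2, hp.1⟩)
    (analyticAt_snd.prod analyticAt_fst)

theorem dirichlet₂₁_isQuad (μ : Measure (Metric.sphere (0 : ℂ) 1)) [IsFiniteMeasure μ] :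
    IsQuad (fun f : holo bidisc => dirichlet₂₁ μ f) := by
  refine radialLim_isQuad (fun r hr hr1 => areaInt_isQuad (fun f => ?_) fun z hz =>
    IsQuad.const_mul (angleMean_isQuad (fun f => ?_) fun t => IsQuad.of_linear
      (linear_partial₁ ⟨hz, circleMap_mem hr hr1 t⟩)) _) fun f r s hr hrs hs => ?_
  · exact (measurable_poisson μ).ennreal_ofReal.aemeasurable.mul
      (aemeasurable_mixed (analytic_partial₁ f.2.1) hr hr1)
  · have : Continuous fun t => partial₁ f (z, circleMap 0 r t) :=
      (slice₂ (analytic_partial₁ f.2.1) hz).continuousOn.comp_continuous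
        (continuous_circleMap 0 r) (circleMap_mem hr hr1)
    exact (this.enorm.measurable.pow_const 2).aemeasurable
  · exact areaInt_le fun z hz => mul_le_mul_right
      (angleMean_mono (slice₂ (analytic_partial₁ f.2.1) hz) hr hrs hs) _

theorem dirichlet₂₂_isQuad (μ : Measure (Metric.sphere (0 : ℂ) 1)) [IsFiniteMeasure μ] :
    IsQuad (fun f : holo bidisc => dirichlet₂₂ μ f) := by
  refine radialLim_isQuad (fun r hr hr1 => areaInt_isQuad (fun f => ?_) fun z hz =>
    IsQuad.const_mul (angleMean_isQuad (fun f => ?_) fun t => IsQuad.of_linear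
      (linear_partial₂ ⟨circleMap_mem hr hr1 t, hz⟩)) _) fun f r s hr hrs hs => ?_
  · exact (measurable_poisson μ).ennreal_ofReal.aemeasurable.mul
      (aemeasurable_mixed (analytic_swap (analytic_partial₂ f.2.1)) hr hr1)
  · have : Continuous fun t => partial₂ f (circleMap 0 r t, z) :=
      (slice₁ (analytic_partial₂ f.2.1) hz).continuousOn.comp_continuous
        (continuous_circleMap 0 r) (circleMap_mem hr hr1)
    exact (this.enorm.measurable.pow_const 2).aemeasurable
  · exact areaInt_le fun z hz => mul_le_mul_right
      (angleMean_mono (slice₁ (analytic_partial₂ f.2.1) hz) hr hrs hs) _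

theorem dirichlet₂₃_isQuad (μ₁ μ₂ : Measure (Metric.sphere (0 : ℂ) 1)) [IsFiniteMeasure μ₁]
    [IsFiniteMeasure μ₂] : IsQuad (fun f : holo bidisc => dirichlet₂₃ μ₁ μ₂ f) := by
  have hw : Measurable fun p : ℂ × ℂ => ENNReal.ofReal (poisson μ₁ p.1 * poisson μ₂ p.2) :=
    (((measurable_poisson μ₁).comp measurable_fst).mul
      ((measurable_poisson μ₂).comp measurable_snd)).ennreal_ofReal
  have hm : ∀ f : holo bidisc, AEMeasurable (fun p : ℂ × ℂ =>
      ‖partial₁ (partial₂ f) p‖ₑ ^ 2) ((volume.restrict (Metric.ball (0 : ℂ) 1)).prod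
        (volume.restrict (Metric.ball (0 : ℂ) 1))) := by
    intro f
    rw [Measure.prod_restrict]
    exact (ContinuousOn.aemeasurable (((analytic_partial₁ (analytic_partial₂
      f.2.1)).continuousOn).enorm) isOpen_bidisc.measurableSet).pow_const 2
  refine areaInt_isQuad (fun f => ?_) fun z hz => areaInt_isQuad (fun f => ?_) fun w hw =>
    IsQuad.const_mul (IsQuad.of_linear (linear_partial₁₂ ⟨hz, hw⟩)) _
  · exact (hw.aemeasurable.mul (hm f)).lintegral_prod_right'.const_mul _
  · refine (hw.comp (measurable_const.prodMk measurable_id)).aemeasurable.mul ?_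
    have := (slice₂ (analytic_partial₁ (analytic_partial₂ f.2.1)) hz).continuousOn
    exact (ContinuousOn.aemeasurable this.enorm Metric.isOpen_ball.measurableSet).pow_const 2

theorem energy₁ (μ : Measure (Metric.sphere (0 : ℂ) 1)) [IsFiniteMeasure μ] :
    IsEnergy (fun f : holo (Metric.ball (0 : ℂ) 1) => hardySq₁ f + dirichlet₁ μ f) where
  toIsQuad := hardySq₁_isQuad.add (dirichlet₁_isQuad μ)
  definite f hf := by
    have h1 := (add_eq_zero.1 hf).1
    have h2 := (le_radialLim (fun r s => angleMean_mono f.2.1) (by norm_num)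
      (by norm_num : (1 / 2 : ℝ) < 1)).trans h1.le
    ext z
    by_cases hz : z ∈ Metric.ball (0 : ℂ) 1
    · exact eq_zero_of_angleMean f.2.1 (le_antisymm h2 bot_le) z hz
    · exact f.2.2 z hz

theorem energy₂ (μ₁ μ₂ : Measure (Metric.sphere (0 : ℂ) 1)) [IsFiniteMeasure μ₁]
    [IsFiniteMeasure μ₂] :
    IsEnergy (fun f : holo bidisc => hardySq₂ f + dirichlet₂ μ₁ μ₂ f) where
  toIsQuad := hardySq₂_isQuad.add
    (((dirichlet₂₁_isQuad μ₁).add (dirichlet₂₂_isQuad μ₂)).add (dirichlet₂₃_isQuad μ₁ μ₂))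
  definite f hf := by
    have h1 := (add_eq_zero.1 hf).1
    have hh : (0 : ℝ) ≤ 1 / 2 := by norm_num
    have hh1 : (1 / 2 : ℝ) < 1 := by norm_num
    have h2 := le_antisymm ((le_radialLim (fun r s => torusMean_mono f.2.1) hh hh1).trans h1.le)
      bot_le
    have hpi : ENNReal.ofReal (2 * Real.pi)⁻¹ ≠ 0 := by
      rw [Ne, ENNReal.ofReal_eq_zero, not_le]; positivity
    ext ⟨z, w⟩
    by_cases hzw : (z, w) ∈ bidisc
    · refine eq_zero_of_angleMean (slice₁ f.2.1 hzw.2) ?_ z hzw.1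
      have h3 := (mul_eq_zero.1 h2).resolve_left hpi
      rw [lintegral_eq_zero_iff (measurable_torusMean f.2.1 hh hh1 hh hh1)] at h3
      refine mul_eq_zero_of_right _ ?_
      refine (lintegral_congr_ae (h3.mono fun a ha => ?_)).trans lintegral_zero
      have := eq_zero_of_angleMean (slice₂ f.2.1 (circleMap_mem hh hh1 a)) ha w hzw.2
      change ‖(f : ℂ × ℂ → ℂ) (circleMap 0 (1 / 2) a, w)‖ₑ ^ 2 = 0
      rw [this]; simp
    · exact f.2.2 _ hzw

end Energy

section Membership

theorem angleMean_eq_symm {F : ℂ → ℝ≥0∞} (ρ : ℝ) :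
    angleMean (fun t => F (circleMap 0 ρ t)) = ENNReal.ofReal (2 * Real.pi)⁻¹ *
      ∫⁻ t in Ioo (-Real.pi) Real.pi, F (circleMap 0 ρ t) := by
  have hp : Function.Periodic (fun t => F (circleMap 0 ρ t)) (2 * Real.pi) := fun t => by
    simp only [periodic_circleMap 0 ρ t]
  have : Fact (0 < 2 * Real.pi) := ⟨Real.two_pi_pos⟩
  have h1 := AddCircle.lintegral_preimage (2 * Real.pi) 0 hp.lift
  have h2 := AddCircle.lintegral_preimage (2 * Real.pi) (-Real.pi) hp.lift
  simp only [Function.Periodic.lift_coe, zero_add] at h1 h2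
  rw [angleMean, h1, ← h2, show -Real.pi + 2 * Real.pi = Real.pi by ring]
  congr 1
  exact setLIntegral_congr Ioo_ae_eq_Ioc.symm

theorem areaInt_polar {F : ℂ → ℝ≥0∞} (hF : Measurable F) :
    areaInt F = 2 * ∫⁻ ρ in Ioo (0 : ℝ) 1,
      ENNReal.ofReal ρ * angleMean (fun t => F (circleMap 0 ρ t)) := by
  have h1 : ∫⁻ z in Metric.ball (0 : ℂ) 1, F z = ∫⁻ ρ in Ioo (0 : ℝ) 1, ENNReal.ofReal ρ *
      ∫⁻ t in Ioo (-Real.pi) Real.pi, F (circleMap 0 ρ t) := by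
    rw [← lintegral_indicator Metric.isOpen_ball.measurableSet,
      ← Complex.lintegral_comp_polarCoord_symm, polarCoord_target]
    have hpol : ∀ p : ℝ × ℝ, Complex.polarCoord.symm p = circleMap 0 p.1 p.2 := fun p => by
      rw [Complex.polarCoord_symm_apply, circleMap, zero_add, Complex.exp_mul_I,
        Complex.ofReal_cos, Complex.ofReal_sin]
    simp only [hpol, smul_eq_mul]
    have hm : Measurable fun p : ℝ × ℝ => ENNReal.ofReal p.1 *
        (Metric.ball (0 : ℂ) 1).indicator F (circleMap 0 p.1 p.2) := by
      refine measurable_fst.ennreal_ofReal.mul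
        ((hF.indicator Metric.isOpen_ball.measurableSet).comp ?_)
      unfold circleMap
      fun_prop
    rw [Measure.volume_eq_prod, setLIntegral_prod _ hm.aemeasurable]
    simp only [lintegral_const_mul' _ _ ENNReal.ofReal_ne_top]
    rw [← lintegral_indicator measurableSet_Ioi, ← lintegral_indicator measurableSet_Ioo]
    congr 1 with ρ
    by_cases h0 : 0 < ρ
    · rw [indicator_of_mem (show ρ ∈ Ioi (0 : ℝ) from h0)]
      have hn : ∀ t, ‖circleMap 0 ρ t‖ = ρ := fun t => by simp [circleMap, abs_of_pos h0]
      by_cases h1 : ρ < 1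
      · rw [indicator_of_mem (show ρ ∈ Ioo (0 : ℝ) 1 from ⟨h0, h1⟩)]
        congr 2 with t
        exact indicator_of_mem (by simp [hn, h1]) _
      · rw [indicator_of_notMem (fun h => h1 h.2)]
        refine mul_eq_zero_of_right _ ((lintegral_congr fun t => ?_).trans lintegral_zero)
        exact indicator_of_notMem (by simpa [hn] using h1) _
    · rw [indicator_of_notMem (show ρ ∉ Ioi (0 : ℝ) from h0),
        indicator_of_notMem (show ρ ∉ Ioo (0 : ℝ) 1 from fun h => h0 h.1)]
  rw [areaInt, h1, ← lintegral_const_mul' _ _ (by simp), ← lintegral_const_mul' _ _ (by simp)]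
  congr 1 with ρ
  rw [angleMean_eq_symm, mul_left_comm, mul_left_comm 2, ← mul_assoc 2]
  congr 2
  rw [show (2 : ℝ≥0∞) = ENNReal.ofReal 2 by simp, ← ENNReal.ofReal_mul (by norm_num), mul_inv,
    mul_inv_cancel_left₀ (by norm_num)]

/-- Littlewood-Paley type estimate. -/
theorem angleMean_le_areaInt {h : ℂ → ℂ} (hh : AnalyticOnNhd ℂ h (Metric.ball 0 1)) {R : ℝ}
    (hR : 0 ≤ R) (hR1 : R < 1) :
    angleMean (fun t => ‖h (circleMap 0 R t)‖ₑ ^ 2) ≤ ‖h 0‖ₑ ^ 2 +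
      2 * areaInt (fun z => ENNReal.ofReal (1 - ‖z‖ ^ 2) * ‖deriv h z‖ₑ ^ 2) := by
  have key : ∀ n : ℕ, ∫⁻ ρ in Ioo (0 : ℝ) 1, ENNReal.ofReal (ρ * (1 - ρ ^ 2) * (ρ ^ 2) ^ n) =
      ENNReal.ofReal ((1 / 2) / ((n + 1) * (n + 2))) := by
    intro n
    have hi : ∫ ρ in (0 : ℝ)..1, ρ * (1 - ρ ^ 2) * (ρ ^ 2) ^ n = (1 / 2 : ℝ) / ((n + 1) * (n + 2)) := by
      have : ∀ ρ : ℝ, ρ * (1 - ρ ^ 2) * (ρ ^ 2) ^ n = ρ ^ (2 * n + 1) - ρ ^ (2 * n + 3) :=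
        fun ρ => by ring
      simp only [this]
      rw [intervalIntegral.integral_sub (Continuous.intervalIntegrable (by fun_prop) _ _)
        (Continuous.intervalIntegrable (by fun_prop) _ _)]
      simp only [integral_pow]
      push_cast
      rw [one_pow, one_pow, zero_pow (by omega), zero_pow (by omega)]
      field_simp
      ring
    rw [← hi, intervalIntegral.integral_of_le zero_le_one, integral_Ioc_eq_integral_Ioo,
      ofReal_integral_eq_lintegral_ofReal]
    · exact (Continuous.integrableOn_Icc (by fun_prop)).mono_set Ioo_subset_Icc_self
    · refine (ae_restrict_iff' measurableSet_Ioo).2 (ae_of_all _ fun ρ hρ => ?_)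
      have h1 : 0 ≤ 1 - ρ ^ 2 := by nlinarith [hρ.1, hρ.2]
      have := hρ.1
      positivity
  have hd : AnalyticOnNhd ℂ (deriv h) (Metric.ball 0 1) := hh.deriv
  have hA : areaInt (fun z => ENNReal.ofReal (1 - ‖z‖ ^ 2) * ‖deriv h z‖ₑ ^ 2) =
      2 * ∑' n : ℕ, ENNReal.ofReal ((1 / 2) / ((n + 1) * (n + 2))) *
        ‖(n.factorial : ℂ)⁻¹ * iteratedDeriv (n + 1) h 0‖ₑ ^ 2 := by
    have hm : Measurable fun z : ℂ => ENNReal.ofReal (1 - ‖z‖ ^ 2) * ‖deriv h z‖ₑ ^ 2 :=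
      (Measurable.ennreal_ofReal (by fun_prop)).mul ((measurable_deriv _).enorm.pow_const 2)
    rw [areaInt_polar hm]
    congr 1
    have : ∀ ρ ∈ Ioo (0 : ℝ) 1, ENNReal.ofReal ρ * angleMean (fun t =>
        ENNReal.ofReal (1 - ‖circleMap 0 ρ t‖ ^ 2) * ‖deriv h (circleMap 0 ρ t)‖ₑ ^ 2) =
        ∑' n : ℕ, ENNReal.ofReal (ρ * (1 - ρ ^ 2) * (ρ ^ 2) ^ n) *
        ‖(n.factorial : ℂ)⁻¹ * iteratedDeriv (n + 1) h 0‖ₑ ^ 2 := by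
      intro ρ hρ
      have h1 : 0 ≤ 1 - ρ ^ 2 := by nlinarith [hρ.1, hρ.2]
      have e : ∀ t, ‖circleMap 0 ρ t‖ = ρ := fun t => by simp [circleMap, abs_of_pos hρ.1]
      have e2 : angleMean (fun t => ENNReal.ofReal (1 - ρ ^ 2) * ‖deriv h (circleMap 0 ρ t)‖ₑ ^ 2) =
          ENNReal.ofReal (1 - ρ ^ 2) * angleMean (fun t => ‖deriv h (circleMap 0 ρ t)‖ₑ ^ 2) := by
        unfold angleMean
        rw [lintegral_const_mul' _ _ ENNReal.ofReal_ne_top, mul_left_comm]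
      simp only [e]
      rw [e2, angleMean_eq hd hρ.1.le hρ.2, ← mul_assoc, ← ENNReal.tsum_mul_left]
      refine tsum_congr fun n => ?_
      rw [ENNReal.ofReal_mul (mul_nonneg hρ.1.le h1), ENNReal.ofReal_mul hρ.1.le,
        ENNReal.ofReal_pow (sq_nonneg ρ), iteratedDeriv_succ']
      ring
    rw [setLIntegral_congr_fun measurableSet_Ioo this, lintegral_tsum]
    · refine tsum_congr fun n => ?_
      rw [lintegral_mul_const' _ _ (ENNReal.pow_ne_top enorm_ne_top), key]
    · intro n
      exact (Measurable.ennreal_ofReal (by fun_prop)).aemeasurable.mul_const _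
  rw [hA, angleMean_eq hh hR hR1, tsum_eq_zero_add' ENNReal.summable, ← ENNReal.tsum_mul_left,
    ← ENNReal.tsum_mul_left]
  refine add_le_add (by simp) (ENNReal.tsum_le_tsum fun n => ?_)
  have h1 : ENNReal.ofReal (R ^ 2) ^ (n + 1) ≤ 1 :=
    pow_le_one' (ENNReal.ofReal_le_one.2 (by nlinarith)) _
  have h2 : ‖((n + 1).factorial : ℂ)⁻¹ * iteratedDeriv (n + 1) h 0‖ₑ ^ 2 =
      ENNReal.ofReal (1 / (n + 1) ^ 2) * ‖(n.factorial : ℂ)⁻¹ * iteratedDeriv (n + 1) h 0‖ₑ ^ 2 := by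
    rw [Nat.factorial_succ, Nat.cast_mul, mul_inv, mul_assoc, enorm_mul, mul_pow]
    congr 1
    rw [← ofReal_norm, ← ENNReal.ofReal_pow (norm_nonneg _)]
    congr 1
    rw [norm_inv, Complex.norm_natCast]
    push_cast
    field_simp
  rw [h2]
  refine (mul_le_of_le_one_right' h1).trans ?_
  rw [← mul_assoc, ← mul_assoc]
  gcongr
  rw [show (2 : ℝ≥0∞) * 2 = ENNReal.ofReal 4 by norm_num, ← ENNReal.ofReal_mul (by norm_num)]
  refine ENNReal.ofReal_le_ofReal ?_
  rw [mul_div_assoc', div_le_div_iff₀ (by positivity) (by positivity)]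
  nlinarith [(Nat.cast_nonneg n : (0 : ℝ) ≤ n)]

theorem poisson_lower (μ : Measure (Metric.sphere (0 : ℂ) 1)) [IsFiniteMeasure μ] {z : ℂ}
    (hz : z ∈ Metric.ball (0 : ℂ) 1) :
    (8 * Real.pi)⁻¹ * μ.real univ * (1 - ‖z‖ ^ 2) ≤ poisson μ z := by
  have hz1 : ‖z‖ < 1 := by simpa using hz
  have h0 : 0 ≤ 1 - ‖z‖ ^ 2 := by nlinarith [norm_nonneg z]
  have hpos : ∀ ξ : Metric.sphere (0 : ℂ) 1, 1 - ‖z‖ ≤ ‖(ξ : ℂ) - z‖ := fun ξ => by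
    have := norm_sub_norm_le (ξ : ℂ) z
    rwa [norm_eq_of_mem_sphere] at this
  have hle : ∀ ξ : Metric.sphere (0 : ℂ) 1, ‖(ξ : ℂ) - z‖ ≤ 2 := fun ξ => by
    have := norm_sub_le (ξ : ℂ) z
    rw [norm_eq_of_mem_sphere] at this
    linarith
  have hint : Integrable (fun ξ : Metric.sphere (0 : ℂ) 1 =>
      (1 - ‖z‖ ^ 2) / ‖(ξ : ℂ) - z‖ ^ 2) μ := by
    refine Integrable.of_bound (C := (1 - ‖z‖ ^ 2) / (1 - ‖z‖) ^ 2)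
      (Measurable.aestronglyMeasurable (by fun_prop)) (ae_of_all _ fun ξ => ?_)
    rw [Real.norm_of_nonneg (by positivity)]
    have : 0 < 1 - ‖z‖ := by linarith
    gcongr
    exact hpos ξ
  have h1 := integral_mono (integrable_const ((1 - ‖z‖ ^ 2) / 4)) hint fun ξ => by
    have : 0 < ‖(ξ : ℂ) - z‖ := lt_of_lt_of_le (by linarith) (hpos ξ)
    have h4 : ‖(ξ : ℂ) - z‖ ^ 2 ≤ 4 := by nlinarith [hle ξ]
    change (1 - ‖z‖ ^ 2) / 4 ≤ (1 - ‖z‖ ^ 2) / ‖(ξ : ℂ) - z‖ ^ 2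
    gcongr
  rw [integral_const, smul_eq_mul] at h1
  refine le_trans (le_of_eq ?_) (mul_le_mul_of_nonneg_left h1 (by positivity))
  field_simp
  ring

theorem weight_le (μ : Measure (Metric.sphere (0 : ℂ) 1)) [IsFiniteMeasure μ] (hμ : μ ≠ 0) :
    ∃ C : ℝ≥0∞, C ≠ ∞ ∧ ∀ z ∈ Metric.ball (0 : ℂ) 1,
      ENNReal.ofReal (1 - ‖z‖ ^ 2) ≤ C * ENNReal.ofReal (poisson μ z) := by
  have hm : 0 < μ.real univ := by
    rw [measureReal_def, ENNReal.toReal_pos_iff]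
    exact ⟨by simpa [pos_iff_ne_zero] using hμ, measure_lt_top _ _⟩
  refine ⟨ENNReal.ofReal (8 * Real.pi / μ.real univ), ENNReal.ofReal_ne_top, fun z hz => ?_⟩
  rw [← ENNReal.ofReal_mul (by positivity)]
  refine ENNReal.ofReal_le_ofReal ?_
  have := mul_le_mul_of_nonneg_left (poisson_lower μ hz)
    (by positivity : 0 ≤ 8 * Real.pi / μ.real univ)
  refine le_trans (le_of_eq ?_) this
  field_simp

theorem areaInt_const_mul (C : ℝ≥0∞) (hC : C ≠ ∞) (F : ℂ → ℝ≥0∞) :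
    areaInt (fun z => C * F z) = C * areaInt F := by
  unfold areaInt
  rw [lintegral_const_mul' _ _ hC, mul_left_comm]

theorem hardySq₁_lt_top {μ : Measure (Metric.sphere (0 : ℂ) 1)} [IsFiniteMeasure μ] (hμ : μ ≠ 0)
    {f : ℂ → ℂ} (hf : AnalyticOnNhd ℂ f (Metric.ball 0 1)) (hD : dirichlet₁ μ f < ∞) :
    hardySq₁ f < ∞ := by
  obtain ⟨C, hC, hw⟩ := weight_le μ hμ
  refine lt_of_le_of_lt (b := ‖f 0‖ₑ ^ 2 + 2 * (C * dirichlet₁ μ f)) ?_ ?_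
  · refine le_of_tendsto (tendsto_radialLim fun r s => angleMean_mono hf) ?_
    filter_upwards [Ioo_mem_nhdsLT (zero_lt_one' ℝ)] with r hr
    refine (angleMean_le_areaInt hf hr.1.le hr.2).trans ?_
    gcongr
    rw [dirichlet₁, ← areaInt_const_mul C hC]
    refine areaInt_le fun z hz => ?_
    rw [← mul_assoc]
    gcongr
    exact hw z hz
  · refine ENNReal.add_lt_top.2 ⟨by simp, ENNReal.mul_lt_top (by simp) (ENNReal.mul_lt_top hC.lt_top hD)⟩

theorem deriv_slice₁ {f : ℂ × ℂ → ℂ} (hf : AnalyticOnNhd ℂ f bidisc) {z w : ℂ}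
    (h : (z, w) ∈ bidisc) : deriv (fun u => f (u, w)) z = partial₁ f (z, w) :=
  ((hf (z, w) h).differentiableAt.hasFDerivAt.comp_hasDerivAt z
    ((hasDerivAt_id z).prodMk (hasDerivAt_const z w))).deriv

theorem deriv_slice₂ {f : ℂ × ℂ → ℂ} (hf : AnalyticOnNhd ℂ f bidisc) {z w : ℂ}
    (h : (z, w) ∈ bidisc) : deriv (fun u => f (z, u)) w = partial₂ f (z, w) :=
  ((hf (z, w) h).differentiableAt.hasFDerivAt.comp_hasDerivAt w
    ((hasDerivAt_const w z).prodMk (hasDerivAt_id w))).deriv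

theorem le_dirichlet₂₁ {μ : Measure (Metric.sphere (0 : ℂ) 1)} {f : ℂ × ℂ → ℂ}
    (hf : AnalyticOnNhd ℂ f bidisc) {r : ℝ} (hr : 0 ≤ r) (hr1 : r < 1) :
    areaInt (fun z => ENNReal.ofReal (poisson μ z) *
      angleMean fun t => ‖partial₁ f (z, circleMap 0 r t)‖ₑ ^ 2) ≤ dirichlet₂₁ μ f := by
  unfold dirichlet₂₁
  refine le_radialLim (F := fun r => areaInt (fun z => ENNReal.ofReal (poisson μ z) *
      angleMean fun t => ‖partial₁ f (z, circleMap 0 r t)‖ₑ ^ 2)) (fun r s hr hrs hs => ?_) hr hr1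
  exact areaInt_le fun z hz => mul_le_mul_right
    (angleMean_mono (slice₂ (analytic_partial₁ hf) hz) hr hrs hs) _

theorem le_dirichlet₂₂ {μ : Measure (Metric.sphere (0 : ℂ) 1)} {f : ℂ × ℂ → ℂ}
    (hf : AnalyticOnNhd ℂ f bidisc) {r : ℝ} (hr : 0 ≤ r) (hr1 : r < 1) :
    areaInt (fun z => ENNReal.ofReal (poisson μ z) *
      angleMean fun t => ‖partial₂ f (circleMap 0 r t, z)‖ₑ ^ 2) ≤ dirichlet₂₂ μ f := by
  unfold dirichlet₂₂
  refine le_radialLim (F := fun r => areaInt (fun z => ENNReal.ofReal (poisson μ z) *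
      angleMean fun t => ‖partial₂ f (circleMap 0 r t, z)‖ₑ ^ 2)) (fun r s hr hrs hs => ?_) hr hr1
  exact areaInt_le fun z hz => mul_le_mul_right
    (angleMean_mono (slice₁ (analytic_partial₂ hf) hz) hr hrs hs) _

theorem hardySq₂_lt_top {μ₁ μ₂ : Measure (Metric.sphere (0 : ℂ) 1)} [IsFiniteMeasure μ₁]
    [IsFiniteMeasure μ₂] (hμ₁ : μ₁ ≠ 0) (hμ₂ : μ₂ ≠ 0) {f : ℂ × ℂ → ℂ}
    (hf : AnalyticOnNhd ℂ f bidisc) (hD : dirichlet₂ μ₁ μ₂ f < ∞) : hardySq₂ f < ∞ := by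
  obtain ⟨C₁, hC₁, hw₁⟩ := weight_le μ₁ hμ₁
  obtain ⟨C₂, hC₂, hw₂⟩ := weight_le μ₂ hμ₂
  have hD1 : dirichlet₂₁ μ₁ f < ∞ := (ENNReal.add_lt_top.1 (ENNReal.add_lt_top.1 hD).1).1
  have hD2 : dirichlet₂₂ μ₂ f < ∞ := (ENNReal.add_lt_top.1 (ENNReal.add_lt_top.1 hD).1).2
  have h00 : (0 : ℂ) ∈ Metric.ball (0 : ℂ) 1 := by simp
  refine lt_of_le_of_lt (b := (‖f (0, 0)‖ₑ ^ 2 + 2 * (C₂ * dirichlet₂₂ μ₂ f)) +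
    2 * (C₁ * dirichlet₂₁ μ₁ f)) ?_ ?_
  · refine le_of_tendsto (tendsto_radialLim fun r s => torusMean_mono hf) ?_
    filter_upwards [Ioo_mem_nhdsLT (zero_lt_one' ℝ)] with r hr
    have hr0 := hr.1.le
    have hr1 := hr.2
    have m1 := le_dirichlet₂₁ (μ := μ₁) hf hr0 hr1
    have m2 := le_dirichlet₂₂ (μ := μ₂) hf hr0 hr1
    have s1 : angleMean (fun t => ‖f (0, circleMap 0 r t)‖ₑ ^ 2) ≤
        ‖f (0, 0)‖ₑ ^ 2 + 2 * (C₂ * dirichlet₂₂ μ₂ f) := by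
      refine (angleMean_le_areaInt (slice₂ hf h00) hr0 hr1).trans ?_
      gcongr
      refine le_trans ?_ (mul_le_mul_right m2 C₂)
      rw [← areaInt_const_mul C₂ hC₂]
      refine areaInt_le fun w hw => ?_
      rw [← mul_assoc, deriv_slice₂ hf ⟨h00, hw⟩]
      refine mul_le_mul' (hw₂ w hw) ?_
      have h0 := angleMean_mono (slice₁ (analytic_partial₂ hf) hw) le_rfl hr0 hr1
      refine le_trans (le_of_eq ?_) h0
      simp only [circleMap_zero_radius, Function.const_apply, angleMean, lintegral_const,
        MeasurableSet.univ, Measure.restrict_apply, univ_inter, Real.volume_Ioc, sub_zero]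
      rw [mul_left_comm, ← ENNReal.ofReal_mul (by positivity), inv_mul_cancel₀ (by positivity)]
      simp
    have s2 : angleMean (fun t => areaInt fun z => ENNReal.ofReal (1 - ‖z‖ ^ 2) *
        ‖partial₁ f (z, circleMap 0 r t)‖ₑ ^ 2) ≤ C₁ * dirichlet₂₁ μ₁ f := by
      refine le_trans ?_ (mul_le_mul_right m1 C₁)
      rw [← areaInt_const_mul C₁ hC₁]
      have hc : ContinuousOn (fun p : ℂ × ℝ => ‖partial₁ f (p.1, circleMap 0 r p.2)‖ₑ)
          (Metric.ball (0 : ℂ) 1 ×ˢ Ioc 0 (2 * Real.pi)) := by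
        refine ContinuousOn.enorm ?_
        exact (analytic_partial₁ hf).continuousOn.comp (continuous_fst.prodMk
          ((continuous_circleMap 0 r).comp continuous_snd)).continuousOn
          fun p hp => ⟨hp.1, circleMap_mem hr0 hr1 p.2⟩
      have hm := hc.aemeasurable (μ := (volume : Measure ℂ).prod (volume : Measure ℝ))
        (Metric.isOpen_ball.measurableSet.prod measurableSet_Ioc)
      rw [← Measure.prod_restrict] at hm
      have hm2 : AEMeasurable (fun p : ℂ × ℝ => ENNReal.ofReal (1 - ‖p.1‖ ^ 2) *
          ‖partial₁ f (p.1, circleMap 0 r p.2)‖ₑ ^ 2) ((volume.restrict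
            (Metric.ball (0 : ℂ) 1)).prod (volume.restrict (Ioc 0 (2 * Real.pi)))) :=
        (Measurable.ennreal_ofReal (by fun_prop)).aemeasurable.mul (hm.pow_const 2)
      have sw := lintegral_lintegral_swap (f := fun (z : ℂ) (t : ℝ) => ENNReal.ofReal (1 - ‖z‖ ^ 2) *
          ‖partial₁ f (z, circleMap 0 r t)‖ₑ ^ 2) hm2
      have e : (angleMean fun t => areaInt fun z => ENNReal.ofReal (1 - ‖z‖ ^ 2) *
          ‖partial₁ f (z, circleMap 0 r t)‖ₑ ^ 2) = areaInt fun z => ENNReal.ofReal (1 - ‖z‖ ^ 2) *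
          angleMean fun t => ‖partial₁ f (z, circleMap 0 r t)‖ₑ ^ 2 := by
        unfold angleMean areaInt
        rw [lintegral_const_mul' _ _ ENNReal.ofReal_ne_top, ← sw, mul_left_comm,
          ← lintegral_const_mul' _ _ ENNReal.ofReal_ne_top]
        congr 2 with z
        rw [lintegral_const_mul' _ _ ENNReal.ofReal_ne_top, mul_left_comm]
      rw [e]
      refine areaInt_le fun z hz => ?_
      rw [← mul_assoc]
      gcongr
      exact hw₁ z hz
    have s3 : ∀ t, angleMean (fun s => ‖f (circleMap 0 r s, circleMap 0 r t)‖ₑ ^ 2) ≤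
        ‖f (0, circleMap 0 r t)‖ₑ ^ 2 + 2 * areaInt fun z => ENNReal.ofReal (1 - ‖z‖ ^ 2) *
        ‖partial₁ f (z, circleMap 0 r t)‖ₑ ^ 2 := by
      intro t
      refine (angleMean_le_areaInt (slice₁ hf (circleMap_mem hr0 hr1 t)) hr0 hr1).trans ?_
      gcongr
      refine areaInt_le fun z hz => ?_
      rw [deriv_slice₁ (w := circleMap 0 r t) hf ⟨hz, circleMap_mem hr0 hr1 t⟩]
    rw [angleMean_swap (measurable_torus hf hr0 hr1 hr0 hr1)]
    refine (angleMean_le s3).trans ?_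
    refine le_trans (le_of_eq ?_) (add_le_add s1 (mul_le_mul_right s2 2))
    have hc0 : Measurable fun t => ‖f (0, circleMap 0 r t)‖ₑ ^ 2 := by
      have : Continuous fun t => f (0, circleMap 0 r t) :=
        (slice₂ hf h00).continuousOn.comp_continuous (continuous_circleMap 0 r)
          (circleMap_mem hr0 hr1)
      exact this.enorm.measurable.pow_const 2
    unfold angleMean
    rw [lintegral_add_left hc0, mul_add, lintegral_const_mul' _ _ (by simp), mul_left_comm]
  · exact ENNReal.add_lt_top.2 ⟨ENNReal.add_lt_top.2 ⟨by simp,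
      ENNReal.mul_lt_top (by simp) (ENNReal.mul_lt_top hC₂.lt_top hD2)⟩,
      ENNReal.mul_lt_top (by simp) (ENNReal.mul_lt_top hC₁.lt_top hD1)⟩

end Membership

/-- Elements of an energy space of holomorphic functions are used as functions. -/
noncomputable instance {E : Type*} [NormedAddCommGroup E] [NormedSpace ℂ E] {Ω : Set E}
    {Q : holo Ω → ℝ≥0∞} {hQ : IsEnergy Q} : CoeFun (EnergySpace Q hQ) (fun _ => E → ℂ) :=
  ⟨fun f => (f.val : holo Ω)⟩

/-- The Dirichlet-type space `𝒟(μ)` on the unit disc: the holomorphic functions `f` on `𝔻` with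
`‖f‖² = ‖f‖²_{H²(𝔻)} + ∫_𝔻 |f'|² P_μ dA` finite, with this norm. -/
abbrev DirichletSpace (μ : Measure (Metric.sphere (0 : ℂ) 1)) [IsFiniteMeasure μ] : Type :=
  EnergySpace (fun f : holo (Metric.ball (0 : ℂ) 1) => hardySq₁ f + dirichlet₁ μ f) (energy₁ μ)

/-- For `μ ≠ 0` the space `𝒟(μ)` consists of all holomorphic functions with finite Dirichlet-type
integral. -/
theorem DirichletSpace.exists_iff (μ : Measure (Metric.sphere (0 : ℂ) 1)) [IsFiniteMeasure μ]
    (hμ : μ ≠ 0) (f : holo (Metric.ball (0 : ℂ) 1)) :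
    (∃ g : DirichletSpace μ, g.val = f) ↔ dirichlet₁ μ f < ∞ := by
  constructor
  · rintro ⟨g, rfl⟩
    exact (ENNReal.add_lt_top.1 g.energy_lt_top).2
  · exact fun h => ⟨⟨f, ENNReal.add_lt_top.2 ⟨hardySq₁_lt_top hμ f.2.1 h, h⟩⟩, rfl⟩

/-- For `μ = 0` the space `𝒟(μ)` is the Hardy space `H²(𝔻)`. -/
theorem DirichletSpace.exists_iff_zero (f : holo (Metric.ball (0 : ℂ) 1)) :
    (∃ g : DirichletSpace 0, g.val = f) ↔ hardySq₁ f < ∞ := by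
  constructor
  · rintro ⟨g, rfl⟩
    exact (ENNReal.add_lt_top.1 g.energy_lt_top).1
  · refine fun h => ⟨⟨f, ENNReal.add_lt_top.2 ⟨h, ?_⟩⟩, rfl⟩
    simp [dirichlet₁, areaInt, poisson]

/-- The Dirichlet-type space `𝒟²(μ₁ × μ₂)` on the unit bidisc: the holomorphic functions `f` on `𝔻²`
with `‖f‖² = ‖f‖²_{H²(𝔻²)} + D^{(2)}(f)` finite, with this norm. -/
abbrev BidiscDirichletSpace (μ₁ μ₂ : Measure (Metric.sphere (0 : ℂ) 1)) [IsFiniteMeasure μ₁]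
    [IsFiniteMeasure μ₂] : Type :=
  EnergySpace (fun f : holo bidisc => hardySq₂ f + dirichlet₂ μ₁ μ₂ f) (energy₂ μ₁ μ₂)

/-- If `μ₁ × μ₂ ≠ 0`, then `𝒟²(μ₁ × μ₂)` consists of all holomorphic functions on the bidisc with
finite Dirichlet-type integral. -/
theorem BidiscDirichletSpace.exists_iff (μ₁ μ₂ : Measure (Metric.sphere (0 : ℂ) 1))
    [IsFiniteMeasure μ₁] [IsFiniteMeasure μ₂] (hμ₁ : μ₁ ≠ 0) (hμ₂ : μ₂ ≠ 0) (f : holo bidisc) :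
    (∃ g : BidiscDirichletSpace μ₁ μ₂, g.val = f) ↔ dirichlet₂ μ₁ μ₂ f < ∞ := by
  constructor
  · rintro ⟨g, rfl⟩
    exact (ENNReal.add_lt_top.1 g.energy_lt_top).2
  · exact fun h => ⟨⟨f, ENNReal.add_lt_top.2 ⟨hardySq₂_lt_top hμ₁ hμ₂ f.2.1 h, h⟩⟩, rfl⟩

/-- For `μ₁ = μ₂ = 0` the space `𝒟²(μ₁ × μ₂)` is the Hardy space `H²(𝔻²)`. -/
theorem BidiscDirichletSpace.exists_iff_zero (f : holo bidisc) :
    (∃ g : BidiscDirichletSpace 0 0, g.val = f) ↔ hardySq₂ f < ∞ := by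
  constructor
  · rintro ⟨g, rfl⟩
    exact (ENNReal.add_lt_top.1 g.energy_lt_top).1
  · refine fun h => ⟨⟨f, ENNReal.add_lt_top.2 ⟨h, ?_⟩⟩, rfl⟩
    simp [dirichlet₂, dirichlet₂₁, dirichlet₂₂, dirichlet₂₃, areaInt, poisson, radialLim]

/-- `K` is the reproducing kernel of a space of holomorphic functions on `Ω`: for every `w ∈ Ω` the
function `K(·, w)` lies in the space and `f(w) = ⟨f, K(·, w)⟩` for all `f` in the space.  (The inner
product is conjugate linear in its first argument.) -/
def IsReproducingKernel {E : Type*} [NormedAddCommGroup E] [NormedSpace ℂ E] {Ω : Set E}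
    {Q : holo Ω → ℝ≥0∞} (hQ : IsEnergy Q) (K : E → E → ℂ) : Prop :=
  ∀ w ∈ Ω, ∃ k : EnergySpace Q hQ, (∀ z ∈ Ω, k z = K z w) ∧
    ∀ f : EnergySpace Q hQ, f w = inner ℂ k f

/-- A `2`-isometry. -/
def IsTwoIsometry {H : Type*} [NormedAddCommGroup H] [InnerProductSpace ℂ H] (T : H →L[ℂ] H) :
    Prop :=
  ∀ x, ‖T (T x)‖ ^ 2 - 2 * ‖T x‖ ^ 2 + ‖x‖ ^ 2 = 0

/-- A doubly commuting pair of operators: `S T = T S` and `S* T = T S*`. -/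
def DoublyCommuting {H : Type*} [NormedAddCommGroup H] [InnerProductSpace ℂ H] [CompleteSpace H]
    (S T : H →L[ℂ] H) : Prop :=
  S * T = T * S ∧ ContinuousLinearMap.adjoint S * T = T * ContinuousLinearMap.adjoint S

/-- The Hilbert space tensor product: the completion of the algebraic tensor product with respect to
the inner product determined by `⟪a ⊗ b, c ⊗ d⟫ = ⟪a, c⟫ * ⟪b, d⟫`. -/
abbrev HilbertTensor (E F : Type*) [NormedAddCommGroup E] [InnerProductSpace ℂ E]
    [NormedAddCommGroup F] [InnerProductSpace ℂ F] : Type _ :=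
  UniformSpace.Completion (TensorProduct ℂ E F)

/-- The bounded operator `S ⊗ T` on the Hilbert space tensor product. -/
noncomputable def tensorOp {E F : Type*} [NormedAddCommGroup E] [InnerProductSpace ℂ E]
    [NormedAddCommGroup F] [InnerProductSpace ℂ F] (S : E →L[ℂ] E) (T : F →L[ℂ] F) :
    HilbertTensor E F →L[ℂ] HilbertTensor E F :=
  (TensorProduct.mapL S T).completion


end DirichletType

/-! The proof realizes every norm involved as an `L²` norm of linear functionals of the Taylor
coefficients; tensor products then become product measures. One variable: by Tonelli the
Dirichlet-type integral is the `μ/2π`-average over `ξ` of local integrals with weight `(1 - |z|²)/|ξ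
- z|²`. Such a local integral is the Bergman norm, with weight `1 - |z|²`, of `f'/(ξ - z)`, whose
coefficients have the moduli of the sums `∑_{j ≤ n+1} j ξ^j a_j` (`coef_deriv_div`,
`areaInt_local_eq`). With the coefficients themselves for the `H²` part, this gives functionals `ev
x` and a measure `idxMeasure μ` such that `‖f‖² = ∫ |ev x|²` (`norm_sq_eq_lintegral`). Two
variables: Parseval and the one-variable formula, applied in each variable, show that the four terms
of the norm of `𝒟²` are the four blocks of the integral of `|ev x ⊗ ev y|²` against `idxMeasure μ₁ ×
idxMeasure μ₂` (`norm_sq_eq_lintegral₂`). Hence `f ⊗ g ↦ f(z₁)g(z₂)` preserves inner products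
(`inner_tensorBilin`). Its range is dense because the products `k₁ ⊗ k₂` of kernel functions
reproduce values on all of `𝒟²`, by Fubini and the reproducing property in one variable at a time
(`apply_eq_inner_tensorBilin`). A function orthogonal to the range therefore vanishes at every point
(`denseRange_tensorIsometry`); the kernel factorization comes with this. The isometry extends to a
unitary, and `M_z ⊗ I`, `I ⊗ M_z` are carried back by it. They are the coordinate multiplications,
since this holds on products and evaluation is continuous (`apply_eq_mul_of_tmul`). Double
commutation is read off from elementary tensors. The `2`-isometry identity is first proved for `M_z`
through an exact formula for partial sums under the coefficient shift (`localPartial_shift`,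
`localSum_shift_shift`), and then passes to the tensor product in polarized form. -/

namespace DirichletType

/-! ### Taylor coefficients on the disc and the coefficient shift. -/

section Coefficients

/-- The `n`-th Taylor coefficient at the origin. -/
noncomputable def coef (f : ℂ → ℂ) (n : ℕ) : ℂ := (n.factorial : ℂ)⁻¹ * iteratedDeriv n f 0

theorem coef_congr {f g : ℂ → ℂ} (h : EqOn f g (Metric.ball 0 1)) (n : ℕ) : coef f n = coef g n := by
  have : f =ᶠ[𝓝 0] g := h.eventuallyEq_of_mem (Metric.ball_mem_nhds 0 one_pos)
  rw [coef, coef, this.iteratedDeriv_eq n]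

theorem hasSum_coef {f : ℂ → ℂ} (hf : AnalyticOnNhd ℂ f (Metric.ball 0 1)) {z : ℂ}
    (hz : z ∈ Metric.ball (0 : ℂ) 1) : HasSum (fun n => coef f n * z ^ n) (f z) := by
  have := Complex.hasSum_taylorSeries_on_ball (c := (0 : ℂ)) (r := 1) hf.differentiableOn hz
  refine this.congr_fun fun n => ?_
  simp [coef]; ring

/-- Uniqueness of power series. The coefficient rules below are mostly obtained by exhibiting a
convergent expansion and applying this lemma. -/
theorem coef_eq_of_hasSum {f : ℂ → ℂ} {b : ℕ → ℂ}
    (h : ∀ z ∈ Metric.ball (0 : ℂ) 1, HasSum (fun n => b n * z ^ n) (f z)) (n : ℕ) :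
    coef f n = b n := by
  have h1 : HasFPowerSeriesAt f (FormalMultilinearSeries.ofScalars ℂ b) 0 := by
    rw [hasFPowerSeriesAt_iff]
    filter_upwards [Metric.ball_mem_nhds (0 : ℂ) one_pos] with z hz
    simpa [mul_comm, FormalMultilinearSeries.coeff_ofScalars] using h z hz
  have h2 := h1.analyticAt.hasFPowerSeriesAt
  have h3 := congrArg (fun p => p.coeff n) (h2.eq_formalMultilinearSeries h1)
  simp only [FormalMultilinearSeries.coeff_ofScalars] at h3
  rw [coef, ← h3]
  field_simp

theorem coef_add {f g : ℂ → ℂ} (hf : AnalyticOnNhd ℂ f (Metric.ball 0 1))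
    (hg : AnalyticOnNhd ℂ g (Metric.ball 0 1)) (n : ℕ) :
    coef (fun z => f z + g z) n = coef f n + coef g n :=
  coef_eq_of_hasSum (b := fun n => coef f n + coef g n) (fun z hz => by
    simpa only [add_mul] using (hasSum_coef hf hz).add (hasSum_coef hg hz)) n

theorem coef_const_mul {f : ℂ → ℂ} (hf : AnalyticOnNhd ℂ f (Metric.ball 0 1)) (c : ℂ) (n : ℕ) :
    coef (fun z => c * f z) n = c * coef f n :=
  coef_eq_of_hasSum (b := fun n => c * coef f n) (fun z hz => by
    simpa only [mul_assoc] using (hasSum_coef hf hz).mul_left c) n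

theorem coef_sum {ι : Type*} (s : Finset ι) {f : ι → ℂ → ℂ}
    (hf : ∀ i, AnalyticOnNhd ℂ (f i) (Metric.ball 0 1)) (n : ℕ) :
    coef (fun z => ∑ i ∈ s, f i z) n = ∑ i ∈ s, coef (f i) n :=
  coef_eq_of_hasSum (b := fun n => ∑ i ∈ s, coef (f i) n) (fun z hz => by
    simpa only [Finset.sum_mul] using hasSum_sum fun i _ => hasSum_coef (hf i) hz) n

/-- The coefficients of `z ↦ z * f z`. -/
def shift (a : ℕ → ℂ) : ℕ → ℂ
  | 0 => 0
  | n + 1 => a n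

@[simp] theorem shift_zero (a : ℕ → ℂ) : shift a 0 = 0 := rfl

@[simp] theorem shift_succ (a : ℕ → ℂ) (n : ℕ) : shift a (n + 1) = a n := rfl

theorem coef_id_mul {f : ℂ → ℂ} (hf : AnalyticOnNhd ℂ f (Metric.ball 0 1)) (n : ℕ) :
    coef (fun z => z * f z) n = shift (coef f) n :=
  coef_eq_of_hasSum (fun z hz => by
    rw [← hasSum_nat_add_iff' 1]
    simpa [pow_succ', mul_left_comm] using (hasSum_coef hf hz).mul_left z) n

theorem coef_deriv (f : ℂ → ℂ) (n : ℕ) : coef (deriv f) n = (n + 1) * coef f (n + 1) := by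
  rw [coef, coef, iteratedDeriv_succ', Nat.factorial_succ]
  push_cast
  field_simp

theorem coef_zero (f : ℂ → ℂ) : coef f 0 = f 0 := by simp [coef]

end Coefficients

/-! ### Radial limits of power series with nonnegative terms, and the `H²` norm. -/

section RadialLimits

/-- Monotone convergence: `r² ≤ 1` gives the upper bound, and continuity of each finite partial sum
at `r = 1` gives the lower one. The exponent is an arbitrary function of the index so that double
series with exponent `j + k` are covered. -/
theorem radialLim_tsum {ι : Type*} (c : ι → ℝ≥0∞) (e : ι → ℕ) :
    radialLim (fun r => ∑' i, c i * ENNReal.ofReal (r ^ 2) ^ e i) = ∑' i, c i := by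
  have hle : ∀ r : ℝ, 0 ≤ r → r < 1 → ENNReal.ofReal (r ^ 2) ≤ 1 := fun r h0 h1 =>
    ENNReal.ofReal_le_one.2 (by nlinarith)
  have hmono : ∀ r s : ℝ, 0 ≤ r → r ≤ s → s < 1 → ∑' i, c i * ENNReal.ofReal (r ^ 2) ^ e i ≤
      ∑' i, c i * ENNReal.ofReal (s ^ 2) ^ e i := fun r s h0 hrs _ => by gcongr
  have hT := tendsto_radialLim hmono
  refine le_antisymm ?_ ?_
  · refine le_of_tendsto hT ?_
    filter_upwards [Ioo_mem_nhdsLT (zero_lt_one' ℝ)] with r hr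
    exact ENNReal.tsum_le_tsum fun i =>
      mul_le_of_le_one_right' (pow_le_one' (hle r hr.1.le hr.2) _)
  · rw [ENNReal.tsum_eq_iSup_sum]
    refine iSup_le fun s => ?_
    have h1 : Tendsto (fun r : ℝ => ∑ i ∈ s, c i * ENNReal.ofReal (r ^ 2) ^ e i) (𝓝[<] 1)
        (𝓝 (∑ i ∈ s, c i * 1)) := by
      refine tendsto_finsetSum _ fun i _ => ENNReal.Tendsto.const_mul ?_ (Or.inl one_ne_zero)
      have : Continuous fun r : ℝ => ENNReal.ofReal (r ^ 2) ^ e i :=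
        (ENNReal.continuous_pow _).comp (ENNReal.continuous_ofReal.comp (continuous_pow 2))
      have h2 := this.tendsto 1
      simp only [one_pow, ENNReal.ofReal_one] at h2
      exact h2.mono_left nhdsWithin_le_nhds
    simp only [mul_one] at h1
    exact le_of_tendsto_of_tendsto h1 hT (Eventually.of_forall fun r => ENNReal.sum_le_tsum s)

theorem radialLim_congr {F G : ℝ → ℝ≥0∞} (h : ∀ r, 0 ≤ r → r < 1 → F r = G r) :
    radialLim F = radialLim G := by
  refine limsup_congr ?_
  filter_upwards [Ioo_mem_nhdsLT (zero_lt_one' ℝ)] with r hr using h r hr.1.le hr.2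

theorem hardySq₁_eq {f : ℂ → ℂ} (hf : AnalyticOnNhd ℂ f (Metric.ball 0 1)) :
    hardySq₁ f = ∑' n, ‖coef f n‖ₑ ^ 2 := by
  rw [← radialLim_tsum (fun n => ‖coef f n‖ₑ ^ 2) id]
  exact radialLim_congr fun r h0 h1 => angleMean_eq hf h0 h1

end RadialLimits

/-! ### Local Dirichlet integrals at a point of the circle. -/

section Local

theorem areaInt_congr {F G : ℂ → ℝ≥0∞} (h : ∀ z ∈ Metric.ball (0 : ℂ) 1, F z = G z) :
    areaInt F = areaInt G :=
  le_antisymm (areaInt_le fun z hz => (h z hz).le) (areaInt_le fun z hz => (h z hz).ge)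

/-- The radial moments of the weight `1 - |z|²`. The factor `1/2` cancels the `2` that polar
coordinates produce for normalized area measure. -/
theorem lintegral_radial_weight (n : ℕ) :
    ∫⁻ ρ in Ioo (0 : ℝ) 1, ENNReal.ofReal (ρ * (1 - ρ ^ 2) * (ρ ^ 2) ^ n) =
      ENNReal.ofReal ((1 / 2) / ((n + 1) * (n + 2))) := by
  have hi : ∫ ρ in (0 : ℝ)..1, ρ * (1 - ρ ^ 2) * (ρ ^ 2) ^ n = (1 / 2 : ℝ) / ((n + 1) * (n + 2)) := by
    have : ∀ ρ : ℝ, ρ * (1 - ρ ^ 2) * (ρ ^ 2) ^ n = ρ ^ (2 * n + 1) - ρ ^ (2 * n + 3) :=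
      fun ρ => by ring
    simp only [this]
    rw [intervalIntegral.integral_sub (Continuous.intervalIntegrable (by fun_prop) _ _)
      (Continuous.intervalIntegrable (by fun_prop) _ _)]
    simp only [integral_pow]
    push_cast
    rw [one_pow, one_pow, zero_pow (by omega), zero_pow (by omega)]
    field_simp
    ring
  rw [← hi, intervalIntegral.integral_of_le zero_le_one, integral_Ioc_eq_integral_Ioo,
    ofReal_integral_eq_lintegral_ofReal]
  · exact (Continuous.integrableOn_Icc (by fun_prop)).mono_set Ioo_subset_Icc_self
  · refine (ae_restrict_iff' measurableSet_Ioo).2 (ae_of_all _ fun ρ hρ => ?_)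
    have h1 : 0 ≤ 1 - ρ ^ 2 := by nlinarith [hρ.1, hρ.2]
    have := hρ.1
    positivity

/-- The weighted Bergman norm in terms of Taylor coefficients. -/
theorem areaInt_weight_eq {h : ℂ → ℂ} (hh : AnalyticOnNhd ℂ h (Metric.ball 0 1))
    (hm : Measurable h) :
    areaInt (fun z => ENNReal.ofReal (1 - ‖z‖ ^ 2) * ‖h z‖ₑ ^ 2) =
      ∑' n : ℕ, ENNReal.ofReal (1 / ((n + 1) * (n + 2))) * ‖coef h n‖ₑ ^ 2 := by
  have hm' : Measurable fun z : ℂ => ENNReal.ofReal (1 - ‖z‖ ^ 2) * ‖h z‖ₑ ^ 2 :=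
    (Measurable.ennreal_ofReal (by fun_prop)).mul (hm.enorm.pow_const 2)
  -- The weight is radial, so Parseval applies on each circle and only the radial moments remain.
  rw [areaInt_polar hm']
  have : ∀ ρ ∈ Ioo (0 : ℝ) 1, ENNReal.ofReal ρ * angleMean (fun t =>
      ENNReal.ofReal (1 - ‖circleMap 0 ρ t‖ ^ 2) * ‖h (circleMap 0 ρ t)‖ₑ ^ 2) =
      ∑' n : ℕ, ENNReal.ofReal (ρ * (1 - ρ ^ 2) * (ρ ^ 2) ^ n) * ‖coef h n‖ₑ ^ 2 := by
    intro ρ hρ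
    have h1 : 0 ≤ 1 - ρ ^ 2 := by nlinarith [hρ.1, hρ.2]
    have e : ∀ t, ‖circleMap 0 ρ t‖ = ρ := fun t => by simp [circleMap, abs_of_pos hρ.1]
    have e2 : angleMean (fun t => ENNReal.ofReal (1 - ρ ^ 2) * ‖h (circleMap 0 ρ t)‖ₑ ^ 2) =
        ENNReal.ofReal (1 - ρ ^ 2) * angleMean (fun t => ‖h (circleMap 0 ρ t)‖ₑ ^ 2) := by
      unfold angleMean
      rw [lintegral_const_mul' _ _ ENNReal.ofReal_ne_top, mul_left_comm]
    simp only [e]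
    rw [e2, angleMean_eq hh hρ.1.le hρ.2, ← mul_assoc, ← ENNReal.tsum_mul_left]
    refine tsum_congr fun n => ?_
    rw [ENNReal.ofReal_mul (mul_nonneg hρ.1.le h1), ENNReal.ofReal_mul hρ.1.le,
      ENNReal.ofReal_pow (sq_nonneg ρ), coef]
    ring
  rw [setLIntegral_congr_fun measurableSet_Ioo this, lintegral_tsum, ← ENNReal.tsum_mul_left]
  · refine tsum_congr fun n => ?_
    rw [lintegral_mul_const' _ _ (ENNReal.pow_ne_top enorm_ne_top), lintegral_radial_weight,
      ← mul_assoc, show (2 : ℝ≥0∞) = ENNReal.ofReal 2 by norm_num,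
      ← ENNReal.ofReal_mul (by norm_num)]
    congr 2
    field_simp
  · intro n
    exact (Measurable.ennreal_ofReal (by fun_prop)).aemeasurable.mul_const _

theorem sphere_sub_ne_zero {ξ : ℂ} (hξ : ‖ξ‖ = 1) {z : ℂ} (hz : z ∈ Metric.ball (0 : ℂ) 1) :
    ξ - z ≠ 0 := by
  intro h
  have : ‖z‖ < 1 := by simpa using hz
  rw [← sub_eq_zero.1 h, hξ] at this
  exact lt_irrefl _ this

/-- The partial sums `∑_{j ≤ n} j ξ ^ j a_j`. -/
def weightedSum (ξ : ℂ) (a : ℕ → ℂ) (n : ℕ) : ℂ := ∑ j ∈ Finset.range (n + 1), j * ξ ^ j * a j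

/-- With `h = f'/(ξ - z)`, comparing coefficients in `f' = ξ h - z h` gives `(n+1) a_{n+1} = ξ h_n -
h_{n-1}`. Multiplied by `ξ^{n+1}`, the right side telescopes. The outer power of `ξ` has modulus one
and disappears from the norms. -/
theorem coef_deriv_div {f : ℂ → ℂ} (hf : AnalyticOnNhd ℂ f (Metric.ball 0 1)) {ξ : ℂ}
    (hξ : ‖ξ‖ = 1) (n : ℕ) :
    ξ ^ (n + 2) * coef (fun z => deriv f z / (ξ - z)) n = weightedSum ξ (coef f) (n + 1) := by
  have hh : AnalyticOnNhd ℂ (fun z => deriv f z / (ξ - z)) (Metric.ball 0 1) :=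
    hf.deriv.div (analyticOnNhd_const.sub analyticOnNhd_id) fun z hz => sphere_sub_ne_zero hξ hz
  set h := fun z => deriv f z / (ξ - z) with hdef
  have key : ∀ n, (n + 1) * coef f (n + 1) = ξ * coef h n - shift (coef h) n := by
    intro n
    rw [← coef_deriv]
    refine coef_eq_of_hasSum (b := fun n => ξ * coef h n - shift (coef h) n) (fun z hz => ?_) n
    have h1 := (hasSum_coef hh hz).mul_left ξ
    have h2 := hasSum_coef (analyticOnNhd_id.mul hh) hz
    have h3 := h1.sub h2
    have e : deriv f z = ξ * h z - z * h z := by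
      have := sphere_sub_ne_zero hξ hz
      simp only [hdef]
      field_simp
    rw [e]
    refine h3.congr_fun fun n => ?_
    have : coef (fun z => z * h z) n = shift (coef h) n := coef_id_mul hh n
    rw [this]; ring
  induction n with
  | zero =>
    have := key 0
    simp [weightedSum, Finset.sum_range_succ] at this ⊢
    rw [this]; ring
  | succ n ih =>
    have := key (n + 1)
    rw [weightedSum, Finset.sum_range_succ, ← weightedSum, ← ih]
    push_cast at this ⊢
    rw [shift_succ] at this
    linear_combination (-ξ ^ (n + 2)) * this

/-- The local Dirichlet integral in terms of Taylor coefficients. -/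
theorem areaInt_local_eq {f : ℂ → ℂ} (hf : AnalyticOnNhd ℂ f (Metric.ball 0 1)) {ξ : ℂ}
    (hξ : ‖ξ‖ = 1) :
    areaInt (fun z => ENNReal.ofReal ((1 - ‖z‖ ^ 2) / ‖ξ - z‖ ^ 2) * ‖deriv f z‖ₑ ^ 2) =
      ∑' n : ℕ, ENNReal.ofReal (1 / ((n + 1) * (n + 2))) *
        ‖weightedSum ξ (coef f) (n + 1)‖ₑ ^ 2 := by
  have hh : AnalyticOnNhd ℂ (fun z => deriv f z / (ξ - z)) (Metric.ball 0 1) :=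
    hf.deriv.div (analyticOnNhd_const.sub analyticOnNhd_id) fun z hz => sphere_sub_ne_zero hξ hz
  have hm : Measurable (fun z => deriv f z / (ξ - z)) :=
    (measurable_deriv f).div (measurable_const.sub measurable_id)
  -- The denominator `|ξ - z|²` is absorbed into the holomorphic function, so the integrand is `(1 -
  -- |z|²) |f'/(ξ - z)|²`.
  have e1 := areaInt_weight_eq hh hm
  have hξe : ‖ξ‖ₑ = 1 := by rw [← ofReal_norm, hξ]; simp
  have e2 : ∀ n, ‖weightedSum ξ (coef f) (n + 1)‖ₑ =
      ‖coef (fun z => deriv f z / (ξ - z)) n‖ₑ := fun n => by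
    rw [← coef_deriv_div hf hξ, enorm_mul, enorm_pow, hξe, one_pow, one_mul]
  simp only [e2]
  rw [← e1]
  refine areaInt_congr fun z hz => ?_
  have hz1 : ‖z‖ < 1 := by simpa using hz
  have h0 : 0 ≤ 1 - ‖z‖ ^ 2 := by nlinarith [norm_nonneg z]
  have hne : 0 < ‖ξ - z‖ := norm_pos_iff.2 (sphere_sub_ne_zero hξ hz)
  have e : ∀ w : ℂ, ‖w‖ₑ ^ 2 = ENNReal.ofReal (‖w‖ ^ 2) := fun z => by
    rw [ENNReal.ofReal_pow (norm_nonneg _), ofReal_norm]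
  rw [e, e, ← ENNReal.ofReal_mul (by positivity), ← ENNReal.ofReal_mul h0, norm_div, div_pow]
  congr 1
  field_simp

end Local

/-! ### The Dirichlet-type integral as an average of local Dirichlet integrals. -/

section Poisson

theorem integrable_poisson_kernel (μ : Measure (Metric.sphere (0 : ℂ) 1)) [IsFiniteMeasure μ] {z : ℂ}
    (hz : z ∈ Metric.ball (0 : ℂ) 1) :
    Integrable (fun ξ : Metric.sphere (0 : ℂ) 1 => (1 - ‖z‖ ^ 2) / ‖(ξ : ℂ) - z‖ ^ 2) μ := by
  have hz1 : ‖z‖ < 1 := by simpa using hz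
  have h0 : 0 ≤ 1 - ‖z‖ ^ 2 := by nlinarith [norm_nonneg z]
  have hpos : ∀ ξ : Metric.sphere (0 : ℂ) 1, 1 - ‖z‖ ≤ ‖(ξ : ℂ) - z‖ := fun ξ => by
    have := norm_sub_norm_le (ξ : ℂ) z
    rwa [norm_eq_of_mem_sphere] at this
  refine Integrable.of_bound (C := (1 - ‖z‖ ^ 2) / (1 - ‖z‖) ^ 2)
    (Measurable.aestronglyMeasurable (by fun_prop)) (ae_of_all _ fun ξ => ?_)
  rw [Real.norm_of_nonneg (by positivity)]
  have : 0 < 1 - ‖z‖ := by linarith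
  gcongr
  exact hpos ξ

theorem poisson_nonneg (μ : Measure (Metric.sphere (0 : ℂ) 1)) {z : ℂ}
    (hz : z ∈ Metric.ball (0 : ℂ) 1) : 0 ≤ poisson μ z := by
  have hz1 : ‖z‖ < 1 := by simpa using hz
  have h0 : 0 ≤ 1 - ‖z‖ ^ 2 := by nlinarith [norm_nonneg z]
  exact mul_nonneg (by positivity) (integral_nonneg fun ξ => by positivity)

theorem ofReal_poisson (μ : Measure (Metric.sphere (0 : ℂ) 1)) [IsFiniteMeasure μ] {z : ℂ}
    (hz : z ∈ Metric.ball (0 : ℂ) 1) :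
    ENNReal.ofReal (poisson μ z) = ∫⁻ ξ, ENNReal.ofReal ((1 - ‖z‖ ^ 2) / ‖(ξ : ℂ) - z‖ ^ 2)
      ∂(ENNReal.ofReal (2 * Real.pi)⁻¹ • μ) := by
  have hz1 : ‖z‖ < 1 := by simpa using hz
  have h0 : 0 ≤ 1 - ‖z‖ ^ 2 := by nlinarith [norm_nonneg z]
  rw [poisson, ENNReal.ofReal_mul (by positivity), lintegral_smul_measure,
    ofReal_integral_eq_lintegral_ofReal (integrable_poisson_kernel μ hz)
      (ae_of_all _ fun ξ => by positivity), smul_eq_mul]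

/-- The Poisson integral is a superposition of the local weights, so Tonelli moves the integration
over the circle outside the area integral. -/
theorem dirichlet₁_eq (μ : Measure (Metric.sphere (0 : ℂ) 1)) [IsFiniteMeasure μ] {f : ℂ → ℂ}
    (hf : AnalyticOnNhd ℂ f (Metric.ball 0 1)) :
    dirichlet₁ μ f = ∫⁻ ξ, ∑' n : ℕ, ENNReal.ofReal (1 / ((n + 1) * (n + 2))) *
        ‖weightedSum ξ (coef f) (n + 1)‖ₑ ^ 2 ∂(ENNReal.ofReal (2 * Real.pi)⁻¹ • μ) := by
  have h1 : ∀ ξ : Metric.sphere (0 : ℂ) 1, _ := fun ξ =>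
    areaInt_local_eq hf (norm_eq_of_mem_sphere ξ)
  simp only [← h1]
  have hm : Measurable fun p : ℂ × Metric.sphere (0 : ℂ) 1 =>
      ENNReal.ofReal ((1 - ‖p.1‖ ^ 2) / ‖(p.2 : ℂ) - p.1‖ ^ 2) * ‖deriv f p.1‖ₑ ^ 2 :=
    (Measurable.ennreal_ofReal (by fun_prop)).mul
      (((measurable_deriv f).comp measurable_fst).enorm.pow_const 2)
  have : IsFiniteMeasure (ENNReal.ofReal (2 * Real.pi)⁻¹ • μ) := Measure.smul_finite _ (by simp)
  unfold areaInt
  rw [lintegral_const_mul' _ _ ENNReal.ofReal_ne_top,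
    lintegral_lintegral_swap (f := fun (ξ : Metric.sphere (0 : ℂ) 1) (z : ℂ) =>
      ENNReal.ofReal ((1 - ‖z‖ ^ 2) / ‖(ξ : ℂ) - z‖ ^ 2) * ‖deriv f z‖ₑ ^ 2)
      (hm.comp measurable_swap).aemeasurable]
  change areaInt _ = areaInt _
  refine areaInt_congr fun z hz => ?_
  rw [ofReal_poisson μ hz, lintegral_mul_const _ (Measurable.ennreal_ofReal (by fun_prop))]

end Poisson

/-! ### The effect of multiplication by `z` on local Dirichlet integrals. -/

section LocalShift

/-- The local Dirichlet integral at `ξ`, as a functional of the Taylor coefficients. -/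
noncomputable def localSum (ξ : ℂ) (a : ℕ → ℂ) : ℝ≥0∞ :=
  ∑' n : ℕ, ENNReal.ofReal (1 / ((n + 1) * (n + 2))) * ‖weightedSum ξ a (n + 1)‖ₑ ^ 2

/-- The partial sums of `localSum`. -/
noncomputable def localPartial (ξ : ℂ) (a : ℕ → ℂ) (N : ℕ) : ℝ :=
  ∑ n ∈ Finset.range N, 1 / ((n + 1) * (n + 2)) * ‖weightedSum ξ a (n + 1)‖ ^ 2

/-- The sum of the first `N` partial sums of `∑ ξ ^ j a_j`. -/
def doubleSum (ξ : ℂ) (a : ℕ → ℂ) (N : ℕ) : ℂ :=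
  ∑ i ∈ Finset.range N, ∑ j ∈ Finset.range (i + 1), ξ ^ j * a j

theorem doubleSum_succ (ξ : ℂ) (a : ℕ → ℂ) (N : ℕ) :
    doubleSum ξ a (N + 1) = doubleSum ξ a N + ∑ j ∈ Finset.range (N + 1), ξ ^ j * a j := by
  rw [doubleSum, Finset.sum_range_succ, ← doubleSum]

/-- Abel summation: with `s_i = ∑_{j ≤ i} ξ^j a_j` and `D_N = ∑_{i < N} s_i`, the weighted sum is `n
s_n - D_n`, and `s_n = D_{n+1} - D_n`. -/
theorem weightedSum_eq (ξ : ℂ) (a : ℕ → ℂ) (n : ℕ) :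
    weightedSum ξ a n = n * doubleSum ξ a (n + 1) - (n + 1) * doubleSum ξ a n := by
  induction n with
  | zero => simp [weightedSum, doubleSum]
  | succ n ih =>
    rw [weightedSum, Finset.sum_range_succ, ← weightedSum, ih, doubleSum_succ ξ a (n + 1),
      doubleSum_succ ξ a n, Finset.sum_range_succ _ (n + 1)]
    push_cast
    ring

theorem doubleSum_shift (ξ : ℂ) (a : ℕ → ℂ) (N : ℕ) :
    doubleSum ξ (shift a) (N + 1) = ξ * doubleSum ξ a N := by
  induction N with
  | zero => simp [doubleSum]
  | succ N ih =>
    rw [doubleSum_succ, ih, doubleSum_succ ξ a N, Finset.sum_range_succ']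
    simp only [shift_succ, shift_zero, mul_zero, add_zero, mul_add, Finset.mul_sum]
    congr 1
    exact Finset.sum_congr rfl fun j _ => by ring

variable {ξ : ℂ}

/-- A finite form of the identity `D_ξ(zf) = D_ξ(f) + |f(ξ)|²` that needs no boundary values: a
normalized Cesàro sum takes the place of `f(ξ)`. The induction compares increments written in
`D_{N+2}` and `D_{N+1}`; their difference is the increment of the remainder. -/
theorem localPartial_shift (hξ : ‖ξ‖ = 1) (a : ℕ → ℂ) (N : ℕ) :
    localPartial ξ (shift a) (N + 1) =
      localPartial ξ a N + ‖doubleSum ξ a (N + 1)‖ ^ 2 / ((N + 1) * (N + 2)) := by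
  induction N with
  | zero =>
    simp [localPartial, doubleSum, weightedSum, Finset.sum_range_succ, hξ]
    ring
  | succ N ih =>
    rw [localPartial, Finset.sum_range_succ, ← localPartial, ih, localPartial, localPartial,
      Finset.sum_range_succ, weightedSum_eq ξ a, weightedSum_eq ξ (shift a), doubleSum_shift,
      doubleSum_shift]
    have e : ((N + 1 + 1 : ℕ) : ℂ) * (ξ * doubleSum ξ a (N + 1 + 1)) -
        (((N + 1 + 1 : ℕ) : ℂ) + 1) * (ξ * doubleSum ξ a (N + 1)) =
        ξ * (((N + 2 : ℝ) : ℂ) * doubleSum ξ a (N + 2) -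
          ((N + 3 : ℝ) : ℂ) * doubleSum ξ a (N + 1)) := by
      push_cast; ring
    have e' : ((N + 1 : ℕ) : ℂ) * doubleSum ξ a (N + 1 + 1) -
        (((N + 1 : ℕ) : ℂ) + 1) * doubleSum ξ a (N + 1) =
        ((N + 1 : ℝ) : ℂ) * doubleSum ξ a (N + 2) -
          ((N + 2 : ℝ) : ℂ) * doubleSum ξ a (N + 1) := by
      push_cast; ring
    rw [e, e', norm_mul, hξ, one_mul]
    generalize doubleSum ξ a (N + 2) = p
    generalize doubleSum ξ a (N + 1) = q
    -- Each product `αβ` equals the denominator of its own term, so the mixed terms in `p` and `q`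
    -- are the same on both sides and cancel.
    have h3 : ∀ (α β : ℝ), ‖(α : ℂ) * p - (β : ℂ) * q‖ ^ 2 =
        α ^ 2 * ‖p‖ ^ 2 + β ^ 2 * ‖q‖ ^ 2 - 2 * (α * β) * (p.re * q.re + p.im * q.im) := by
      intro α β
      simp only [Complex.sq_norm, Complex.normSq_apply]
      simp
      ring
    rw [h3, h3]
    push_cast
    have h4 : (N : ℝ) + 1 + 2 ≠ 0 := by positivity
    have h5 : (N : ℝ) + 1 + 1 ≠ 0 := by positivity
    have h6 : (N : ℝ) + 1 ≠ 0 := by positivity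
    have h7 : (N : ℝ) + 2 ≠ 0 := by positivity
    field_simp
    ring

/-- The Cesàro means `D_{N+1}/(N+1)` start at `a_0` and have increments `weightedSum /
((n+1)(n+2))`. Cauchy-Schwarz with the weights `1/((n+1)(n+2))`, whose partial sums are below one,
bounds them uniformly by the local integral. This controls the remainder in `localPartial_shift`. -/
theorem norm_doubleSum_sq_le (ξ : ℂ) (a : ℕ → ℂ) (N : ℕ) :
    ‖doubleSum ξ a (N + 1)‖ ^ 2 / ((N + 1) * (N + 2)) ≤
      2 * ‖a 0‖ ^ 2 + 2 * localPartial ξ a N := by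
  have hdiff : ∀ N : ℕ, ‖doubleSum ξ a (N + 1) / (N + 1)‖ ≤
      ‖a 0‖ + ∑ n ∈ Finset.range N, 1 / ((n + 1) * (n + 2) : ℝ) * ‖weightedSum ξ a (n + 1)‖ := by
    intro N
    induction N with
    | zero => simp [doubleSum]
    | succ N ih =>
      rw [Finset.sum_range_succ, ← add_assoc]
      have e : doubleSum ξ a (N + 1 + 1) / ((N + 1 : ℕ) + 1) = doubleSum ξ a (N + 1) / (N + 1) +
          ((1 / ((N + 1) * (N + 2)) : ℝ) : ℂ) * weightedSum ξ a (N + 1) := by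
        rw [weightedSum_eq]
        have h1 : (N : ℂ) + 1 ≠ 0 := by exact_mod_cast N.succ_ne_zero
        have h2 : (N : ℂ) + 1 + 1 ≠ 0 := by exact_mod_cast (N + 1).succ_ne_zero
        have h3 : (N : ℂ) + 2 ≠ 0 := by exact_mod_cast (N + 1).succ_ne_zero
        push_cast
        field_simp
        ring
      rw [e]
      refine (norm_add_le _ _).trans (add_le_add ih ?_)
      rw [norm_mul, Complex.norm_real, Real.norm_of_nonneg (by positivity)]
  have hcs : (∑ n ∈ Finset.range N, 1 / ((n + 1) * (n + 2) : ℝ) * ‖weightedSum ξ a (n + 1)‖) ^ 2 ≤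
      localPartial ξ a N * ∑ n ∈ Finset.range N, 1 / ((n + 1) * (n + 2) : ℝ) := by
    refine Finset.sum_sq_le_sum_mul_sum_of_sq_le_mul _ (fun n _ => by positivity)
      (fun n _ => by positivity) fun n _ => le_of_eq (by ring)
  have hone : ∀ N : ℕ, ∑ n ∈ Finset.range N, 1 / ((n + 1) * (n + 2) : ℝ) = 1 - 1 / (N + 1) := by
    intro N
    induction N with
    | zero => simp
    | succ N ih =>
      rw [Finset.sum_range_succ, ih]
      push_cast
      field_simp
      ring
  have hD : 0 ≤ localPartial ξ a N := Finset.sum_nonneg fun n _ => by positivity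
  have hle1 : ∑ n ∈ Finset.range N, 1 / ((n + 1) * (n + 2) : ℝ) ≤ 1 := by
    rw [hone]
    have : (0 : ℝ) < 1 / (N + 1) := by positivity
    linarith
  have hcs' := hcs.trans (mul_le_of_le_one_right hD hle1)
  have h := hdiff N
  have h1 : ‖doubleSum ξ a (N + 1)‖ ^ 2 / ((N + 1) * (N + 2)) ≤
      ‖doubleSum ξ a (N + 1) / (N + 1)‖ ^ 2 := by
    have : ‖(N + 1 : ℂ)‖ = N + 1 := by exact_mod_cast Complex.norm_natCast (N + 1)
    rw [norm_div, div_pow, this]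
    gcongr
    nlinarith [(Nat.cast_nonneg N : (0 : ℝ) ≤ N)]
  refine h1.trans ((pow_le_pow_left₀ (norm_nonneg _) h 2).trans ?_)
  refine add_sq_le.trans ?_
  nlinarith

theorem tendsto_localPartial (ξ : ℂ) (a : ℕ → ℂ) :
    Tendsto (fun N => ENNReal.ofReal (localPartial ξ a N)) atTop (𝓝 (localSum ξ a)) := by
  have h := ENNReal.tendsto_nat_tsum fun n : ℕ =>
    ENNReal.ofReal (1 / ((n + 1) * (n + 2))) * ‖weightedSum ξ a (n + 1)‖ₑ ^ 2
  refine h.congr fun N => ?_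
  rw [localPartial, ENNReal.ofReal_sum_of_nonneg fun n _ => by positivity]
  refine Finset.sum_congr rfl fun n _ => ?_
  rw [ENNReal.ofReal_mul (by positivity), ENNReal.ofReal_pow (norm_nonneg _), ofReal_norm]

theorem localPartial_nonneg (ξ : ℂ) (a : ℕ → ℂ) (N : ℕ) : 0 ≤ localPartial ξ a N :=
  Finset.sum_nonneg fun n _ => by positivity

theorem ofReal_localPartial_le (ξ : ℂ) (a : ℕ → ℂ) (N : ℕ) :
    ENNReal.ofReal (localPartial ξ a N) ≤ localSum ξ a := by
  refine Monotone.ge_of_tendsto (fun M N h => ENNReal.ofReal_le_ofReal ?_) (tendsto_localPartial ξ a) N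
  exact Finset.sum_le_sum_of_subset_of_nonneg (Finset.range_mono h) fun n _ _ => by positivity

/-- The constant is `3 = 1 + 2`: one copy of the local sum from the shift formula and two from the
bound on its remainder. This is the source of the boundedness of `M_z`. -/
theorem localSum_shift_le (hξ : ‖ξ‖ = 1) (a : ℕ → ℂ) :
    localSum ξ (shift a) ≤ 3 * localSum ξ a + 2 * ‖a 0‖ₑ ^ 2 := by
  refine le_of_tendsto ((tendsto_localPartial ξ (shift a)).comp (tendsto_add_atTop_nat 1))
    (Eventually.of_forall fun N => ?_)
  have h1 : localPartial ξ (shift a) (N + 1) ≤ 3 * localPartial ξ a N + 2 * ‖a 0‖ ^ 2 := by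
    rw [localPartial_shift hξ]
    linarith [norm_doubleSum_sq_le ξ a N]
  refine (ENNReal.ofReal_le_ofReal h1).trans ?_
  rw [ENNReal.ofReal_add (by linarith [localPartial_nonneg ξ a N]) (by positivity),
    ENNReal.ofReal_mul (by norm_num), ENNReal.ofReal_mul (by norm_num),
    ENNReal.ofReal_pow (norm_nonneg _), ofReal_norm]
  simp only [ENNReal.ofReal_ofNat]
  gcongr
  exact ofReal_localPartial_le ξ a N

theorem le_localSum_shift (hξ : ‖ξ‖ = 1) (a : ℕ → ℂ) : localSum ξ a ≤ localSum ξ (shift a) := by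
  refine le_of_tendsto_of_tendsto (tendsto_localPartial ξ a)
    ((tendsto_localPartial ξ (shift a)).comp (tendsto_add_atTop_nat 1))
    (Eventually.of_forall fun N => ENNReal.ofReal_le_ofReal ?_)
  rw [localPartial_shift hξ]
  exact le_add_of_nonneg_right (by positivity)

/-- A second shift leaves the Cesàro sum in the remainder unchanged up to the factor `ξ` but raises
its index by one. Hence the second difference of partial sums is `-2/(N+3)` times a bounded
quantity, and it vanishes in the limit. -/
theorem localSum_shift_shift (hξ : ‖ξ‖ = 1) (a : ℕ → ℂ) :
    localSum ξ (shift (shift a)) + localSum ξ a = 2 * localSum ξ (shift a) := by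
  -- In the infinite case both sides are infinite. Finiteness is needed below to bound the
  -- remainders `B N`.
  by_cases hfin : localSum ξ a = ∞
  · have h1 : localSum ξ (shift a) = ∞ := top_le_iff.1 (hfin ▸ le_localSum_shift hξ a)
    simp [hfin, h1]
  set B : ℕ → ℝ := fun N => ‖doubleSum ξ a (N + 1)‖ ^ 2 / ((N + 1) * (N + 2)) with hB
  have hBle : ∀ N, B N ≤ 2 * ‖a 0‖ ^ 2 + 2 * (localSum ξ a).toReal := fun N => by
    refine (norm_doubleSum_sq_le ξ a N).trans ?_
    have := ENNReal.toReal_mono hfin (ofReal_localPartial_le ξ a N)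
    rw [ENNReal.toReal_ofReal (localPartial_nonneg ξ a N)] at this
    linarith
  have hB0 : Tendsto (fun N : ℕ => 2 / ((N : ℝ) + 3) * B N) atTop (𝓝 0) := by
    have h2 : Tendsto (fun N : ℕ => 2 / ((N : ℝ) + 3)) atTop (𝓝 0) :=
      tendsto_const_nhds.div_atTop
        (tendsto_atTop_add_const_right _ _ tendsto_natCast_atTop_atTop)
    have h3 := h2.mul_const (2 * ‖a 0‖ ^ 2 + 2 * (localSum ξ a).toReal)
    rw [zero_mul] at h3
    exact squeeze_zero (fun N => by positivity)
      (fun N => mul_le_mul_of_nonneg_left (hBle N) (by positivity)) h3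
  -- The levels `N + 2`, `N + 1`, `N` match the number of shifts. The two remainders are
  -- `(N+1)/(N+3) * B N` and `B N`, which explains the factor `2/(N+3)`.
  have key : ∀ N, ENNReal.ofReal (localPartial ξ (shift (shift a)) (N + 2)) +
      ENNReal.ofReal (localPartial ξ a N) + ENNReal.ofReal (2 / ((N : ℝ) + 3) * B N) =
      2 * ENNReal.ofReal (localPartial ξ (shift a) (N + 1)) := by
    intro N
    have hBN : 0 ≤ 2 / ((N : ℝ) + 3) * B N := by positivity
    rw [← ENNReal.ofReal_add (localPartial_nonneg _ _ _) (localPartial_nonneg _ _ _),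
      ← ENNReal.ofReal_add (add_nonneg (localPartial_nonneg _ _ _) (localPartial_nonneg _ _ _)) hBN,
      show (2 : ℝ≥0∞) = ENNReal.ofReal 2 by norm_num, ← ENNReal.ofReal_mul (by norm_num)]
    congr 1
    rw [localPartial_shift hξ, localPartial_shift hξ, doubleSum_shift, norm_mul, hξ, one_mul]
    simp only [hB]
    push_cast
    have h4 : (N : ℝ) + 1 + 2 ≠ 0 := by positivity
    have h5 : (N : ℝ) + 1 + 1 ≠ 0 := by positivity
    field_simp
    ring
  have h1 := (tendsto_localPartial ξ (shift (shift a))).comp (tendsto_add_atTop_nat 2)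
  have h2 := (tendsto_localPartial ξ (shift a)).comp (tendsto_add_atTop_nat 1)
  have h3 := ENNReal.tendsto_ofReal hB0
  rw [ENNReal.ofReal_zero] at h3
  have h4 := (h1.add (tendsto_localPartial ξ a)).add h3
  rw [add_zero] at h4
  refine tendsto_nhds_unique h4 ?_
  exact (ENNReal.Tendsto.const_mul h2 (Or.inr (by simp))).congr fun N => (key N).symm

end LocalShift

/-! ### The norm of `𝒟(μ)` as an `L²` norm of coefficient functionals. -/

section Model

/-- The index set of the functionals that represent the norm of a Dirichlet-type space. -/
abbrev Idx : Type := ℕ ⊕ (ℕ × Metric.sphere (0 : ℂ) 1)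

/-- The number of Taylor coefficients that a functional depends on. -/
def Idx.deg : Idx → ℕ
  | .inl n => n + 1
  | .inr p => p.1 + 2

/-- The matrix of a functional. -/
noncomputable def Idx.coeff : Idx → ℕ → ℂ
  | .inl n, j => if j = n then 1 else 0
  | .inr p, j => if j < p.1 + 2 then
      (Real.sqrt (1 / ((p.1 + 1) * (p.1 + 2))) : ℂ) * (j * (p.2 : ℂ) ^ j) else 0

/-- The functionals whose squared moduli add up to the norm of a Dirichlet-type space. -/
noncomputable def ev (x : Idx) (a : ℕ → ℂ) : ℂ := ∑ j ∈ Finset.range x.deg, x.coeff j * a j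

theorem ev_inl (n : ℕ) (a : ℕ → ℂ) : ev (.inl n) a = a n := by
  simp [ev, Idx.deg, Idx.coeff]

theorem ev_inr (p : ℕ × Metric.sphere (0 : ℂ) 1) (a : ℕ → ℂ) :
    ev (.inr p) a = (Real.sqrt (1 / ((p.1 + 1) * (p.1 + 2))) : ℂ) *
      weightedSum p.2 a (p.1 + 1) := by
  rw [ev, weightedSum, Finset.mul_sum]
  refine Finset.sum_congr rfl fun j hj => ?_
  have : j < p.1 + 2 := Finset.mem_range.1 hj
  simp only [Idx.coeff, this, if_true]
  ring

theorem ev_add (x : Idx) (a b : ℕ → ℂ) : ev x (fun j => a j + b j) = ev x a + ev x b := by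
  simp [ev, mul_add, Finset.sum_add_distrib]

theorem ev_const_mul (x : Idx) (c : ℂ) (a : ℕ → ℂ) : ev x (fun j => c * a j) = c * ev x a := by
  simp only [ev, Finset.mul_sum]
  exact Finset.sum_congr rfl fun j _ => by ring

/-- Joint measurability, with the index and the sequence both varying, is what the later uses of
Tonelli require. -/
theorem measurable_ev {Y : Type*} [MeasurableSpace Y] {φ : Y → Idx} (hφ : Measurable φ)
    {v : ℕ → Y → ℂ} (hv : ∀ j, Measurable (v j)) :
    Measurable fun y => ev (φ y) (fun j => v j y) := by
  have hc : ∀ j, Measurable fun x : Idx => x.coeff j := by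
    intro j
    refine measurable_fun_sum (measurable_of_countable _) ?_
    refine measurable_from_prod_countable_right fun n => ?_
    change Measurable fun ξ : Metric.sphere (0 : ℂ) 1 => if j < n + 2 then
      (Real.sqrt (1 / ((n + 1) * (n + 2))) : ℂ) * (j * (ξ : ℂ) ^ j) else 0
    split_ifs <;> fun_prop
  have hz : ∀ x : Idx, ∀ j, x.deg ≤ j → x.coeff j = 0 := by
    rintro (n | p) j hj
    · simp only [Idx.deg, Idx.coeff] at hj ⊢
      rw [if_neg (by omega)]
    · simp only [Idx.deg, Idx.coeff] at hj ⊢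
      rw [if_neg (by omega)]
  -- The length of the defining sum depends on the index. Since the matrix entries vanish beyond the
  -- degree, sums of fixed length `N` are eventually equal to it.
  refine measurable_of_tendsto_metrizable (f := fun N y => ∑ j ∈ Finset.range N,
    (φ y).coeff j * v j y) (fun N => ?_) (tendsto_pi_nhds.2 fun y => ?_)
  · exact Finset.measurable_sum _ fun j _ => ((hc j).comp hφ).mul (hv j)
  · refine tendsto_const_nhds.congr' ?_
    filter_upwards [eventually_ge_atTop (φ y).deg] with N hN
    refine Finset.sum_subset (Finset.range_mono hN) fun j _ hj => ?_
    rw [hz _ _ (by simpa using hj), zero_mul]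

variable (μ : Measure (Metric.sphere (0 : ℂ) 1))

/-- The measure `μ / 2π`. -/
noncomputable def circ : Measure (Metric.sphere (0 : ℂ) 1) := ENNReal.ofReal (2 * Real.pi)⁻¹ • μ

noncomputable instance [IsFiniteMeasure μ] : IsFiniteMeasure (circ μ) := Measure.smul_finite _ (by simp)

/-- The part of the index measure that represents the Dirichlet-type integral. -/
noncomputable def dirichletMeasure : Measure (ℕ × Metric.sphere (0 : ℂ) 1) :=
  Measure.count.prod (circ μ)

noncomputable instance [IsFiniteMeasure μ] : SFinite (dirichletMeasure μ) := by unfold dirichletMeasure; infer_instance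

/-- The index measure: the norm of `𝒟(μ)` is an `L²`-norm with respect to it. -/
noncomputable def idxMeasure : Measure Idx :=
  Measure.count.map Sum.inl + (dirichletMeasure μ).map Sum.inr

noncomputable instance [IsFiniteMeasure μ] : SFinite (idxMeasure μ) := by unfold idxMeasure; infer_instance

theorem lintegral_idxMeasure (F : Idx → ℝ≥0∞) :
    ∫⁻ x, F x ∂idxMeasure μ = ∑' n, F (.inl n) + ∫⁻ p, F (.inr p) ∂dirichletMeasure μ := by
  have h1 : MeasurableEmbedding (Sum.inl : ℕ → Idx) :=
    ⟨Sum.inl_injective, measurable_inl, fun _ hs => measurableSet_inl_image.2 hs⟩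
  have h2 : MeasurableEmbedding (Sum.inr : ℕ × Metric.sphere (0 : ℂ) 1 → Idx) :=
    ⟨Sum.inr_injective, measurable_inr, fun _ hs => measurableSet_inr_image.2 hs⟩
  rw [idxMeasure, lintegral_add_measure, h1.lintegral_map, h2.lintegral_map, lintegral_count]

variable [IsFiniteMeasure μ]

theorem lintegral_dirichletMeasure (a : ℕ → ℂ) :
    ∫⁻ p, ‖ev (.inr p) a‖ₑ ^ 2 ∂dirichletMeasure μ = ∫⁻ ξ, localSum ξ a ∂circ μ := by
  have hm : Measurable fun p : ℕ × Metric.sphere (0 : ℂ) 1 => ‖ev (.inr p) a‖ₑ ^ 2 :=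
    (measurable_ev measurable_inr fun j => measurable_const).enorm.pow_const 2
  have hm' : ∀ n : ℕ, Measurable fun ξ : Metric.sphere (0 : ℂ) 1 => ‖ev (.inr (n, ξ)) a‖ₑ ^ 2 :=
    fun n => hm.comp (measurable_const.prodMk measurable_id)
  rw [dirichletMeasure, lintegral_prod _ hm.aemeasurable, lintegral_count,
    ← lintegral_tsum fun n => (hm' n).aemeasurable]
  refine lintegral_congr fun ξ => tsum_congr fun n => ?_
  rw [ev_inr, enorm_mul, mul_pow]
  congr 1
  rw [← ofReal_norm, Complex.norm_real, Real.norm_of_nonneg (Real.sqrt_nonneg _),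
    ← ENNReal.ofReal_pow (Real.sqrt_nonneg _), Real.sq_sqrt (by positivity)]

theorem dirichlet₁_eq_lintegral {f : ℂ → ℂ} (hf : AnalyticOnNhd ℂ f (Metric.ball 0 1)) :
    dirichlet₁ μ f = ∫⁻ p, ‖ev (.inr p) (coef f)‖ₑ ^ 2 ∂dirichletMeasure μ := by
  rw [lintegral_dirichletMeasure, dirichlet₁_eq μ hf]
  rfl

/-- The `L²` model in one variable: the discrete block gives the `H²` norm, the other block the
Dirichlet-type integral. -/
theorem norm_sq_eq_lintegral {f : ℂ → ℂ} (hf : AnalyticOnNhd ℂ f (Metric.ball 0 1)) :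
    hardySq₁ f + dirichlet₁ μ f = ∫⁻ x, ‖ev x (coef f)‖ₑ ^ 2 ∂idxMeasure μ := by
  rw [lintegral_idxMeasure, hardySq₁_eq hf, dirichlet₁_eq_lintegral μ hf]
  simp only [ev_inl]

/-- Stated for arbitrary sequences, so that the shift estimates can be made on sequences alone. -/
theorem lintegral_ev (a : ℕ → ℂ) :
    ∫⁻ x, ‖ev x a‖ₑ ^ 2 ∂idxMeasure μ = ∑' n, ‖a n‖ₑ ^ 2 + ∫⁻ ξ, localSum ξ a ∂circ μ := by
  rw [lintegral_idxMeasure, lintegral_dirichletMeasure]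
  simp only [ev_inl]

theorem measurable_localSum (a : ℕ → ℂ) :
    Measurable fun ξ : Metric.sphere (0 : ℂ) 1 => localSum ξ a := by
  refine Measurable.tsum fun n => Measurable.const_mul ?_ _
  unfold weightedSum
  fun_prop

theorem tsum_shift (a : ℕ → ℂ) : ∑' n, ‖shift a n‖ₑ ^ 2 = ∑' n, ‖a n‖ₑ ^ 2 := by
  rw [tsum_eq_zero_add' ENNReal.summable]
  simp

theorem lintegral_ev_shift_le (a : ℕ → ℂ) :
    ∫⁻ x, ‖ev x (shift a)‖ₑ ^ 2 ∂idxMeasure μ ≤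
      (3 + 2 * circ μ univ) * ∫⁻ x, ‖ev x a‖ₑ ^ 2 ∂idxMeasure μ := by
  rw [lintegral_ev, lintegral_ev, tsum_shift]
  have h0 : ‖a 0‖ₑ ^ 2 ≤ ∑' n, ‖a n‖ₑ ^ 2 := ENNReal.le_tsum 0
  have h1 : ∫⁻ ξ, localSum ξ (shift a) ∂circ μ ≤
      3 * ∫⁻ ξ, localSum ξ a ∂circ μ + 2 * ‖a 0‖ₑ ^ 2 * circ μ univ := by
    refine (lintegral_mono fun ξ => localSum_shift_le (norm_eq_of_mem_sphere ξ) a).trans ?_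
    rw [lintegral_add_right _ measurable_const, lintegral_const_mul _ (measurable_localSum a),
      lintegral_const]
  generalize ∫⁻ ξ, localSum ξ (shift a) ∂circ μ = s at *
  generalize ∫⁻ ξ, localSum ξ a ∂circ μ = t at *
  generalize ∑' n, ‖a n‖ₑ ^ 2 = u at *
  generalize circ μ univ = m at *
  -- The extra term `2u + 2mt` is added only to make the bound factor as a constant times the full
  -- norm `u + t`.
  calc u + s ≤ u + (3 * t + 2 * u * m) := by gcongr; exact h1.trans (by gcongr)
    _ ≤ (u + (3 * t + 2 * u * m)) + (2 * u + 2 * m * t) := le_self_add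
    _ = (3 + 2 * m) * (u + t) := by ring

/-- The `ℓ²` part is invariant under the shift and the local part satisfies the identity at every
`ξ`; integrating over the circle gives the `2`-isometry law of `M_z`. -/
theorem lintegral_ev_shift_shift (a : ℕ → ℂ) :
    ∫⁻ x, ‖ev x (shift (shift a))‖ₑ ^ 2 ∂idxMeasure μ + ∫⁻ x, ‖ev x a‖ₑ ^ 2 ∂idxMeasure μ =
      2 * ∫⁻ x, ‖ev x (shift a)‖ₑ ^ 2 ∂idxMeasure μ := by
  simp only [lintegral_ev, tsum_shift]
  have h : ∫⁻ ξ, localSum ξ (shift (shift a)) ∂circ μ + ∫⁻ ξ, localSum ξ a ∂circ μ =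
      2 * ∫⁻ ξ, localSum ξ (shift a) ∂circ μ := by
    rw [← lintegral_add_left (measurable_localSum _), ← lintegral_const_mul _ (measurable_localSum _)]
    exact lintegral_congr fun ξ => localSum_shift_shift (norm_eq_of_mem_sphere ξ) a
  rw [add_add_add_comm, h, mul_add, two_mul (∑' n, _)]

end Model

/-! ### Energy spaces embedded in `L²`: inner products and completeness. -/

namespace EnergySpace

variable {V : Type*} [AddCommGroup V] [Module ℂ V] {Q : V → ℝ≥0∞} {hQ : IsEnergy Q}
  {X : Type*} [MeasurableSpace X] {ν : Measure X} {ℓ : X → V →ₗ[ℂ] ℂ}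

theorem memLp_of_eq_lintegral (hm : ∀ f, Measurable fun x => ℓ x f)
    (hℓ : ∀ f, Q f = ∫⁻ x, ‖ℓ x f‖ₑ ^ 2 ∂ν) (f : EnergySpace Q hQ) :
    MemLp (fun x => ℓ x f.val) 2 ν := by
  refine ⟨(hm _).aestronglyMeasurable, ?_⟩
  rw [eLpNorm_lt_top_iff_lintegral_rpow_enorm_lt_top (by simp) (by simp)]
  have := f.energy_lt_top
  rw [hℓ] at this
  simpa using this

theorem enorm_sq (f : EnergySpace Q hQ) : ‖f‖ₑ ^ 2 = Q f.val := by
  rw [← ofReal_norm, ← ENNReal.ofReal_pow (norm_nonneg _), norm_sq,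
    ENNReal.ofReal_toReal f.energy_lt_top.ne]

/-- A representation of the energy as an `L²`-norm embeds the energy space into `L²`. -/
noncomputable def toL2 (hm : ∀ f, Measurable fun x => ℓ x f)
    (hℓ : ∀ f, Q f = ∫⁻ x, ‖ℓ x f‖ₑ ^ 2 ∂ν) : EnergySpace Q hQ →ₗᵢ[ℂ] Lp ℂ 2 ν where
  toFun f := (memLp_of_eq_lintegral hm hℓ f).toLp _
  map_add' f g := by
    rw [← MemLp.toLp_add]
    congr 1
    ext x
    simp
  map_smul' c f := by
    rw [RingHom.id_apply, ← MemLp.toLp_const_smul]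
    congr 1
    ext x
    simp
  norm_map' f := by
    change ‖(memLp_of_eq_lintegral hm hℓ f).toLp _‖ = ‖f‖
    rw [Lp.norm_toLp, norm_def, hℓ, eLpNorm_eq_lintegral_rpow_enorm_toReal (by simp) (by simp),
      Real.sqrt_eq_rpow, ENNReal.toReal_rpow]
    simp

/-- An isometry preserves inner products, so those of the energy space are integrals, to which
Fubini can be applied. -/
theorem inner_eq_integral (hm : ∀ f, Measurable fun x => ℓ x f)
    (hℓ : ∀ f, Q f = ∫⁻ x, ‖ℓ x f‖ₑ ^ 2 ∂ν) (f g : EnergySpace Q hQ) :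
    inner ℂ f g = ∫ x, (starRingEnd ℂ) (ℓ x f.val) * ℓ x g.val ∂ν := by
  rw [← (toL2 hm hℓ).inner_map_map f g, L2.inner_def]
  refine integral_congr_ae ?_
  filter_upwards [(memLp_of_eq_lintegral hm hℓ f).coeFn_toLp,
    (memLp_of_eq_lintegral hm hℓ g).coeFn_toLp] with x h1 h2
  change inner ℂ ((memLp_of_eq_lintegral hm hℓ f).toLp _ x)
    ((memLp_of_eq_lintegral hm hℓ g).toLp _ x) = _
  rw [h1, h2, RCLike.inner_apply']

/-- An energy space is complete if every Cauchy sequence has a pointwise limit, with respect to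
functionals that represent the energy. -/
theorem completeSpace_of_pointwise_limits (hm : ∀ f, Measurable fun x => ℓ x f)
    (hℓ : ∀ f, Q f = ∫⁻ x, ‖ℓ x f‖ₑ ^ 2 ∂ν)
    (hlim : ∀ u : ℕ → EnergySpace Q hQ, CauchySeq u →
      ∃ g : V, ∀ x, Tendsto (fun k => ℓ x (u k).val) atTop (𝓝 (ℓ x g))) :
    CompleteSpace (EnergySpace Q hQ) := by
  refine UniformSpace.complete_of_cauchySeq_tendsto fun u hu => ?_
  obtain ⟨g, hg⟩ := hlim u hu
  -- Fatou's lemma along the pointwise limit: a Cauchy bound on `u l - u k` passes to `g - u k`.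
  have fatou : ∀ k (C : ℝ≥0∞), (∀ᶠ l in atTop, ‖u l - u k‖ₑ ^ 2 ≤ C) → Q (g - (u k).val) ≤ C := by
    intro k C hC
    rw [hℓ]
    have h1 : ∀ x, ‖ℓ x (g - (u k).val)‖ₑ ^ 2 =
        liminf (fun l => ‖ℓ x ((u l).val - (u k).val)‖ₑ ^ 2) atTop := by
      intro x
      refine (Tendsto.liminf_eq ?_).symm
      simp only [map_sub]
      exact ((ENNReal.continuous_pow 2).tendsto _).comp
        ((continuous_enorm.tendsto _).comp ((hg x).sub_const _))
    simp only [h1]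
    refine (lintegral_liminf_le fun l => (hm _).enorm.pow_const 2).trans ?_
    refine liminf_le_of_frequently_le' (hC.mono fun l hl => ?_).frequently
    rw [← hℓ, ← map_sub]
    exact (enorm_sq (u l - u k)).symm.le.trans hl
  have hcauchy : ∀ ε : ℝ, 0 < ε → ∃ N, ∀ k ≥ N, Q (g - (u k).val) ≤ ENNReal.ofReal ε ^ 2 := by
    intro ε hε
    obtain ⟨N, hN⟩ := Metric.cauchySeq_iff.1 hu ε hε
    refine ⟨N, fun k hk => fatou k _ ?_⟩
    filter_upwards [eventually_ge_atTop N] with l hl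
    gcongr
    rw [← ofReal_norm, ← dist_eq_norm]
    exact ENNReal.ofReal_le_ofReal (hN l hl k hk).le
  obtain ⟨N, hN⟩ := hcauchy 1 one_pos
  -- The limit `g` has finite energy because `g - u N` has; it enters the space as `d + u N`.
  let d : EnergySpace Q hQ := ⟨g - (u N).val, (hN N le_rfl).trans_lt (by simp)⟩
  refine ⟨d + u N, Metric.tendsto_atTop.2 fun ε hε => ?_⟩
  obtain ⟨M, hM⟩ := hcauchy (ε / 2) (by positivity)
  refine ⟨M, fun k hk => ?_⟩
  have h1 : (d + u N - u k).val = g - (u k).val := by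
    rw [map_sub, map_add]
    change g - (u N).val + (u N).val - _ = _
    rw [sub_add_cancel]
  have h2 := hM k hk
  rw [← h1, ← enorm_sq (d + u N - u k)] at h2
  rw [← ofReal_norm, ← ENNReal.ofReal_pow (norm_nonneg _), ← ENNReal.ofReal_pow (by positivity),
    ENNReal.ofReal_le_ofReal_iff (by positivity)] at h2
  have h3 := (pow_le_pow_iff_left₀ (norm_nonneg _) (by positivity) two_ne_zero).1 h2
  rw [dist_comm, dist_eq_norm]
  linarith

end EnergySpace

/-! ### Holomorphic functions with prescribed bounded coefficients. -/

section Synthesis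

/-- A power series with bounded coefficients in a Banach space converges on the unit disc. -/
theorem analyticOnNhd_powerSeries {E : Type*} [NormedAddCommGroup E] [NormedSpace ℂ E]
    [CompleteSpace E] {v : ℕ → E} {C : ℝ} (hv : ∀ n, ‖v n‖ ≤ C) :
    (∀ z ∈ Metric.ball (0 : ℂ) 1, Summable fun n => z ^ n • v n) ∧
      AnalyticOnNhd ℂ (fun z : ℂ => ∑' n, z ^ n • v n) (Metric.ball 0 1) := by
  have hC : 0 ≤ C := (norm_nonneg _).trans (hv 0)
  have hb : ∀ (r : ℝ) (z : ℂ), ‖z‖ ≤ r → ∀ n : ℕ, ‖z ^ n • v n‖ ≤ r ^ n * C := fun r z hz n => by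
    rw [norm_smul, norm_pow]
    exact mul_le_mul (pow_le_pow_left₀ (norm_nonneg z) hz n) (hv n) (norm_nonneg _)
      (pow_nonneg ((norm_nonneg z).trans hz) n)
  have hs : ∀ r : ℝ, 0 ≤ r → r < 1 → Summable fun n : ℕ => r ^ n * C := fun r h0 h1 =>
    (summable_geometric_of_lt_one h0 h1).mul_right C
  refine ⟨fun z hz => (hs ‖z‖ (norm_nonneg _) (by simpa using hz)).of_norm_bounded (hb _ z le_rfl),
    ?_⟩
  refine DifferentiableOn.analyticOnNhd (fun z hz => ?_) Metric.isOpen_ball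
  -- Geometric domination is uniform only on smaller discs, so differentiability is checked on a
  -- disc of radius `r` with `|z| < r < 1`.
  obtain ⟨r, hzr, hr1⟩ := exists_between (show ‖z‖ < 1 by simpa using hz)
  have hd : DifferentiableOn ℂ (fun z : ℂ => ∑' n, z ^ n • v n) (Metric.ball 0 r) := by
    refine Complex.differentiableOn_tsum_of_summable_norm (hs r ((norm_nonneg z).trans hzr.le) hr1)
      (fun n => by fun_prop) Metric.isOpen_ball fun n w hw => hb r w ?_ n
    exact (by simpa using hw : ‖w‖ < r).le
  exact (hd.differentiableAt (Metric.isOpen_ball.mem_nhds (by simpa using hzr))).differentiableWithinAt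

theorem exists_holo_coef {a : ℕ → ℂ} {C : ℝ} (ha : ∀ n, ‖a n‖ ≤ C) :
    ∃ f : holo (Metric.ball (0 : ℂ) 1), coef f = a := by
  obtain ⟨hs, han⟩ := analyticOnNhd_powerSeries ha
  have he : EqOn (fun z : ℂ => ∑' n, z ^ n • a n)
      ((Metric.ball (0 : ℂ) 1).indicator fun z => ∑' n, z ^ n • a n) (Metric.ball 0 1) :=
    fun z hz => (indicator_of_mem (f := fun z : ℂ => ∑' n, z ^ n • a n) hz).symm
  refine ⟨⟨_, han.congr Metric.isOpen_ball he, fun z hz => indicator_of_notMem hz _⟩, ?_⟩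
  ext n
  refine coef_eq_of_hasSum (fun z hz => ?_) n
  change HasSum _ ((Metric.ball (0 : ℂ) 1).indicator (fun z => ∑' n, z ^ n • a n) z)
  rw [← he hz]
  simpa only [smul_eq_mul, mul_comm] using (hs z hz).hasSum

end Synthesis

/-! ### Partial derivatives on the bidisc and derivatives of slices. -/

section PartialDerivatives

theorem partial_comm {f : ℂ × ℂ → ℂ} (hf : AnalyticOnNhd ℂ f bidisc) :
    EqOn (partial₁ (partial₂ f)) (partial₂ (partial₁ f)) bidisc := by
  intro z hz
  have hd : DifferentiableAt ℂ (fderiv ℂ f) z := (hf.fderiv z hz).differentiableAt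
  have e : ∀ u v : ℂ × ℂ, fderiv ℂ (fun p => fderiv ℂ f p v) z u = fderiv ℂ (fderiv ℂ f) z u v := by
    intro u v
    rw [fderiv_clm_apply hd (differentiableAt_const v)]
    simp
  have hs : IsSymmSndFDerivAt ℂ f z :=
    (hf z hz).contDiffAt.isSymmSndFDerivAt (n := ⊤) (by simp)
  change fderiv ℂ (fun p => fderiv ℂ f p (0, 1)) z (1, 0) =
    fderiv ℂ (fun p => fderiv ℂ f p (1, 0)) z (0, 1)
  rw [e, e]
  exact hs.eq _ _

theorem partial₁_iterate {f : ℂ × ℂ → ℂ} (hf : AnalyticOnNhd ℂ f bidisc) (j : ℕ) :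
    AnalyticOnNhd ℂ (partial₁^[j] f) bidisc := by
  induction j with
  | zero => exact hf
  | succ j ih =>
    rw [Function.iterate_succ_apply']
    exact analytic_partial₁ ih

theorem partial₁_congr {f g : ℂ × ℂ → ℂ} (h : EqOn f g bidisc) :
    EqOn (partial₁ f) (partial₁ g) bidisc := fun z hz => by
  rw [partial₁, partial₁, (h.eventuallyEq_of_mem (isOpen_bidisc.mem_nhds hz)).fderiv_eq]

theorem partial₁_iterate_partial₂ {f : ℂ × ℂ → ℂ} (hf : AnalyticOnNhd ℂ f bidisc) (j : ℕ) :
    EqOn (partial₁^[j] (partial₂ f)) (partial₂ (partial₁^[j] f)) bidisc := by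
  induction j with
  | zero => exact fun _ _ => rfl
  | succ j ih =>
    rw [Function.iterate_succ_apply', Function.iterate_succ_apply']
    exact fun z hz => (partial₁_congr ih hz).trans (partial_comm (partial₁_iterate hf j) hz)

/-- Rewriting derivatives of slices as iterated partial derivatives makes their holomorphic
dependence on the other variable visible. -/
theorem iteratedDeriv_slice₁ {f : ℂ × ℂ → ℂ} (hf : AnalyticOnNhd ℂ f bidisc) (j : ℕ) {z w : ℂ}
    (h : (z, w) ∈ bidisc) : iteratedDeriv j (fun u => f (u, w)) z = partial₁^[j] f (z, w) := by
  induction j generalizing f with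
  | zero => simp
  | succ j ih =>
    rw [iteratedDeriv_succ', Function.iterate_succ_apply, ← ih (analytic_partial₁ hf)]
    refine Filter.EventuallyEq.iteratedDeriv_eq j ?_
    filter_upwards [Metric.isOpen_ball.mem_nhds h.1] with u hu
    exact deriv_slice₁ hf ⟨hu, h.2⟩

theorem partial₁_swap {f : ℂ × ℂ → ℂ} (hf : AnalyticOnNhd ℂ f bidisc) {z w : ℂ}
    (h : (z, w) ∈ bidisc) : partial₁ (fun p => f (p.2, p.1)) (w, z) = partial₂ f (z, w) := by
  rw [← deriv_slice₁ (analytic_swap hf) ⟨h.2, h.1⟩, ← deriv_slice₂ hf h]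

end PartialDerivatives

/-! ### Taylor coefficients in two variables. -/

section TwoVariableCoefficients

theorem zero_mem_ball : (0 : ℂ) ∈ Metric.ball (0 : ℂ) 1 := by simp

theorem coef_slice₁ {f : ℂ × ℂ → ℂ} (hf : AnalyticOnNhd ℂ f bidisc) (j : ℕ) :
    EqOn (fun w => coef (fun z => f (z, w)) j)
      (fun w => (j.factorial : ℂ)⁻¹ * partial₁^[j] f (0, w)) (Metric.ball 0 1) := fun w hw => by
  change (j.factorial : ℂ)⁻¹ * iteratedDeriv j (fun z => f (z, w)) 0 = _
  rw [iteratedDeriv_slice₁ hf j ⟨zero_mem_ball, hw⟩]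

theorem analytic_coef_slice₁ {f : ℂ × ℂ → ℂ} (hf : AnalyticOnNhd ℂ f bidisc) (j : ℕ) :
    AnalyticOnNhd ℂ (fun w => coef (fun z => f (z, w)) j) (Metric.ball 0 1) :=
  (analyticOnNhd_const.mul (slice₂ (partial₁_iterate hf j) zero_mem_ball)).congr
    Metric.isOpen_ball (coef_slice₁ hf j).symm

/-- Taking a coefficient in `z` is an iterated `∂₁` at `z = 0`, and this commutes with `∂₂`. -/
theorem deriv_coef_slice₁ {f : ℂ × ℂ → ℂ} (hf : AnalyticOnNhd ℂ f bidisc) (j : ℕ) :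
    EqOn (deriv fun w => coef (fun z => f (z, w)) j)
      (fun w => coef (fun z => partial₂ f (z, w)) j) (Metric.ball 0 1) := fun w hw => by
  have h := (coef_slice₁ hf j).eventuallyEq_of_mem (Metric.isOpen_ball.mem_nhds hw)
  rw [h.deriv_eq, deriv_const_mul _
    (slice₂ (partial₁_iterate hf j) zero_mem_ball w hw).differentiableAt,
    deriv_slice₂ (partial₁_iterate hf j) ⟨zero_mem_ball, hw⟩,
    ← partial₁_iterate_partial₂ hf j ⟨zero_mem_ball, hw⟩]
  exact (coef_slice₁ (analytic_partial₂ hf) j hw).symm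

theorem analytic_coef_slice₂ {f : ℂ × ℂ → ℂ} (hf : AnalyticOnNhd ℂ f bidisc) (k : ℕ) :
    AnalyticOnNhd ℂ (fun z => coef (fun w => f (z, w)) k) (Metric.ball 0 1) :=
  analytic_coef_slice₁ (analytic_swap hf) k

theorem deriv_coef_slice₂ {f : ℂ × ℂ → ℂ} (hf : AnalyticOnNhd ℂ f bidisc) (k : ℕ) :
    EqOn (deriv fun z => coef (fun w => f (z, w)) k)
      (fun z => coef (fun w => partial₁ f (z, w)) k) (Metric.ball 0 1) := fun z hz => by
  refine (deriv_coef_slice₁ (analytic_swap hf) k hz).trans (coef_congr (fun w hw => ?_) k)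
  exact (partial₁_swap (analytic_swap hf) (z := w) (w := z) ⟨hw, hz⟩).symm

/-- The Taylor coefficients of a function of two variables. -/
noncomputable def coef₂ (f : ℂ × ℂ → ℂ) (j k : ℕ) : ℂ :=
  coef (fun w => coef (fun z => f (z, w)) j) k

/-- Induction on `k`, applied to `∂₂ f`: both orders of extraction gain the same factor `k + 1`. For
`k = 0` both reduce to the slice at `w = 0`. -/
theorem coef₂_eq {f : ℂ × ℂ → ℂ} (hf : AnalyticOnNhd ℂ f bidisc) (j k : ℕ) :
    coef (fun z => coef (fun w => f (z, w)) k) j = coef₂ f j k := by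
  induction k generalizing f with
  | zero => simp only [coef₂, coef_zero]
  | succ k ih =>
    have hk : (k + 1 : ℂ) ≠ 0 := by exact_mod_cast k.succ_ne_zero
    have h1 : coef₂ (partial₂ f) j k = (k + 1) * coef₂ f j (k + 1) := by
      rw [coef₂, coef₂, ← coef_deriv]
      exact coef_congr (deriv_coef_slice₁ hf j).symm k
    have h2 : coef (fun z => coef (fun w => partial₂ f (z, w)) k) j =
        (k + 1) * coef (fun z => coef (fun w => f (z, w)) (k + 1)) j := by
      rw [← coef_const_mul (analytic_coef_slice₂ hf (k + 1))]
      refine coef_congr (fun z hz => ?_) j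
      rw [← coef_deriv]
      exact coef_congr (fun w hw => (deriv_slice₂ hf ⟨hz, hw⟩).symm) k
    rw [ih (analytic_partial₂ hf), h1] at h2
    exact (mul_left_cancel₀ hk h2).symm

theorem analytic_ev {h : ℕ → ℂ → ℂ}
    (hh : ∀ k, AnalyticOnNhd ℂ (h k) (Metric.ball 0 1)) (x : Idx) :
    AnalyticOnNhd ℂ (fun z => ev x fun k => h k z) (Metric.ball 0 1) :=
  Finset.analyticOnNhd_fun_sum _ fun k _ => analyticOnNhd_const.mul (hh k)

theorem coef_ev {h : ℕ → ℂ → ℂ}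
    (hh : ∀ k, AnalyticOnNhd ℂ (h k) (Metric.ball 0 1)) (x : Idx) (j : ℕ) :
    coef (fun z => ev x fun k => h k z) j = ev x fun k => coef (h k) j := by
  unfold ev
  rw [coef_sum _ (fun k => analyticOnNhd_const.mul (hh k))]
  exact Finset.sum_congr rfl fun k _ => coef_const_mul (hh k) _ j

theorem deriv_ev {h : ℕ → ℂ → ℂ}
    (hh : ∀ k, AnalyticOnNhd ℂ (h k) (Metric.ball 0 1)) (x : Idx) {z : ℂ} (hz : z ∈ Metric.ball (0 : ℂ) 1) :
    deriv (fun z => ev x fun k => h k z) z = ev x fun k => deriv (h k) z := by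
  unfold ev
  rw [deriv_fun_sum fun k _ => (analyticOnNhd_const.mul (hh k) z hz).differentiableAt]
  exact Finset.sum_congr rfl fun k _ => deriv_const_mul _ (hh k z hz).differentiableAt

theorem ev_comm (x y : Idx) (m : ℕ → ℕ → ℂ) :
    ev x (fun j => ev y fun k => m j k) = ev y fun k => ev x fun j => m j k := by
  simp only [ev, Finset.mul_sum]
  rw [Finset.sum_comm]
  exact Finset.sum_congr rfl fun k _ => Finset.sum_congr rfl fun j _ => by ring

end TwoVariableCoefficients

/-! ### The norm of `𝒟²` as an `L²` norm over a product measure. -/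

section TwoVariableNorm

theorem angleMean_tsum {F : ℕ → ℝ → ℝ≥0∞} (hF : ∀ k, Measurable (F k)) :
    angleMean (fun t => ∑' k, F k t) = ∑' k, angleMean (F k) := by
  unfold angleMean
  rw [lintegral_tsum fun k => (hF k).aemeasurable, ENNReal.tsum_mul_left]

theorem angleMean_mul_const {c : ℝ≥0∞} (hc : c ≠ ∞) (F : ℝ → ℝ≥0∞) :
    angleMean (fun t => F t * c) = angleMean F * c := by
  unfold angleMean
  rw [lintegral_mul_const' _ _ hc, mul_assoc]

theorem hardySq₂_eq {f : ℂ × ℂ → ℂ} (hf : AnalyticOnNhd ℂ f bidisc) :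
    hardySq₂ f = ∑' k, ∑' j, ‖coef₂ f j k‖ₑ ^ 2 := by
  rw [← ENNReal.tsum_prod' (f := fun p : ℕ × ℕ => ‖coef₂ f p.2 p.1‖ₑ ^ 2),
    ← radialLim_tsum (fun p : ℕ × ℕ => ‖coef₂ f p.2 p.1‖ₑ ^ 2) fun p => p.1 + p.2]
  refine radialLim_congr fun r h0 h1 => ?_
  have hx : ENNReal.ofReal (r ^ 2) ≠ ∞ := ENNReal.ofReal_ne_top
  have e1 : ∀ s, angleMean (fun t => ‖f (circleMap 0 r s, circleMap 0 r t)‖ₑ ^ 2) =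
      ∑' k, ‖coef (fun w => f (circleMap 0 r s, w)) k‖ₑ ^ 2 * ENNReal.ofReal (r ^ 2) ^ k := fun s =>
    angleMean_eq (slice₂ hf (circleMap_mem h0 h1 s)) h0 h1
  simp only [e1]
  rw [angleMean_tsum, ENNReal.tsum_prod']
  · refine tsum_congr fun k => ?_
    rw [angleMean_mul_const (ENNReal.pow_ne_top hx)]
    have e2 := angleMean_eq (analytic_coef_slice₂ hf k) h0 h1
    rw [e2, ← ENNReal.tsum_mul_right]
    refine tsum_congr fun j => ?_
    rw [← coef, coef₂_eq hf, pow_add]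
    ring
  · intro k
    have : Continuous fun s => coef (fun w => f (circleMap 0 r s, w)) k :=
      (analytic_coef_slice₂ hf k).continuousOn.comp_continuous (continuous_circleMap 0 r)
        (circleMap_mem h0 h1)
    exact (this.enorm.measurable.pow_const 2).mul_const _

/-- For fixed `z₁`, Parseval in the second variable expands the circle mean of `|∂₁ f|²`. The
coefficients of `∂₁ f(z₁, ·)` are the derivatives of the coefficient functions of `f`, so each term
is a one-variable Dirichlet-type integral. -/
theorem dirichlet₂₁_eq (μ : Measure (Metric.sphere (0 : ℂ) 1)) [IsFiniteMeasure μ]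
    {f : ℂ × ℂ → ℂ} (hf : AnalyticOnNhd ℂ f bidisc) :
    dirichlet₂₁ μ f = ∑' k, dirichlet₁ μ fun z => coef (fun w => f (z, w)) k := by
  rw [← radialLim_tsum _ id]
  refine radialLim_congr fun r h0 h1 => ?_
  have hx : ENNReal.ofReal (r ^ 2) ≠ ∞ := ENNReal.ofReal_ne_top
  have e1 : ∀ z ∈ Metric.ball (0 : ℂ) 1, ENNReal.ofReal (poisson μ z) *
      angleMean (fun t => ‖partial₁ f (z, circleMap 0 r t)‖ₑ ^ 2) =
      ∑' k, ENNReal.ofReal (poisson μ z) *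
        ‖deriv (fun z => coef (fun w => f (z, w)) k) z‖ₑ ^ 2 * ENNReal.ofReal (r ^ 2) ^ k := by
    intro z hz
    rw [angleMean_eq (slice₂ (analytic_partial₁ hf) hz) h0 h1, ← ENNReal.tsum_mul_left]
    refine tsum_congr fun k => ?_
    rw [deriv_coef_slice₂ hf k hz, ← coef, mul_assoc]
  rw [areaInt_congr e1]
  unfold areaInt dirichlet₁ areaInt
  rw [lintegral_tsum, ← ENNReal.tsum_mul_left]
  · refine tsum_congr fun k => ?_
    rw [lintegral_mul_const' _ _ (ENNReal.pow_ne_top hx), mul_assoc, id]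
  · intro k
    exact (((measurable_poisson μ).ennreal_ofReal.mul
      ((measurable_deriv _).enorm.pow_const 2)).mul_const _).aemeasurable

theorem dirichlet₂₂_eq (μ : Measure (Metric.sphere (0 : ℂ) 1)) [IsFiniteMeasure μ]
    {f : ℂ × ℂ → ℂ} (hf : AnalyticOnNhd ℂ f bidisc) :
    dirichlet₂₂ μ f = ∑' j, dirichlet₁ μ fun w => coef (fun z => f (z, w)) j := by
  have h := dirichlet₂₁_eq μ (analytic_swap hf)
  refine Eq.trans ?_ h
  refine radialLim_congr fun r h0 h1 => areaInt_congr fun z hz => ?_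
  congr 2
  ext t
  rw [partial₁_swap (z := circleMap 0 r t) hf ⟨circleMap_mem h0 h1 t, hz⟩]

variable (μ₁ μ₂ : Measure (Metric.sphere (0 : ℂ) 1)) [IsFiniteMeasure μ₁] [IsFiniteMeasure μ₂]

/-- The one-variable formula is used twice: first in `z₂` for `∂₁ f(z₁, ·)`, then, after Tonelli, in
`z₁` for the function obtained by applying `ev q` to the second-variable coefficients. -/
theorem dirichlet₂₃_eq {f : ℂ × ℂ → ℂ} (hf : AnalyticOnNhd ℂ f bidisc) :
    dirichlet₂₃ μ₁ μ₂ f = ∫⁻ q, ∫⁻ p, ‖ev (.inr p) fun j => ev (.inr q) fun k => coef₂ f j k‖ₑ ^ 2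
      ∂dirichletMeasure μ₁ ∂dirichletMeasure μ₂ := by
  set h : ℕ → ℂ → ℂ := fun k z => coef (fun w => f (z, w)) k with hdef
  have hh : ∀ k, AnalyticOnNhd ℂ (h k) (Metric.ball 0 1) := fun k => analytic_coef_slice₂ hf k
  have e1 : ∀ z ∈ Metric.ball (0 : ℂ) 1, areaInt (fun w => ENNReal.ofReal (poisson μ₁ z *
      poisson μ₂ w) * ‖partial₁ (partial₂ f) (z, w)‖ₑ ^ 2) =
      ∫⁻ q, ENNReal.ofReal (poisson μ₁ z) * ‖ev (.inr q) fun k => deriv (h k) z‖ₑ ^ 2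
        ∂dirichletMeasure μ₂ := by
    intro z hz
    -- Symmetry of mixed partials turns `∂₁ ∂₂ f(z, ·)` into the derivative of `∂₁ f(z, ·)`, so the
    -- inner integral is a Dirichlet-type integral in `z₂`.
    have e2 := dirichlet₁_eq_lintegral μ₂ (slice₂ (analytic_partial₁ hf) hz)
    rw [lintegral_const_mul' _ _ ENNReal.ofReal_ne_top]
    have e3 : coef (fun w => partial₁ f (z, w)) = fun k => deriv (h k) z := by
      ext k
      exact (deriv_coef_slice₂ hf k hz).symm
    rw [e3] at e2
    rw [← e2, dirichlet₁, ← areaInt_const_mul _ ENNReal.ofReal_ne_top]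
    refine areaInt_congr fun w hw => ?_
    rw [ENNReal.ofReal_mul (poisson_nonneg μ₁ hz), mul_assoc, partial_comm hf ⟨hz, hw⟩,
      deriv_slice₂ (analytic_partial₁ hf) ⟨hz, hw⟩]
  rw [dirichlet₂₃, areaInt_congr e1, areaInt]
  have hm : Measurable fun p : ℂ × (ℕ × Metric.sphere (0 : ℂ) 1) =>
      ENNReal.ofReal (poisson μ₁ p.1) * ‖ev (.inr p.2) fun k => deriv (h k) p.1‖ₑ ^ 2 :=
    ((measurable_poisson μ₁).comp measurable_fst).ennreal_ofReal.mul
      ((measurable_ev (measurable_inr.comp measurable_snd)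
        fun k => (measurable_deriv (h k)).comp measurable_fst).enorm.pow_const 2)
  rw [lintegral_lintegral_swap (f := fun z q => ENNReal.ofReal (poisson μ₁ z) *
    ‖ev (.inr q) fun k => deriv (h k) z‖ₑ ^ 2) hm.aemeasurable,
    ← lintegral_const_mul' _ _ ENNReal.ofReal_ne_top]
  refine lintegral_congr fun q => ?_
  change areaInt (fun z => ENNReal.ofReal (poisson μ₁ z) *
    ‖ev (.inr q) fun k => deriv (h k) z‖ₑ ^ 2) = _
  have e4 := dirichlet₁_eq_lintegral μ₁ (analytic_ev hh (.inr q))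
  have e5 : areaInt (fun z => ENNReal.ofReal (poisson μ₁ z) *
      ‖ev (.inr q) fun k => deriv (h k) z‖ₑ ^ 2) =
      dirichlet₁ μ₁ fun z => ev (.inr q) fun k => h k z :=
    areaInt_congr fun z hz => by rw [deriv_ev hh _ hz]
  rw [e5, e4]
  refine lintegral_congr fun p => ?_
  congr 3
  ext j
  rw [coef_ev hh]
  simp only [hdef, coef₂_eq hf]

/-- The functionals whose squared moduli add up to the norm of `𝒟²(μ₁ × μ₂)`. -/
noncomputable def ev₂ (p : Idx × Idx) (f : ℂ × ℂ → ℂ) : ℂ :=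
  ev p.1 fun j => ev p.2 fun k => coef₂ f j k

theorem measurable_ev₂ (f : ℂ × ℂ → ℂ) : Measurable fun p => ev₂ p f :=
  measurable_ev measurable_fst fun _ => measurable_ev measurable_snd fun _ => measurable_const

/-- Each index measure has a Hardy block and a Dirichlet block. The four blocks of the product
measure give the `H²` norm, `D₁`, `D₂` and `D₃`. -/
theorem norm_sq_eq_lintegral₂ {f : ℂ × ℂ → ℂ} (hf : AnalyticOnNhd ℂ f bidisc) :
    hardySq₂ f + dirichlet₂ μ₁ μ₂ f =
      ∫⁻ p, ‖ev₂ p f‖ₑ ^ 2 ∂(idxMeasure μ₁).prod (idxMeasure μ₂) := by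
  have hm : Measurable fun p => ‖ev₂ p f‖ₑ ^ 2 := (measurable_ev₂ f).enorm.pow_const 2
  rw [lintegral_prod_symm _ hm.aemeasurable, lintegral_idxMeasure]
  simp only [lintegral_idxMeasure]
  have hm1 : Measurable fun q : ℕ × Metric.sphere (0 : ℂ) 1 =>
      ∑' j : ℕ, ‖ev₂ (.inl j, .inr q) f‖ₑ ^ 2 := Measurable.tsum fun j =>
    hm.comp (measurable_const.prodMk measurable_inr)
  rw [lintegral_add_left hm1, ENNReal.tsum_add, hardySq₂_eq hf, dirichlet₂, dirichlet₂₁_eq μ₁ hf,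
    dirichlet₂₂_eq μ₂ hf, dirichlet₂₃_eq μ₁ μ₂ hf]
  have e1 : ∑' k, ∑' j, ‖ev₂ (.inl j, .inl k) f‖ₑ ^ 2 = ∑' k, ∑' j, ‖coef₂ f j k‖ₑ ^ 2 := by
    simp only [ev₂, ev_inl]
  have e2 : ∑' k, ∫⁻ p, ‖ev₂ (.inr p, .inl k) f‖ₑ ^ 2 ∂dirichletMeasure μ₁ =
      ∑' k, dirichlet₁ μ₁ fun z => coef (fun w => f (z, w)) k := by
    refine tsum_congr fun k => ?_
    rw [dirichlet₁_eq_lintegral μ₁ (analytic_coef_slice₂ hf k)]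
    simp only [ev₂, ev_inl, ← coef₂_eq hf]
  have e3 : ∫⁻ q, ∑' j, ‖ev₂ (.inl j, .inr q) f‖ₑ ^ 2 ∂dirichletMeasure μ₂ =
      ∑' j, dirichlet₁ μ₂ fun w => coef (fun z => f (z, w)) j := by
    have hm2 : ∀ j : ℕ, Measurable fun q : ℕ × Metric.sphere (0 : ℂ) 1 =>
        ‖ev₂ (.inl j, .inr q) f‖ₑ ^ 2 := fun j => hm.comp (measurable_const.prodMk measurable_inr)
    rw [lintegral_tsum fun j => (hm2 j).aemeasurable]
    refine tsum_congr fun j => ?_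
    rw [dirichlet₁_eq_lintegral μ₂ (analytic_coef_slice₁ hf j)]
    simp only [ev₂, ev_inl]
    rfl
  rw [e1, e2, e3]
  simp only [ev₂]
  ring

end TwoVariableNorm

/-! ### The coefficient functionals as linear maps on holomorphic functions. -/

section Functionals

/-- The functional `ev x`, on holomorphic functions on the disc. -/
noncomputable def evL (x : Idx) : holo (Metric.ball (0 : ℂ) 1) →ₗ[ℂ] ℂ where
  toFun f := ev x (coef f)
  map_add' f g := by
    rw [← ev_add]
    congr 1
    ext n
    exact coef_add f.2.1 g.2.1 n
  map_smul' c f := by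
    rw [RingHom.id_apply, smul_eq_mul, ← ev_const_mul]
    congr 1
    ext n
    exact coef_const_mul f.2.1 c n

theorem evL_apply (x : Idx) (f : holo (Metric.ball (0 : ℂ) 1)) : evL x f = ev x (coef f) := rfl

theorem measurable_evL (f : holo (Metric.ball (0 : ℂ) 1)) : Measurable fun x => evL x f :=
  measurable_ev measurable_id fun _ => measurable_const

theorem coef₂_add {f g : ℂ × ℂ → ℂ} (hf : AnalyticOnNhd ℂ f bidisc)
    (hg : AnalyticOnNhd ℂ g bidisc) (j k : ℕ) : coef₂ (f + g) j k = coef₂ f j k + coef₂ g j k := by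
  rw [coef₂, coef₂, coef₂, ← coef_add (analytic_coef_slice₁ hf j) (analytic_coef_slice₁ hg j)]
  exact coef_congr (fun w hw => coef_add (slice₁ hf hw) (slice₁ hg hw) j) k

theorem coef₂_smul {f : ℂ × ℂ → ℂ} (hf : AnalyticOnNhd ℂ f bidisc) (c : ℂ) (j k : ℕ) :
    coef₂ (c • f) j k = c * coef₂ f j k := by
  rw [coef₂, coef₂, ← coef_const_mul (analytic_coef_slice₁ hf j)]
  exact coef_congr (fun w hw => coef_const_mul (slice₁ hf hw) c j) k

/-- The functional `ev₂ p`, on holomorphic functions on the bidisc. -/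
noncomputable def evL₂ (p : Idx × Idx) : holo bidisc →ₗ[ℂ] ℂ where
  toFun f := ev₂ p f
  map_add' f g := by
    simp only [ev₂, ← ev_add, ← coef₂_add f.2.1 g.2.1]
    rfl
  map_smul' c f := by
    simp only [ev₂, RingHom.id_apply, smul_eq_mul, ← ev_const_mul, ← coef₂_smul f.2.1]
    rfl

theorem evL₂_apply (p : Idx × Idx) (f : holo bidisc) : evL₂ p f = ev₂ p f := rfl

theorem measurable_evL₂ (f : holo bidisc) : Measurable fun p => evL₂ p f := measurable_ev₂ f

end Functionals

/-! ### The space `𝒟(μ)`: completeness, kernel functions and multiplication by `z`. -/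

section OneVariable

variable (μ : Measure (Metric.sphere (0 : ℂ) 1)) [IsFiniteMeasure μ]

theorem energy_eq_lintegral (f : holo (Metric.ball (0 : ℂ) 1)) :
    hardySq₁ f + dirichlet₁ μ f = ∫⁻ x, ‖evL x f‖ₑ ^ 2 ∂idxMeasure μ :=
  norm_sq_eq_lintegral μ f.2.1

variable {μ}

theorem norm_le_of_enorm_sq_le {E : Type*} [NormedAddCommGroup E] {a : ℂ} {x : E}
    (h : ‖a‖ₑ ^ 2 ≤ ‖x‖ₑ ^ 2) : ‖a‖ ≤ ‖x‖ := by
  rw [← ofReal_norm, ← ofReal_norm, ← ENNReal.ofReal_pow (norm_nonneg _),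
    ← ENNReal.ofReal_pow (norm_nonneg _), ENNReal.ofReal_le_ofReal_iff (by positivity)] at h
  exact (pow_le_pow_iff_left₀ (norm_nonneg _) (norm_nonneg _) two_ne_zero).1 h

theorem norm_coef_le (f : DirichletSpace μ) (n : ℕ) : ‖coef f n‖ ≤ ‖f‖ := by
  refine norm_le_of_enorm_sq_le ?_
  rw [EnergySpace.enorm_sq, hardySq₁_eq f.val.2.1]
  exact (ENNReal.le_tsum n).trans le_self_add

theorem tendsto_ev {ι : Type*} {l : Filter ι} {u : ι → ℕ → ℂ} {a : ℕ → ℂ}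
    (h : ∀ n, Tendsto (fun i => u i n) l (𝓝 (a n))) (x : Idx) :
    Tendsto (fun i => ev x (u i)) l (𝓝 (ev x a)) :=
  tendsto_finsetSum _ fun n _ => (h n).const_mul _

theorem coef_sub_apply (f g : DirichletSpace μ) (n : ℕ) :
    coef (f - g : DirichletSpace μ) n = coef f n - coef g n := by
  have h := map_sub (evL (.inl n)) f.val g.val
  simp only [evL_apply, ev_inl] at h
  exact h

instance completeSpace_dirichletSpace : CompleteSpace (DirichletSpace μ) := by
  refine EnergySpace.completeSpace_of_pointwise_limits measurable_evL (energy_eq_lintegral μ)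
    fun u hu => ?_
  have hc : ∀ n, ∃ a, Tendsto (fun k => coef (u k) n) atTop (𝓝 a) := fun n => by
    refine cauchySeq_tendsto_of_complete (Metric.cauchySeq_iff.2 fun ε hε => ?_)
    obtain ⟨N, hN⟩ := Metric.cauchySeq_iff.1 hu ε hε
    refine ⟨N, fun k hk l hl => lt_of_le_of_lt ?_ (hN k hk l hl)⟩
    rw [dist_eq_norm, dist_eq_norm, ← coef_sub_apply]
    exact norm_coef_le _ n
  choose a ha using hc
  -- A Cauchy sequence is bounded, so the limiting coefficients are bounded and belong to a
  -- holomorphic function.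
  obtain ⟨C, hC⟩ := hu.norm_bddAbove
  obtain ⟨g, hg⟩ := exists_holo_coef (a := a) (C := C) fun n =>
    le_of_tendsto (ha n).norm (Eventually.of_forall fun k =>
      (norm_coef_le (u k) n).trans (hC ⟨k, rfl⟩))
  refine ⟨g, fun x => ?_⟩
  rw [evL_apply, hg]
  exact tendsto_ev ha x

/-- All coefficients are bounded by the norm, so a geometric series bounds point evaluation; the
Riesz theorem then yields kernel functions. -/
theorem norm_apply_le (f : DirichletSpace μ) {z : ℂ} (hz : z ∈ Metric.ball (0 : ℂ) 1) :
    ‖f z‖ ≤ (1 - ‖z‖)⁻¹ * ‖f‖ := by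
  have hz1 : ‖z‖ < 1 := by simpa using hz
  have hs := (hasSum_geometric_of_lt_one (norm_nonneg z) hz1).mul_right ‖f‖
  refine (hasSum_coef f.val.2.1 hz).norm_le_of_bounded hs fun n => ?_
  rw [norm_mul, norm_pow, mul_comm]
  gcongr
  exact norm_coef_le f n

/-- The kernel functions of `𝒟(μ)`. -/
theorem exists_kernel (μ : Measure (Metric.sphere (0 : ℂ) 1)) [IsFiniteMeasure μ] {w : ℂ}
    (hw : w ∈ Metric.ball (0 : ℂ) 1) :
    ∃ k : DirichletSpace μ, ∀ f : DirichletSpace μ, f w = inner ℂ k f := by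
  let L : DirichletSpace μ →ₗ[ℂ] ℂ :=
    { toFun := fun f => f w
      map_add' := fun f g => rfl
      map_smul' := fun c f => rfl }
  let L' : DirichletSpace μ →L[ℂ] ℂ := L.mkContinuous _ fun f => norm_apply_le f hw
  refine ⟨(InnerProductSpace.toDual ℂ _).symm L', fun f => ?_⟩
  rw [InnerProductSpace.toDual_symm_apply]
  rfl

/-- Multiplication by the coordinate function. -/
noncomputable def mulCoord :
    holo (Metric.ball (0 : ℂ) 1) →ₗ[ℂ] holo (Metric.ball (0 : ℂ) 1) where
  toFun f := ⟨fun z => z * f.1 z, analyticOnNhd_id.mul f.2.1, fun z hz => by simp [f.2.2 z hz]⟩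
  map_add' f g := by ext z; exact mul_add _ _ _
  map_smul' c f := by ext z; exact mul_left_comm _ _ _

theorem coef_mulCoord (f : holo (Metric.ball (0 : ℂ) 1)) : coef (mulCoord f) = shift (coef f) :=
  funext fun n => coef_id_mul f.2.1 n

theorem energy_mulCoord_le (f : holo (Metric.ball (0 : ℂ) 1)) :
    hardySq₁ (mulCoord f) + dirichlet₁ μ (mulCoord f) ≤
      (3 + 2 * circ μ univ) * (hardySq₁ f + dirichlet₁ μ f) := by
  rw [energy_eq_lintegral, energy_eq_lintegral]
  simp only [evL_apply, coef_mulCoord]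
  exact lintegral_ev_shift_le μ _

/-- Multiplication by `z` on `𝒟(μ)`. -/
noncomputable def mulZ (μ : Measure (Metric.sphere (0 : ℂ) 1)) [IsFiniteMeasure μ] :
    DirichletSpace μ →L[ℂ] DirichletSpace μ :=
  LinearMap.mkContinuous
    { toFun := fun f => (⟨mulCoord f.val, (energy_mulCoord_le f.val).trans_lt
        (ENNReal.mul_lt_top (by finiteness) f.energy_lt_top)⟩ : DirichletSpace μ)
      map_add' := fun f g => EnergySpace.val_injective (map_add mulCoord f.val g.val)
      map_smul' := fun c f => EnergySpace.val_injective (map_smul mulCoord c f.val) }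
    (Real.sqrt (3 + 2 * circ μ univ).toReal) fun f => by
      rw [EnergySpace.norm_def, EnergySpace.norm_def, ← Real.sqrt_mul ENNReal.toReal_nonneg,
        ← ENNReal.toReal_mul]
      refine Real.sqrt_le_sqrt (ENNReal.toReal_mono ?_ (energy_mulCoord_le f.val))
      exact (ENNReal.mul_lt_top (by finiteness) f.energy_lt_top).ne

theorem isTwoIsometry_mulZ : IsTwoIsometry (mulZ μ) := fun f => by
  have h := lintegral_ev_shift_shift μ (coef f)
  have e : ∀ g : DirichletSpace μ, ∫⁻ x, ‖ev x (coef g)‖ₑ ^ 2 ∂idxMeasure μ =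
      ENNReal.ofReal (‖g‖ ^ 2) := fun g => by
    rw [ENNReal.ofReal_pow (norm_nonneg _), ofReal_norm, EnergySpace.enorm_sq]
    exact (energy_eq_lintegral μ g.val).symm
  have e1 : coef (mulZ μ f) = shift (coef f) := coef_mulCoord f.val
  have e2 : coef (mulZ μ (mulZ μ f)) = shift (shift (coef f)) := by
    rw [← e1]; exact coef_mulCoord (mulZ μ f).val
  rw [← e2, ← e1, e, e, e, ← ENNReal.ofReal_add (by positivity) (by positivity),
    show (2 : ℝ≥0∞) = ENNReal.ofReal 2 by norm_num, ← ENNReal.ofReal_mul (by norm_num),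
    ENNReal.ofReal_eq_ofReal_iff (by positivity) (by positivity)] at h
  linarith

end OneVariable

/-! ### Double power series with bounded coefficients. -/

section TwoVariables

/-- A power series in two variables with bounded coefficients converges on the bidisc. -/
theorem exists_holo_coef₂ {a : ℕ → ℕ → ℂ} {C : ℝ} (ha : ∀ j k, ‖a j k‖ ≤ C) :
    ∃ f : holo bidisc, ∀ j k, coef₂ f j k = a j k := by
  -- The double series is reduced to two Banach-valued series in one variable: the rows of `a` in
  -- the space of bounded sequences, and the coordinate functionals in its dual.
  let row : ℕ → BoundedContinuousFunction ℕ ℂ := fun j =>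
    BoundedContinuousFunction.ofNormedAddCommGroupDiscrete (a j) C (ha j)
  have hrow : ∀ j, ‖row j‖ ≤ C := fun j =>
    (BoundedContinuousFunction.norm_le ((norm_nonneg _).trans (ha 0 0))).2 (ha j)
  let δ : ℕ → BoundedContinuousFunction ℕ ℂ →L[ℂ] ℂ := fun k =>
    BoundedContinuousFunction.evalCLM ℂ k
  have hδ : ∀ k, ‖δ k‖ ≤ 1 := fun k => ContinuousLinearMap.opNorm_le_bound _ zero_le_one fun g => by
    rw [one_mul]; exact g.norm_coe_le_norm k
  obtain ⟨hsr, har⟩ := analyticOnNhd_powerSeries hrow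
  obtain ⟨hsδ, haδ⟩ := analyticOnNhd_powerSeries (E := BoundedContinuousFunction ℕ ℂ →L[ℂ] ℂ) hδ
  -- The pairing of `∑ w^k δ_k` with `∑ z^j row_j`. A bounded bilinear map of analytic functions is
  -- analytic.
  set F : ℂ × ℂ → ℂ := fun p => (∑' k, p.2 ^ k • δ k) (∑' j, p.1 ^ j • row j) with hF
  have hFa : AnalyticOnNhd ℂ F bidisc := fun p hp => by
    have h1 : AnalyticAt ℂ (fun p : ℂ × ℂ => ∑' k, p.2 ^ k • δ k) p :=
      AnalyticAt.fun_comp (g := fun w : ℂ => ∑' k, w ^ k • δ k) (haδ p.2 hp.2) analyticAt_snd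
    have h2 : AnalyticAt ℂ (fun p : ℂ × ℂ => ∑' j, p.1 ^ j • row j) p :=
      AnalyticAt.fun_comp (g := fun z : ℂ => ∑' j, z ^ j • row j) (har p.1 hp.1) analyticAt_fst
    have h3 := (ContinuousLinearMap.id ℂ (BoundedContinuousFunction ℕ ℂ →L[ℂ] ℂ)).analyticAt_bilinear
      (∑' k, p.2 ^ k • δ k, ∑' j, p.1 ^ j • row j)
    exact h3.comp_of_eq (h1.prod h2) rfl
  have he : EqOn F (bidisc.indicator F) bidisc := fun p hp => (indicator_of_mem hp F).symm
  refine ⟨⟨bidisc.indicator F, hFa.congr isOpen_bidisc he, fun z hz => indicator_of_notMem hz F⟩,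
    fun j k => ?_⟩
  refine coef_eq_of_hasSum (fun w hw => ?_) k
  have hsw : HasSum (fun k => a j k * w ^ k) ((∑' k, w ^ k • δ k) (row j)) := by
    have := (hsδ w hw).hasSum.mapL (ContinuousLinearMap.apply ℂ ℂ (row j))
    refine this.congr_fun fun k => ?_
    exact mul_comm _ _
  have hc : coef (fun z => bidisc.indicator F (z, w)) j = (∑' k, w ^ k • δ k) (row j) := by
    refine coef_eq_of_hasSum (b := fun j => (∑' k, w ^ k • δ k) (row j)) (fun z hz => ?_) j
    rw [← he ⟨hz, hw⟩]
    refine ((hsr z hz).hasSum.mapL (∑' k, w ^ k • δ k)).congr_fun fun j => ?_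
    rw [map_smul, smul_eq_mul, mul_comm]
  change HasSum _ (coef (fun z => bidisc.indicator F (z, w)) j)
  rw [hc]
  exact hsw

end TwoVariables

/-! ### Completeness of `𝒟²(μ₁ × μ₂)`. -/

section BidiscSpace

variable (μ₁ μ₂ : Measure (Metric.sphere (0 : ℂ) 1)) [IsFiniteMeasure μ₁] [IsFiniteMeasure μ₂]

theorem energy_eq_lintegral₂ (f : holo bidisc) :
    hardySq₂ f + dirichlet₂ μ₁ μ₂ f =
      ∫⁻ p, ‖evL₂ p f‖ₑ ^ 2 ∂(idxMeasure μ₁).prod (idxMeasure μ₂) :=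
  norm_sq_eq_lintegral₂ μ₁ μ₂ f.2.1

variable {μ₁ μ₂}

theorem norm_coef₂_le (f : BidiscDirichletSpace μ₁ μ₂) (j k : ℕ) : ‖coef₂ f j k‖ ≤ ‖f‖ := by
  refine norm_le_of_enorm_sq_le ?_
  rw [EnergySpace.enorm_sq, hardySq₂_eq f.val.2.1]
  exact ((ENNReal.le_tsum j).trans (ENNReal.le_tsum (f := fun k => ∑' j, ‖coef₂ f j k‖ₑ ^ 2) k)).trans
    le_self_add

theorem coef₂_sub_apply (f g : BidiscDirichletSpace μ₁ μ₂) (j k : ℕ) :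
    coef₂ (f - g : BidiscDirichletSpace μ₁ μ₂) j k = coef₂ f j k - coef₂ g j k := by
  have h := map_sub (evL₂ (.inl j, .inl k)) f.val g.val
  simp only [evL₂_apply, ev₂, ev_inl] at h
  exact h

instance completeSpace_bidiscDirichletSpace : CompleteSpace (BidiscDirichletSpace μ₁ μ₂) := by
  refine EnergySpace.completeSpace_of_pointwise_limits measurable_evL₂ (energy_eq_lintegral₂ μ₁ μ₂)
    fun u hu => ?_
  have hc : ∀ j k, ∃ a, Tendsto (fun i => coef₂ (u i) j k) atTop (𝓝 a) := fun j k => by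
    refine cauchySeq_tendsto_of_complete (Metric.cauchySeq_iff.2 fun ε hε => ?_)
    obtain ⟨N, hN⟩ := Metric.cauchySeq_iff.1 hu ε hε
    refine ⟨N, fun i hi l hl => lt_of_le_of_lt ?_ (hN i hi l hl)⟩
    rw [dist_eq_norm, dist_eq_norm, ← coef₂_sub_apply]
    exact norm_coef₂_le _ j k
  choose a ha using hc
  obtain ⟨C, hC⟩ := hu.norm_bddAbove
  obtain ⟨g, hg⟩ := exists_holo_coef₂ (a := a) (C := C) fun j k =>
    le_of_tendsto (ha j k).norm (Eventually.of_forall fun i =>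
      (norm_coef₂_le (u i) j k).trans (hC ⟨i, rfl⟩))
  refine ⟨g, fun p => ?_⟩
  simp only [evL₂_apply, ev₂, hg]
  exact tendsto_ev (fun j => tendsto_ev (fun k => ha j k) _) _

end BidiscSpace

/-! ### Product functions and the isometry from the algebraic tensor product. -/

section Products

/-- The function `(z, w) ↦ f z * g w`. -/
def tensorFun (f g : holo (Metric.ball (0 : ℂ) 1)) : holo bidisc :=
  ⟨fun p => f.1 p.1 * g.1 p.2, fun p hp =>
    (AnalyticAt.fun_comp (g := f.1) (f.2.1 p.1 hp.1) analyticAt_fst).mul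
      (AnalyticAt.fun_comp (g := g.1) (g.2.1 p.2 hp.2) analyticAt_snd), fun p hp => by
    beta_reduce
    by_cases h1 : p.1 ∈ Metric.ball (0 : ℂ) 1
    · have h2 : p.2 ∉ Metric.ball (0 : ℂ) 1 := fun h2 => hp ⟨h1, h2⟩
      rw [g.2.2 _ h2, mul_zero]
    · rw [f.2.2 _ h1, zero_mul]⟩

theorem tensorFun_apply (f g : holo (Metric.ball (0 : ℂ) 1)) (p : ℂ × ℂ) :
    (tensorFun f g : ℂ × ℂ → ℂ) p = (f : ℂ → ℂ) p.1 * (g : ℂ → ℂ) p.2 := rfl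

theorem coef₂_tensorFun (f g : holo (Metric.ball (0 : ℂ) 1)) (j k : ℕ) :
    coef₂ (tensorFun f g) j k = coef f j * coef g k := by
  have h : ∀ w, coef (fun z => (tensorFun f g : ℂ × ℂ → ℂ) (z, w)) j =
      coef f j * (g : ℂ → ℂ) w := fun w => by
    simp only [tensorFun_apply, mul_comm _ ((g : ℂ → ℂ) w)]
    exact coef_const_mul f.2.1 _ j
  rw [coef₂]
  simp only [h]
  exact coef_const_mul g.2.1 _ k

theorem evL₂_tensorFun (f g : holo (Metric.ball (0 : ℂ) 1)) (p : Idx × Idx) :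
    evL₂ p (tensorFun f g) = evL p.1 f * evL p.2 g := by
  rw [evL₂_apply, ev₂, evL_apply, evL_apply]
  simp only [coef₂_tensorFun, ev_const_mul]
  simp only [mul_comm _ (ev p.2 _), ev_const_mul]

variable {μ₁ μ₂ : Measure (Metric.sphere (0 : ℂ) 1)} [IsFiniteMeasure μ₁] [IsFiniteMeasure μ₂]

/-- The functionals are multiplicative on products, so the integral over the product measure
factors; in particular products of elements of the two spaces lie in `𝒟²`. -/
theorem energy_tensorFun (f g : holo (Metric.ball (0 : ℂ) 1)) :
    hardySq₂ (tensorFun f g) + dirichlet₂ μ₁ μ₂ (tensorFun f g) =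
      (hardySq₁ f + dirichlet₁ μ₁ f) * (hardySq₁ g + dirichlet₁ μ₂ g) := by
  rw [energy_eq_lintegral₂, energy_eq_lintegral, energy_eq_lintegral,
    ← lintegral_prod_mul ((measurable_evL f).enorm.pow_const 2).aemeasurable
      ((measurable_evL g).enorm.pow_const 2).aemeasurable]
  simp only [evL₂_tensorFun, enorm_mul, mul_pow]

/-- The map `f ⊗ g ↦ f(z₁) g(z₂)`, as a bilinear map. -/
noncomputable def tensorBilin :
    DirichletSpace μ₁ →ₗ[ℂ] DirichletSpace μ₂ →ₗ[ℂ] BidiscDirichletSpace μ₁ μ₂ :=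
  LinearMap.mk₂ ℂ (fun f g => (⟨tensorFun f.val g.val, (energy_tensorFun f.val g.val).trans_lt
      (ENNReal.mul_lt_top f.energy_lt_top g.energy_lt_top)⟩ : BidiscDirichletSpace μ₁ μ₂))
    (fun _ _ _ => EnergySpace.val_injective (Subtype.ext (funext fun _ => add_mul _ _ _)))
    (fun _ _ _ => EnergySpace.val_injective (Subtype.ext (funext fun _ => mul_assoc _ _ _)))
    (fun _ _ _ => EnergySpace.val_injective (Subtype.ext (funext fun _ => mul_add _ _ _)))
    (fun _ _ _ => EnergySpace.val_injective (Subtype.ext (funext fun _ => mul_left_comm _ _ _)))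

theorem tensorBilin_val (f : DirichletSpace μ₁) (g : DirichletSpace μ₂) :
    (tensorBilin f g).val = tensorFun f.val g.val := rfl

theorem tensorBilin_apply (f : DirichletSpace μ₁) (g : DirichletSpace μ₂) (p : ℂ × ℂ) :
    tensorBilin f g p = f p.1 * g p.2 := rfl

theorem inner_tensorBilin (f f' : DirichletSpace μ₁) (g g' : DirichletSpace μ₂) :
    inner ℂ (tensorBilin f g) (tensorBilin f' g') = inner ℂ f f' * inner ℂ g g' := by
  rw [EnergySpace.inner_eq_integral measurable_evL₂ (energy_eq_lintegral₂ μ₁ μ₂),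
    EnergySpace.inner_eq_integral measurable_evL (energy_eq_lintegral μ₁),
    EnergySpace.inner_eq_integral measurable_evL (energy_eq_lintegral μ₂), ← integral_prod_mul]
  refine integral_congr_ae (Eventually.of_forall fun p => ?_)
  simp only [tensorBilin_val, evL₂_tensorFun, map_mul]
  ring

/-- The isometry `f ⊗ g ↦ f(z₁) g(z₂)` on the algebraic tensor product. -/
noncomputable def tensorIsometry (μ₁ μ₂ : Measure (Metric.sphere (0 : ℂ) 1)) [IsFiniteMeasure μ₁]
    [IsFiniteMeasure μ₂] :
    TensorProduct ℂ (DirichletSpace μ₁) (DirichletSpace μ₂) →ₗᵢ[ℂ] BidiscDirichletSpace μ₁ μ₂ :=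
  (TensorProduct.lift tensorBilin).isometryOfInner fun s t => by
    induction s with
    | zero => simp
    | add s s' hs hs' => rw [map_add, inner_add_left, inner_add_left, hs, hs']
    | tmul f g =>
      induction t with
      | zero => simp
      | add t t' ht ht' => rw [map_add, inner_add_right, inner_add_right, ht, ht']
      | tmul f' g' =>
        rw [TensorProduct.lift.tmul, TensorProduct.lift.tmul, inner_tensorBilin,
          TensorProduct.inner_tmul]

theorem tensorIsometry_tmul (f : DirichletSpace μ₁) (g : DirichletSpace μ₂) :
    tensorIsometry μ₁ μ₂ (f ⊗ₜ g) = tensorBilin f g := TensorProduct.lift.tmul f g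

end Products

/-! ### Slices of functions in `𝒟²`, the product kernel and density of products. -/

section Slices

variable {μ₁ μ₂ : Measure (Metric.sphere (0 : ℂ) 1)} [IsFiniteMeasure μ₁] [IsFiniteMeasure μ₂]

theorem notMem_bidisc_right {z w : ℂ} (hw : w ∉ Metric.ball (0 : ℂ) 1) : (z, w) ∉ bidisc :=
  fun h => hw h.2

theorem notMem_bidisc_left {z w : ℂ} (hz : z ∉ Metric.ball (0 : ℂ) 1) : (z, w) ∉ bidisc :=
  fun h => hz h.1

/-- The slice `z ↦ F(z, w)`. -/
def slice (F : holo bidisc) {w : ℂ} (hw : w ∈ Metric.ball (0 : ℂ) 1) :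
    holo (Metric.ball (0 : ℂ) 1) :=
  ⟨fun z => F.1 (z, w), slice₁ F.2.1 hw, fun _ hz => F.2.2 _ (notMem_bidisc_left hz)⟩

/-- The functional `evL x`, applied to a function of two variables in the first variable. -/
noncomputable def partialEv (x : Idx) (F : holo bidisc) : holo (Metric.ball (0 : ℂ) 1) :=
  ⟨fun w => ev x fun j => coef (fun z => F.1 (z, w)) j,
    analytic_ev (fun j => analytic_coef_slice₁ F.2.1 j) x, fun w hw => by
      have : (fun z => F.1 (z, w)) = fun _ => 0 :=
        funext fun z => F.2.2 _ (notMem_bidisc_right hw)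
      beta_reduce
      rw [this]
      have h0 : ∀ n, coef (fun _ => (0 : ℂ)) n = 0 := fun n => by simp [coef]
      simp only [h0, ev, mul_zero, Finset.sum_const_zero]⟩

theorem evL_partialEv (x y : Idx) (F : holo bidisc) : evL y (partialEv x F) = evL₂ (x, y) F := by
  rw [evL_apply, evL₂_apply, ev₂, ev_comm]
  congr 1
  ext k
  exact coef_ev (fun j => analytic_coef_slice₁ F.2.1 j) x k

/-- By Tonelli, almost every partial functional of `F` lies in `𝒟(μ₂)`, so that the reproducing
property can be applied to it in the second variable. -/
theorem ae_energy_partialEv_lt_top (F : BidiscDirichletSpace μ₁ μ₂) :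
    ∀ᵐ x ∂idxMeasure μ₁,
      hardySq₁ (partialEv x F.val) + dirichlet₁ μ₂ (partialEv x F.val) < ∞ := by
  have hm : Measurable fun p => ‖evL₂ p F.val‖ₑ ^ 2 := (measurable_evL₂ _).enorm.pow_const 2
  have h := F.energy_lt_top
  rw [energy_eq_lintegral₂, lintegral_prod _ hm.aemeasurable] at h
  refine (ae_lt_top hm.lintegral_prod_right' h.ne).mono fun x hx => ?_
  rw [energy_eq_lintegral]
  simpa only [evL_partialEv] using hx

/-- For almost every `x`, the value of `evL x` on the slice is the inner product of the kernel at
`w` with the partial functional. Cauchy-Schwarz, integrated in `x`, bounds the slice energy by `‖k‖²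
‖F‖²`. -/
theorem energy_slice_lt_top (F : BidiscDirichletSpace μ₁ μ₂) {w : ℂ}
    (hw : w ∈ Metric.ball (0 : ℂ) 1) :
    hardySq₁ (slice F.val hw) + dirichlet₁ μ₁ (slice F.val hw) < ∞ := by
  obtain ⟨k, hk⟩ := exists_kernel μ₂ hw
  have hm : Measurable fun p => ‖evL₂ p F.val‖ₑ ^ 2 := (measurable_evL₂ _).enorm.pow_const 2
  have h := F.energy_lt_top
  rw [energy_eq_lintegral₂, lintegral_prod _ hm.aemeasurable] at h
  refine lt_of_le_of_lt ?_ (ENNReal.mul_lt_top (by finiteness : ‖k‖ₑ ^ 2 < ∞) h)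
  rw [energy_eq_lintegral, ← lintegral_const_mul' _ _ (by finiteness)]
  refine lintegral_mono_ae ?_
  filter_upwards [ae_energy_partialEv_lt_top F] with x hx
  let g : DirichletSpace μ₂ := ⟨partialEv x F.val, hx⟩
  -- By definition the left side is the value at `w` of `partialEv x F.val`.
  have e1 : evL x (slice F.val hw) = inner ℂ k g := hk g
  have e2 : ∫⁻ y, ‖evL₂ (x, y) F.val‖ₑ ^ 2 ∂idxMeasure μ₂ = ‖g‖ₑ ^ 2 := by
    rw [EnergySpace.enorm_sq, energy_eq_lintegral]
    simp only [← evL_partialEv]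
    rfl
  rw [e1, e2, ← mul_pow]
  gcongr
  rw [← ofReal_norm, ← ofReal_norm, ← ofReal_norm, ← ENNReal.ofReal_mul (norm_nonneg _)]
  exact ENNReal.ofReal_le_ofReal (norm_inner_le_norm k g)

/-- The slice `z ↦ F(z, w)`, as an element of `𝒟(μ₁)`. -/
noncomputable def sliceSpace (F : BidiscDirichletSpace μ₁ μ₂) {w : ℂ} (hw : w ∈ Metric.ball (0 : ℂ) 1) :
    DirichletSpace μ₁ := ⟨slice F.val hw, energy_slice_lt_top F hw⟩

theorem sliceSpace_apply (F : BidiscDirichletSpace μ₁ μ₂) {w : ℂ}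
    (hw : w ∈ Metric.ball (0 : ℂ) 1) (z : ℂ) : sliceSpace F hw z = F (z, w) := rfl

/-- Fubini splits off the second variable, where the kernel `k` evaluates at `w`; the inner product
with the slice remains. -/
theorem inner_tensorBilin_kernel (F : BidiscDirichletSpace μ₁ μ₂) {w : ℂ}
    (hw : w ∈ Metric.ball (0 : ℂ) 1) {k : DirichletSpace μ₂}
    (hk : ∀ g : DirichletSpace μ₂, g w = inner ℂ k g) (f : DirichletSpace μ₁) :
    inner ℂ (tensorBilin f k) F = inner ℂ f (sliceSpace F hw) := by
  have hi : Integrable (fun p => (starRingEnd ℂ) (evL₂ p (tensorBilin f k).val) * evL₂ p F.val)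
      ((idxMeasure μ₁).prod (idxMeasure μ₂)) :=
    MemLp.integrable_mul (p := 2) (q := 2)
      (EnergySpace.memLp_of_eq_lintegral measurable_evL₂ (energy_eq_lintegral₂ μ₁ μ₂)
        (tensorBilin f k)).star
      (EnergySpace.memLp_of_eq_lintegral measurable_evL₂ (energy_eq_lintegral₂ μ₁ μ₂) F)
  rw [EnergySpace.inner_eq_integral measurable_evL₂ (energy_eq_lintegral₂ μ₁ μ₂),
    EnergySpace.inner_eq_integral measurable_evL (energy_eq_lintegral μ₁), integral_prod _ hi]
  refine integral_congr_ae ?_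
  filter_upwards [ae_energy_partialEv_lt_top F] with x hx
  let g : DirichletSpace μ₂ := ⟨partialEv x F.val, hx⟩
  have e1 : evL x (sliceSpace F hw).val = inner ℂ k g := hk g
  rw [e1, EnergySpace.inner_eq_integral measurable_evL (energy_eq_lintegral μ₂),
    ← integral_const_mul]
  refine integral_congr_ae (Eventually.of_forall fun y => ?_)
  simp only [tensorBilin_val, evL₂_tensorFun, map_mul, mul_assoc, ← evL_partialEv]
  rfl

/-- The reproducing kernel of `𝒟²(μ₁ × μ₂)` is the product of the kernels. -/
theorem apply_eq_inner_tensorBilin (F : BidiscDirichletSpace μ₁ μ₂) {z w : ℂ}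
    (hw : w ∈ Metric.ball (0 : ℂ) 1) {k₁ : DirichletSpace μ₁}
    (hk₁ : ∀ f : DirichletSpace μ₁, f z = inner ℂ k₁ f) {k₂ : DirichletSpace μ₂}
    (hk₂ : ∀ g : DirichletSpace μ₂, g w = inner ℂ k₂ g) :
    F (z, w) = inner ℂ (tensorBilin k₁ k₂) F := by
  rw [inner_tensorBilin_kernel F hw hk₂, ← hk₁, sliceSpace_apply]

/-- Orthogonality to all products includes orthogonality to `k₁ ⊗ k₂`, which means vanishing at the
corresponding point of the bidisc. -/
theorem denseRange_tensorIsometry : DenseRange (tensorIsometry μ₁ μ₂) := by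
  have h : (LinearMap.range (tensorIsometry μ₁ μ₂).toLinearMap).topologicalClosure = ⊤ := by
    rw [Submodule.topologicalClosure_eq_top_iff, Submodule.eq_bot_iff]
    intro F hF
    refine EnergySpace.val_injective (Subtype.ext (funext fun p => ?_))
    by_cases hp : p ∈ bidisc
    · obtain ⟨k₁, hk₁⟩ := exists_kernel μ₁ hp.1
      obtain ⟨k₂, hk₂⟩ := exists_kernel μ₂ hp.2
      refine (apply_eq_inner_tensorBilin F hp.2 hk₁ hk₂).trans ?_
      exact (Submodule.mem_orthogonal _ _).1 hF _ ⟨k₁ ⊗ₜ k₂, tensorIsometry_tmul k₁ k₂⟩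
    · exact F.val.2.2 p hp
  rw [← Submodule.dense_iff_topologicalClosure_eq_top] at h
  exact h

end Slices

/-! ### Operators determined by their action on elementary tensors, and the unitary extension. -/

section TensorOperators

open scoped TensorProduct

variable {E F H : Type*} [NormedAddCommGroup E] [InnerProductSpace ℂ E]
  [NormedAddCommGroup F] [InnerProductSpace ℂ F]
  [NormedAddCommGroup H] [InnerProductSpace ℂ H]
  {T : E ⊗[ℂ] F →ₗᵢ[ℂ] H}

theorem continuousLinearMap_ext_of_tmul {G : Type*} [NormedAddCommGroup G] [NormedSpace ℂ G]
    (hT : DenseRange T) {A B : H →L[ℂ] G} (h : ∀ f g, A (T (f ⊗ₜ g)) = B (T (f ⊗ₜ g))) : A = B := by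
  ext x
  refine hT.induction_on (p := fun x => A x = B x) x (isClosed_eq A.continuous B.continuous)
    fun t => ?_
  induction t with
  | zero => simp
  | add s t hs ht => simp only [map_add, hs, ht]
  | tmul f g => exact h f g

theorem inner_self_eq_ofReal (x : E) : inner ℂ x x = ((‖x‖ ^ 2 : ℝ) : ℂ) := by
  rw [inner_self_eq_norm_sq_to_K]
  simp

/-- The polarized identity. The quadratic identity cannot be checked on elementary tensors alone,
because it is not additive; the sesquilinear one can. -/
theorem IsTwoIsometry.inner_eq [CompleteSpace E] {S : E →L[ℂ] E} (hS : IsTwoIsometry S) (x y : E) :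
    inner ℂ (S (S x)) (S (S y)) - 2 * inner ℂ (S x) (S y) + inner ℂ x y = 0 := by
  set A : E →L[ℂ] E := ContinuousLinearMap.adjoint (S * S) * (S * S) -
    (2 : ℂ) • (ContinuousLinearMap.adjoint S * S) + 1 with hA
  have e : ∀ x y, inner ℂ x (A y) =
      inner ℂ (S (S x)) (S (S y)) - 2 * inner ℂ (S x) (S y) + inner ℂ x y := fun x y => by
    simp only [hA, add_apply, sub_apply, smul_apply, mul_apply_eq_comp,
      one_apply_eq_self, inner_add_right, inner_sub_right, inner_smul_right,
      ContinuousLinearMap.adjoint_inner_right]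
  -- Over `ℂ` an operator with vanishing quadratic form is zero; here it is the defect operator
  -- `S*²S² - 2S*S + I`.
  have h0 : (A : E →ₗ[ℂ] E) = 0 := by
    refine inner_map_self_eq_zero _ |>.1 fun x => ?_
    rw [← inner_conj_symm, ContinuousLinearMap.coe_coe, e]
    have := hS x
    simp only [inner_self_eq_ofReal]
    rw [map_eq_zero]
    exact_mod_cast this
  rw [← e]
  have : A y = 0 := LinearMap.congr_fun h0 y
  rw [this, inner_zero_right]

theorem isTwoIsometry_of_inner_eq {M : H →L[ℂ] H}
    (h : ∀ x y, inner ℂ (M (M x)) (M (M y)) - 2 * inner ℂ (M x) (M y) + inner ℂ x y = 0) :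
    IsTwoIsometry M := fun x => by
  have := h x x
  simp only [inner_self_eq_ofReal] at this
  exact_mod_cast this

theorem inner_form_eq_zero_of_tmul (hT : DenseRange T) (M : H →L[ℂ] H)
    (h : ∀ f g f' g', inner ℂ (M (M (T (f ⊗ₜ g)))) (M (M (T (f' ⊗ₜ g')))) -
      2 * inner ℂ (M (T (f ⊗ₜ g))) (M (T (f' ⊗ₜ g'))) + inner ℂ (T (f ⊗ₜ g)) (T (f' ⊗ₜ g')) = 0)
    (x y : H) :
    inner ℂ (M (M x)) (M (M y)) - 2 * inner ℂ (M x) (M y) + inner ℂ x y = 0 := by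
  refine hT.induction_on₂ (p := fun x y =>
    inner ℂ (M (M x)) (M (M y)) - 2 * inner ℂ (M x) (M y) + inner ℂ x y = 0)
    (isClosed_eq (by fun_prop) continuous_const) (fun s t => ?_) x y
  induction s with
  | zero => simp
  | add s s' hs hs' =>
    simp only [map_add, inner_add_left]
    linear_combination hs + hs'
  | tmul f g =>
    induction t with
    | zero => simp
    | add t t' ht ht' =>
      simp only [map_add, inner_add_right]
      linear_combination ht + ht'
    | tmul f' g' => exact h f g f' g'

/-- On elementary tensors the defect form of `M` is `⟨g, g'⟩` times that of `S`. -/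
theorem IsTwoIsometry.tensor_left [CompleteSpace E] (hT : DenseRange T) {S : E →L[ℂ] E} (hS : IsTwoIsometry S)
    {M : H →L[ℂ] H} (hM : ∀ f g, M (T (f ⊗ₜ g)) = T (S f ⊗ₜ g)) : IsTwoIsometry M :=
  isTwoIsometry_of_inner_eq (inner_form_eq_zero_of_tmul hT M fun f g f' g' => by
    simp only [hM, T.inner_map_map, TensorProduct.inner_tmul]
    linear_combination inner ℂ g g' * hS.inner_eq f f')

theorem IsTwoIsometry.tensor_right [CompleteSpace F] (hT : DenseRange T) {S : F →L[ℂ] F} (hS : IsTwoIsometry S)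
    {M : H →L[ℂ] H} (hM : ∀ f g, M (T (f ⊗ₜ g)) = T (f ⊗ₜ S g)) : IsTwoIsometry M :=
  isTwoIsometry_of_inner_eq (inner_form_eq_zero_of_tmul hT M fun f g f' g' => by
    simp only [hM, T.inner_map_map, TensorProduct.inner_tmul]
    linear_combination inner ℂ f f' * hS.inner_eq g g')

/-- The adjoint of `M₁` acts as `S₁* ⊗ I` on elementary tensors, as is seen by testing against the
dense range. Operators acting on different factors then commute. -/
theorem doublyCommuting_tensor [CompleteSpace E] [CompleteSpace H] (hT : DenseRange T)
    {S₁ : E →L[ℂ] E} {S₂ : F →L[ℂ] F}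
    {M₁ M₂ : H →L[ℂ] H} (h₁ : ∀ f g, M₁ (T (f ⊗ₜ g)) = T (S₁ f ⊗ₜ g))
    (h₂ : ∀ f g, M₂ (T (f ⊗ₜ g)) = T (f ⊗ₜ S₂ g)) : DoublyCommuting M₁ M₂ := by
  have hadj : ∀ f g, ContinuousLinearMap.adjoint M₁ (T (f ⊗ₜ g)) =
      T (ContinuousLinearMap.adjoint S₁ f ⊗ₜ g) := by
    intro f g
    refine ext_inner_right ℂ fun v => ?_
    have : (innerSL ℂ (T (f ⊗ₜ g))).comp M₁ =
        innerSL ℂ (T (ContinuousLinearMap.adjoint S₁ f ⊗ₜ g)) := by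
      refine continuousLinearMap_ext_of_tmul hT fun f' g' => ?_
      simp only [ContinuousLinearMap.comp_apply, innerSL_apply_apply, h₁, T.inner_map_map,
        TensorProduct.inner_tmul, ContinuousLinearMap.adjoint_inner_left]
    rw [ContinuousLinearMap.adjoint_inner_left]
    exact DFunLike.congr_fun this v
  refine ⟨continuousLinearMap_ext_of_tmul hT fun f g => ?_,
    continuousLinearMap_ext_of_tmul hT fun f g => ?_⟩
  · simp only [mul_apply_eq_comp, h₁, h₂]
  · simp only [mul_apply_eq_comp, h₂, hadj]

variable [CompleteSpace H]

/-- A densely defined isometry on the algebraic tensor product extends to a unitary. -/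
noncomputable def tensorUnitary (T : E ⊗[ℂ] F →ₗᵢ[ℂ] H) (hT : DenseRange T) :
    H ≃ₗᵢ[ℂ] HilbertTensor E F :=
  (LinearEquiv.refl ℂ (E ⊗[ℂ] F)).extendOfIsometry T.toLinearMap
    (UniformSpace.Completion.toComplL : E ⊗[ℂ] F →L[ℂ] HilbertTensor E F).toLinearMap hT
    UniformSpace.Completion.denseRange_coe fun t => by
      change ‖(t : HilbertTensor E F)‖ = ‖T t‖
      rw [UniformSpace.Completion.norm_coe, T.norm_map]

theorem tensorUnitary_apply (hT : DenseRange T) (t : E ⊗[ℂ] F) :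
    tensorUnitary T hT (T t) = (t : HilbertTensor E F) :=
  LinearEquiv.extendOfIsometry_eq ..

theorem tensorUnitary_symm_apply (hT : DenseRange T) (t : E ⊗[ℂ] F) :
    (tensorUnitary T hT).symm (t : HilbertTensor E F) = T t := by
  rw [← tensorUnitary_apply hT, LinearIsometryEquiv.symm_apply_apply]

/-- The operator on `H` that corresponds to `S₁ ⊗ S₂`. -/
noncomputable def transport (T : E ⊗[ℂ] F →ₗᵢ[ℂ] H) (hT : DenseRange T) (S₁ : E →L[ℂ] E)
    (S₂ : F →L[ℂ] F) : H →L[ℂ] H :=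
  ((tensorUnitary T hT).symm : HilbertTensor E F →L[ℂ] H) ∘L tensorOp S₁ S₂ ∘L
    (tensorUnitary T hT : H →L[ℂ] HilbertTensor E F)

theorem tensorUnitary_transport (hT : DenseRange T) (S₁ : E →L[ℂ] E) (S₂ : F →L[ℂ] F) (x : H) :
    tensorUnitary T hT (transport T hT S₁ S₂ x) = tensorOp S₁ S₂ (tensorUnitary T hT x) :=
  (tensorUnitary T hT).apply_symm_apply _

theorem transport_tmul (hT : DenseRange T) (S₁ : E →L[ℂ] E) (S₂ : F →L[ℂ] F) (f : E) (g : F) :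
    transport T hT S₁ S₂ (T (f ⊗ₜ g)) = T (S₁ f ⊗ₜ S₂ g) := by
  change (tensorUnitary T hT).symm (tensorOp S₁ S₂ (tensorUnitary T hT (T (f ⊗ₜ g)))) = _
  rw [tensorUnitary_apply, tensorOp, ContinuousLinearMap.completion_apply_coe,
    TensorProduct.mapL_tmul, tensorUnitary_symm_apply]

end TensorOperators

/-! ### Identification of the multiplication operators and of the kernels. -/

section Main

variable {μ₁ μ₂ : Measure (Metric.sphere (0 : ℂ) 1)} [IsFiniteMeasure μ₁] [IsFiniteMeasure μ₂]

/-- An operator that acts on products as a multiplication is a multiplication. -/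
theorem apply_eq_mul_of_tmul {M : BidiscDirichletSpace μ₁ μ₂ →L[ℂ] BidiscDirichletSpace μ₁ μ₂}
    {z : ℂ × ℂ} (hz : z ∈ bidisc) (c : ℂ)
    (h : ∀ f g, M (tensorIsometry μ₁ μ₂ (f ⊗ₜ g)) z = c * (tensorIsometry μ₁ μ₂ (f ⊗ₜ g)) z)
    (F : BidiscDirichletSpace μ₁ μ₂) : M F z = c * F z := by
  obtain ⟨k₁, hk₁⟩ := exists_kernel μ₁ hz.1
  obtain ⟨k₂, hk₂⟩ := exists_kernel μ₂ hz.2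
  have hk : ∀ F : BidiscDirichletSpace μ₁ μ₂, F z = innerSL ℂ (tensorBilin k₁ k₂) F := fun F =>
    apply_eq_inner_tensorBilin F hz.2 hk₁ hk₂
  -- Evaluation at `z` is the bounded functional given by the product kernel, so the multiplication
  -- formula only has to be compared on a dense set.
  have e : (innerSL ℂ (tensorBilin k₁ k₂)).comp M = c • innerSL ℂ (tensorBilin k₁ k₂) := by
    refine continuousLinearMap_ext_of_tmul denseRange_tensorIsometry fun f g => ?_
    rw [ContinuousLinearMap.comp_apply, smul_apply, ← hk, ← hk, smul_eq_mul,
      h]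
  rw [hk, hk]
  exact DFunLike.congr_fun e F

theorem mulZ_apply (f : DirichletSpace μ₁) (z : ℂ) : mulZ μ₁ f z = z * f z := rfl

open scoped Classical in
/-- The reproducing kernel of `𝒟(μ)`. -/
noncomputable def kernel (μ : Measure (Metric.sphere (0 : ℂ) 1)) [IsFiniteMeasure μ] (z w : ℂ) : ℂ :=
  if hw : w ∈ Metric.ball (0 : ℂ) 1 then (exists_kernel μ hw).choose z else 0

theorem exists_kernel_eq (μ : Measure (Metric.sphere (0 : ℂ) 1)) [IsFiniteMeasure μ] {w : ℂ}
    (hw : w ∈ Metric.ball (0 : ℂ) 1) : ∃ k : DirichletSpace μ, (∀ z, k z = kernel μ z w) ∧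
      ∀ f : DirichletSpace μ, f w = inner ℂ k f :=
  ⟨(exists_kernel μ hw).choose, fun z => by rw [kernel, dif_pos hw],
    (exists_kernel μ hw).choose_spec⟩

theorem isReproducingKernel_kernel (μ : Measure (Metric.sphere (0 : ℂ) 1)) [IsFiniteMeasure μ] :
    IsReproducingKernel (energy₁ μ) (kernel μ) := fun _ hw =>
  let ⟨k, h1, h2⟩ := exists_kernel_eq μ hw
  ⟨k, fun z _ => h1 z, h2⟩

theorem isReproducingKernel_mul_kernel (μ₁ μ₂ : Measure (Metric.sphere (0 : ℂ) 1))
    [IsFiniteMeasure μ₁] [IsFiniteMeasure μ₂] :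
    IsReproducingKernel (energy₂ μ₁ μ₂) fun z w => kernel μ₁ z.1 w.1 * kernel μ₂ z.2 w.2 := by
  intro w hw
  obtain ⟨k₁, h₁, hk₁⟩ := exists_kernel_eq μ₁ hw.1
  obtain ⟨k₂, h₂, hk₂⟩ := exists_kernel_eq μ₂ hw.2
  exact ⟨tensorBilin k₁ k₂, fun z _ => by rw [tensorBilin_apply, h₁, h₂],
    fun F => apply_eq_inner_tensorBilin F hw.2 hk₁ hk₂⟩

end Main

end DirichletType

theorem mainTheorem8 (μ₁ μ₂ : Measure (Metric.sphere (0 : ℂ) 1)) [IsFiniteMeasure μ₁]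
    [IsFiniteMeasure μ₂] :
    CompleteSpace (DirichletType.DirichletSpace μ₁) ∧
    CompleteSpace (DirichletType.DirichletSpace μ₂) ∧
    ∃ (_ : CompleteSpace (DirichletType.BidiscDirichletSpace μ₁ μ₂))
      (M₁ M₂ : DirichletType.BidiscDirichletSpace μ₁ μ₂ →L[ℂ]
        DirichletType.BidiscDirichletSpace μ₁ μ₂)
      (S₁ : DirichletType.DirichletSpace μ₁ →L[ℂ] DirichletType.DirichletSpace μ₁)
      (S₂ : DirichletType.DirichletSpace μ₂ →L[ℂ] DirichletType.DirichletSpace μ₂),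
      -- `M₁`, `M₂` are multiplication by `z₁`, `z₂`; `S₁`, `S₂` are multiplication by `z`
      (∀ f, ∀ z ∈ DirichletType.bidisc, M₁ f z = z.1 * f z) ∧
      (∀ f, ∀ z ∈ DirichletType.bidisc, M₂ f z = z.2 * f z) ∧
      (∀ f, ∀ z ∈ Metric.ball (0 : ℂ) 1, S₁ f z = z * f z) ∧
      (∀ f, ∀ z ∈ Metric.ball (0 : ℂ) 1, S₂ f z = z * f z) ∧
      DirichletType.IsTwoIsometry M₁ ∧ DirichletType.IsTwoIsometry M₂ ∧
      -- joint unitary equivalence with `(S₁ ⊗ I, I ⊗ S₂)`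
      (∃ U : DirichletType.BidiscDirichletSpace μ₁ μ₂ ≃ₗᵢ[ℂ]
          DirichletType.HilbertTensor (DirichletType.DirichletSpace μ₁)
            (DirichletType.DirichletSpace μ₂),
        (∀ f, U (M₁ f) = DirichletType.tensorOp S₁ (ContinuousLinearMap.id ℂ _) (U f)) ∧
        (∀ f, U (M₂ f) = DirichletType.tensorOp (ContinuousLinearMap.id ℂ _) S₂ (U f))) ∧
      DirichletType.DoublyCommuting M₁ M₂ ∧
      -- factorization of the reproducing kernel
      ∃ (K₁ K₂ : ℂ → ℂ → ℂ) (K : ℂ × ℂ → ℂ × ℂ → ℂ),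
        DirichletType.IsReproducingKernel (DirichletType.energy₁ μ₁) K₁ ∧
        DirichletType.IsReproducingKernel (DirichletType.energy₁ μ₂) K₂ ∧
        DirichletType.IsReproducingKernel (DirichletType.energy₂ μ₁ μ₂) K ∧
        ∀ z ∈ DirichletType.bidisc, ∀ w ∈ DirichletType.bidisc,
          K z w = K₁ z.1 w.1 * K₂ z.2 w.2 := by
  have hT := DirichletType.denseRange_tensorIsometry (μ₁ := μ₁) (μ₂ := μ₂)
  set T := DirichletType.tensorIsometry μ₁ μ₂
  have h₁ := fun f g => DirichletType.transport_tmul hT (DirichletType.mulZ μ₁)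
    (ContinuousLinearMap.id ℂ (DirichletType.DirichletSpace μ₂)) f g
  have h₂ := fun f g => DirichletType.transport_tmul hT
    (ContinuousLinearMap.id ℂ (DirichletType.DirichletSpace μ₁)) (DirichletType.mulZ μ₂) f g
  -- `M₁` and `M₂` are defined by carrying `M_z ⊗ I` and `I ⊗ M_z` back to `𝒟²`. The intertwining
  -- relations hold by construction, and the two remaining goals show that these operators multiply
  -- by the coordinates.
  refine ⟨inferInstance, inferInstance, inferInstance,
    DirichletType.transport T hT (DirichletType.mulZ μ₁) (ContinuousLinearMap.id ℂ _),
    DirichletType.transport T hT (ContinuousLinearMap.id ℂ _) (DirichletType.mulZ μ₂),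
    DirichletType.mulZ μ₁, DirichletType.mulZ μ₂, fun F z hz => ?_, fun F z hz => ?_,
    fun f z _ => DirichletType.mulZ_apply f z, fun f z _ => DirichletType.mulZ_apply f z,
    DirichletType.isTwoIsometry_mulZ.tensor_left hT h₁,
    DirichletType.isTwoIsometry_mulZ.tensor_right hT h₂,
    ⟨DirichletType.tensorUnitary T hT, DirichletType.tensorUnitary_transport hT _ _,
      DirichletType.tensorUnitary_transport hT _ _⟩,
    DirichletType.doublyCommuting_tensor hT h₁ h₂,
    DirichletType.kernel μ₁, DirichletType.kernel μ₂, _,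
    DirichletType.isReproducingKernel_kernel μ₁, DirichletType.isReproducingKernel_kernel μ₂,
    DirichletType.isReproducingKernel_mul_kernel μ₁ μ₂, fun _ _ _ _ => rfl⟩
  · refine DirichletType.apply_eq_mul_of_tmul hz z.1 (fun f g => ?_) F
    rw [h₁]
    simp only [T, DirichletType.tensorIsometry_tmul, DirichletType.tensorBilin_apply,
      DirichletType.mulZ_apply, ContinuousLinearMap.id_apply, mul_assoc]
  · refine DirichletType.apply_eq_mul_of_tmul hz z.2 (fun f g => ?_) F
    rw [h₂]
    simp only [T, DirichletType.tensorIsometry_tmul, DirichletType.tensorBilin_apply,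
      DirichletType.mulZ_apply, ContinuousLinearMap.id_apply, mul_left_comm]
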